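/- Let $r\ge 3$ be an integer with $r\not\equiv 4 \pmod 8$, and put $q=e^{2\pi\sqrt{-1}/r}$, $q^z=e^{2\pi\sqrt{-1}z/r}$ for $z\in\mathbb{C}$. For $n\ge 0$ let $[n]=\sum_{i=0}^{n-1}(-1)^{n+1+i}q^{n-1-2i}=\frac{q^{-n}-(-q)^n}{q+q^{-1}}$, let $[n]!=\prod_{i=1}^n[i]$, and let $\bar r$ be the least positive integer with $[\bar r]=0$. Let $U$ be the complex Hopf superalgebra (the restricted unrolled quantum group of $\mathfrak{osp}(1|2)$) generated by even $H,K^{\pm1}$ and odd $E,F$ with relations $KK^{-1}=K^{-1}K=1$, $HK^{\pm1}=K^{\pm1}H$, $HE-EH=2E$, $HF-FH=-2F$, $KE=q^2EK$, $KF=q^{-2}FK$, $EF+FE=\frac{K-K^{-1}}{q-q^{-1}}$, $E^{\bar r}=F^{\bar r}=0$, with coproduct $\Delta H=H\otimes 1+1\otimes H$, $\Delta K=K\otimes K$, $\Delta E=1\otimes E+E\otimes K$, $\Delta F=K^{-1}\otimes F+F\otimes 1$, counit $\epsilon(K)=1$, $\epsilon(H)=\epsilon(E)=\epsilon(F)=0$,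 and antipode $S(H)=-H$, $S(K)=K^{-1}$, $S(E)=-EK^{-1}$, $S(F)=-KF$. Let $\mathcal{C}$ be the $\mathbb{C}$-linear monoidal category of finite dimensional weight $U$-modules (super $U$-modules on which $H$ acts semisimply and $K$ acts by $q^\lambda$ on vectors of $H$-weight $\lambda$) and parity preserving $U$-linear maps. Give the dual $V^\vee$ the action $(x\cdot f)(v)=(-1)^{|f||x|}f(S(x)v)$. For $V,W\in\mathcal{C}$ let $c_{V,W}=\tau\circ\Upsilon\circ\tilde R: V\otimes W\to W\otimes V$, where $\tilde R$ is the action (with Koszul signs) of $\sum_{l=0}^{\bar r-1}(-1)^l\frac{q^{l(l-1)/2}(q-q^{-1})^l}{[l]!}E^l\otimes F^l$, $\Upsilon(v\otimes w)=q^{\lambda\mu/2}\,v\otimes w$ for $v,w$ of weights $\lambda,\mu$, and $\tau(v\otimes w)=(-1)^{|v||w|}w\otimes v$. Let $s\in\mathbb{Z}$ with $q^{2s}=1$, and consider the maps $$f\otimes v\mapsto f(v),\qquad 1\mapsto\sum_i v_i\otimes v_i^\vee,\qquad v\otimes f\mapsto(-1)^{|f||v|}f(K^{1-s}v),\qquad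 1\mapsto\sum_i(-1)^{|v_i|}v_i^\vee\otimes K^{s-1}v_i,$$ where $\{v_i\}$ is a homogeneous basis of $V$ with dual basis $\{v_i^\vee\}$. Then the maps $c_{V,W}$ form a braiding of $\mathcal{C}$, the four families of duality maps form a pivotal structure on $\mathcal{C}$ (left and right dualities whose duality functors coincide as monoidal functors), and the right partial traces $\theta_V=\operatorname{ptr}_R(c_{V,V})=(\mathrm{id}_V\otimes\overrightarrow{\mathrm{ev}}_V)(c_{V,V}\otimes\mathrm{id}_{V^\vee})(\mathrm{id}_V\otimes\overleftarrow{\mathrm{coev}}_V)$, where $\overleftarrow{\mathrm{coev}}_V$ and $\overrightarrow{\mathrm{ev}}_V$ are the second and third of these maps, form a natural automorphism $\theta$ of $\mathrm{id}_{\mathcal{C}}$. Moreover, $\theta$ makes $\mathcal{C}$ a $\mathbb{C}$-linear ribbon category (that is, $\mathcal{C}$ is abelian with $\mathbb{C}$-bilinear tensor product, the unit $\mathbb{I}$ is simple with $\mathbb{C}\to\mathrm{End}(\mathbb{I})$ an isomorphism, $\theta_{V\otimes W}=(\theta_V\otimes\theta_W)\,c_{W,V}\,c_{V,W}$ and $\theta_{V^\vee}=(\theta_V)^\vee$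 for all $V,W$) if and only if $s=\bar r$. -/

import Mathlib

open CategoryTheory MonoidalCategory
open scoped TensorProduct

noncomputable section

/-! ## Pivotal and ribbon categories -/

universe v u

/-- A pivotal structure on a monoidal category with prescribed dual objects `D V`: for every `V`
a left duality `ev : D V ⊗ V ⟶ 𝟙`, `coev : 𝟙 ⟶ V ⊗ D V` and a right duality
`V ⊗ D V ⟶ 𝟙`, `𝟙 ⟶ D V ⊗ V` (both satisfying the zig-zag identities), such that the left and
the right duality functors coincide as monoidal functors. -/
structure PivotalStructure {C : Type u} [Category.{v} C] [MonoidalCategory C] (D : C → C) where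
  left : ∀ V : C, ExactPairing V (D V)
  right : ∀ V : C, ExactPairing (D V) V
  mate_eq : ∀ {V W : C} (f : V ⟶ W),
    @rightAdjointMate C _ _ V W (@HasRightDual.mk C _ _ V (D V) (left V))
        (@HasRightDual.mk C _ _ W (D W) (left W)) f =
      @leftAdjointMate C _ _ V W (@HasLeftDual.mk C _ _ V (D V) (right V))
        (@HasLeftDual.mk C _ _ W (D W) (right W)) f
  tensor_eq : ∀ V W : C,
    (rightDualIso (@ExactPairing.tensor C _ _ V W (D V) (D W) (left V) (left W))
        (left (V ⊗ W))).hom =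
      (leftDualIso (@ExactPairing.tensor C _ _ (D W) (D V) W V (right W) (right V))
        (right (V ⊗ W))).hom
  unit_eq :
    (rightDualIso exactPairingUnit (left (𝟙_ C))).hom =
      (leftDualIso exactPairingUnit (right (𝟙_ C))).hom

namespace PivotalStructure

variable {C : Type u} [Category.{v} C] [MonoidalCategory C] {D : C → C}
  (P : PivotalStructure D)

/-- The left evaluation `V^∨ ⊗ V ⟶ 𝟙`. -/
def evL (V : C) : D V ⊗ V ⟶ 𝟙_ C := @ExactPairing.evaluation C _ _ V (D V) (P.left V)

/-- The left coevaluation `𝟙 ⟶ V ⊗ V^∨`. -/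
def coevL (V : C) : 𝟙_ C ⟶ V ⊗ D V := @ExactPairing.coevaluation C _ _ V (D V) (P.left V)

/-- The right evaluation `V ⊗ V^∨ ⟶ 𝟙`. -/
def evR (V : C) : V ⊗ D V ⟶ 𝟙_ C := @ExactPairing.evaluation C _ _ (D V) V (P.right V)

/-- The right coevaluation `𝟙 ⟶ V^∨ ⊗ V`. -/
def coevR (V : C) : 𝟙_ C ⟶ D V ⊗ V := @ExactPairing.coevaluation C _ _ (D V) V (P.right V)

/-- The dual `f^∨ : W^∨ ⟶ V^∨` of a morphism `f : V ⟶ W`. -/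
def dualMap {V W : C} (f : V ⟶ W) : D W ⟶ D V :=
  @rightAdjointMate C _ _ V W (@HasRightDual.mk C _ _ V (D V) (P.left V))
    (@HasRightDual.mk C _ _ W (D W) (P.left W)) f

/-- The right partial trace along `W`:
`(id_V ⊗ ev_W) ∘ (f ⊗ id_{W^∨}) ∘ (id_V ⊗ coev_W)`. -/
def ptr {V W : C} (f : V ⊗ W ⟶ V ⊗ W) : V ⟶ V :=
  (ρ_ V).inv ≫ V ◁ P.coevL W ≫ (α_ V W (D W)).inv ≫ f ▷ D W ≫ (α_ V W (D W)).hom ≫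
    V ◁ P.evR W ≫ (ρ_ V).hom

end PivotalStructure

/-- `θ` is a ribbon twist: `θ_{V ⊗ W} = (θ_V ⊗ θ_W) ∘ c_{W,V} ∘ c_{V,W}` and
`θ_{V^∨} = (θ_V)^∨`. -/
structure IsRibbonTwist {C : Type u} [Category.{v} C] [MonoidalCategory C] [BraidedCategory C]
    {D : C → C} (P : PivotalStructure D) (θ : 𝟭 C ≅ 𝟭 C) : Prop where
  balanced : ∀ V W : C, θ.hom.app (V ⊗ W) =
    (β_ V W).hom ≫ (β_ W V).hom ≫ (θ.hom.app V ⊗ₘ θ.hom.app W)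
  dual : ∀ V : C, θ.hom.app (D V) = P.dualMap (θ.hom.app V)

/-- A `ℂ`-linear ribbon category: a `ℂ`-linear abelian monoidal category with `ℂ`-bilinear
tensor product and simple unit such that `ℂ → End 𝟙` is an isomorphism, together with dualities, a
braiding and a compatible twist `θ`. -/
structure IsLinearRibbonCategory (C : Type u) [Category.{v} C] [inst : Preadditive C]
    [Linear ℂ C] [MonoidalCategory C] [MonoidalPreadditive C] [MonoidalLinear ℂ C]
    [BraidedCategory C] {D : C → C} (P : PivotalStructure D) (θ : 𝟭 C ≅ 𝟭 C) : Prop where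
  abelian : ∃ A : Abelian C, A.toPreadditive = inst
  simple_unit : Simple (𝟙_ C)
  end_unit : Function.Bijective (fun k : ℂ => k • 𝟙 (𝟙_ C))
  ribbon : IsRibbonTwist P θ

namespace Osp

/-! ## Super quantum integers -/

/-- `q^z = exp(2 π i z / r)`. -/
def qpow (r : ℕ) (z : ℂ) : ℂ := Complex.exp (2 * Real.pi * Complex.I * z / r)

/-- The super quantum integer `(v^{-n} - (-v)^n) / (v + v^{-1}) =
∑_{i < n} (-1)^{n+1+i} v^{n-1-2i}`, a Laurent polynomial in `v`, specialized at `v = q`. -/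
def superInt (r n : ℕ) : ℂ :=
  ∑ i ∈ Finset.range n, (-1) ^ (n + 1 + i) * qpow r ((n : ℂ) - 1 - 2 * i)

/-- The super quantum factorial. -/
def superFact (r n : ℕ) : ℂ := ∏ i ∈ Finset.range n, superInt r (i + 1)

/-- The least positive integer `n` whose super quantum integer vanishes (with value `0` when there is
none, which happens for `r = 4`). -/
def rbar (r : ℕ) : ℕ := sInf {n : ℕ | 0 < n ∧ superInt r n = 0}

lemma qpow_add (r : ℕ) (a b : ℂ) : qpow r (a + b) = qpow r a * qpow r b := by
  simp only [qpow, ← Complex.exp_add]; congr 1; ring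

lemma qpow_zero (r : ℕ) : qpow r 0 = 1 := by simp [qpow]

lemma qpow_neg_mul (r : ℕ) (a : ℂ) : qpow r (-a) * qpow r a = 1 := by
  rw [← qpow_add]; simp [qpow_zero]

lemma qpow_ne_zero (r : ℕ) (a : ℂ) : qpow r a ≠ 0 := Complex.exp_ne_zero _

lemma qpow_mul_nat (r : ℕ) (a : ℂ) (n : ℕ) : qpow r (a * n) = qpow r a ^ n := by
  simp only [qpow, ← Complex.exp_nat_mul]; congr 1; ring

lemma superInt_eq (r n : ℕ) (hn : 0 < n) :
    superInt r n = qpow r (1 - n) * ∑ i ∈ Finset.range n, (-qpow r 2) ^ i := by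
  unfold superInt
  rw [← Finset.sum_range_reflect, Finset.mul_sum]
  refine Finset.sum_congr rfl fun i hi => ?_
  have hi' : i < n := Finset.mem_range.mp hi
  have h1 : ((n - 1 - i : ℕ) : ℂ) = (n : ℂ) - 1 - i := by
    rw [Nat.cast_sub (by omega), Nat.cast_sub (by omega)]; simp
  have h2 : n + 1 + (n - 1 - i) + 2 * i = 2 * n + i := by omega
  have h3 : (-1 : ℂ) ^ (n + 1 + (n - 1 - i)) = (-1) ^ i := by
    have := congrArg (fun m => (-1 : ℂ) ^ m) h2
    simpa [pow_add, pow_mul] using this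
  rw [h1, h3, neg_pow (qpow r 2), ← qpow_mul_nat, mul_left_comm, ← qpow_add]
  congr 2; ring

/-! ### A `q`-binomial computation -/

/-- Gaussian binomial coefficients, indexed by `(k, j)` with `k + j = n`. -/
def gauss (w : ℂ) : ℕ → ℕ → ℂ
  | 0, _ => 1
  | _ + 1, 0 => 1
  | k + 1, j + 1 => gauss w k (j + 1) + w ^ (k + 1) * gauss w (k + 1) j

lemma gauss_fact (w : ℂ) (k j : ℕ) :
    (∏ i ∈ Finset.range k, ∑ m ∈ Finset.range (i + 1), w ^ m) *
      (∏ i ∈ Finset.range j, ∑ m ∈ Finset.range (i + 1), w ^ m) * gauss w k j =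
      ∏ i ∈ Finset.range (k + j), ∑ m ∈ Finset.range (i + 1), w ^ m := by
  induction k, j using gauss.induct with
  | case1 j => simp [gauss]
  | case2 k => simp [gauss]
  | case3 k j ih1 ih2 =>
    have key : (∑ m ∈ Finset.range (k + 1 + (j + 1)), w ^ m) =
        (∑ m ∈ Finset.range (k + 1), w ^ m) +
          w ^ (k + 1) * ∑ m ∈ Finset.range (j + 1), w ^ m := by
      rw [Finset.sum_range_add, Finset.mul_sum]
      simp [pow_add]
    simp only [Nat.succ_eq_add_one] at *
    rw [show k + 1 + (j + 1) = k + 1 + j + 1 by omega, Finset.prod_range_succ _ (k + 1 + j)]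
    have e1 : k + (j + 1) = k + 1 + j := by omega
    rw [e1] at ih1
    rw [show k + 1 + j + 1 = k + 1 + (j + 1) by omega, key]
    rw [gauss, mul_add, mul_add]
    congr 1
    · rw [← ih1, Finset.prod_range_succ _ k]; ring
    · rw [← ih2, Finset.prod_range_succ _ j]; ring

lemma add_pow_gauss {A : Type*} [Ring A] [Algebra ℂ A] (w : ℂ) (X Y : A)
    (h : Y * X = w • (X * Y)) (n : ℕ) :
    (X + Y) ^ n = ∑ p ∈ Finset.HasAntidiagonal.antidiagonal n, gauss w p.1 p.2 • (X ^ p.1 * Y ^ p.2) := by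
  have hk : ∀ k : ℕ, Y * X ^ k = w ^ k • (X ^ k * Y) := by
    intro k
    induction k with
    | zero => simp
    | succ k ih =>
      rw [pow_succ, ← mul_assoc, ih, smul_mul_assoc, mul_assoc, h, mul_smul_comm, smul_smul,
        ← mul_assoc, pow_succ]
  induction n with
  | zero => simp [gauss]
  | succ n ih =>
    have split : ∀ p ∈ Finset.HasAntidiagonal.antidiagonal (n + 1),
        gauss w p.1 p.2 • (X ^ p.1 * Y ^ p.2) =
          (if p.1 = 0 then 0 else gauss w (p.1 - 1) p.2) • (X ^ p.1 * Y ^ p.2) +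
          (if p.2 = 0 then 0 else w ^ p.1 * gauss w p.1 (p.2 - 1)) • (X ^ p.1 * Y ^ p.2) := by
      rintro ⟨k, j⟩ hp
      rw [← add_smul]
      congr 1
      rcases k with _ | k
      · rcases j with _ | j
        · simp at hp
        · simp [gauss]
      · rcases j with _ | j
        · rcases k with _ | k <;> simp [gauss]
        · simp [gauss]
    rw [Finset.sum_congr rfl split, Finset.sum_add_distrib, Finset.Nat.sum_antidiagonal_succ,
      Finset.Nat.sum_antidiagonal_succ', pow_succ', ih, add_mul, Finset.mul_sum, Finset.mul_sum]
    simp only [mul_smul_comm]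
    have e : ∀ p : ℕ × ℕ, Y * (X ^ p.1 * Y ^ p.2) = w ^ p.1 • (X ^ p.1 * Y ^ (p.2 + 1)) := by
      intro p
      rw [← mul_assoc, hk, smul_mul_assoc, mul_assoc, ← pow_succ']
    simp only [e, smul_smul, ← mul_assoc, ← pow_succ']
    simp [mul_comm]

lemma add_pow_eq_zero_of_root {A : Type*} [Ring A] [Algebra ℂ A] (w : ℂ) (X Y : A)
    (h : Y * X = w • (X * Y)) (n : ℕ) (hn : 0 < n)
    (h0 : ∑ m ∈ Finset.range n, w ^ m = 0)
    (h1 : ∀ k, 0 < k → k < n → ∑ m ∈ Finset.range k, w ^ m ≠ 0)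
    (hX : X ^ n = 0) (hY : Y ^ n = 0) : (X + Y) ^ n = 0 := by
  rw [add_pow_gauss w X Y h]
  refine Finset.sum_eq_zero ?_
  rintro ⟨k, j⟩ hp
  have hkj : k + j = n := by simpa using hp
  rcases Nat.eq_zero_or_pos k with rfl | hk
  · have : j = n := by omega
    subst this; simp [hY]
  rcases Nat.eq_zero_or_pos j with rfl | hj
  · have : k = n := by omega
    subst this; simp [hX]
  have hg := gauss_fact w k j
  have hz : ∏ i ∈ Finset.range (k + j), ∑ m ∈ Finset.range (i + 1), w ^ m = 0 := by
    refine Finset.prod_eq_zero (i := n - 1) (by simp; omega) ?_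
    rw [Nat.sub_add_cancel hn, h0]
  have hnz : ∀ l, l < n → ∏ i ∈ Finset.range l, ∑ m ∈ Finset.range (i + 1), w ^ m ≠ 0 := by
    intro l hl
    refine Finset.prod_ne_zero_iff.mpr fun i hi => h1 _ (by omega) ?_
    have := Finset.mem_range.mp hi
    omega
  rw [hz] at hg
  have : gauss w k j = 0 := by
    rcases mul_eq_zero.mp hg with h' | h'
    · exact absurd h' (mul_ne_zero (hnz k (by omega)) (hnz j (by omega)))
    · exact h'
  simp [this]

lemma rbar_spec (r : ℕ) (h : rbar r ≠ 0) : superInt r (rbar r) = 0 :=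
  (Nat.sInf_mem (Nat.nonempty_of_pos_sInf (Nat.pos_of_ne_zero h))).2

lemma rbar_min (r k : ℕ) (hk : 0 < k) (hk' : k < rbar r) : superInt r k ≠ 0 := fun h =>
  Nat.notMem_of_lt_sInf hk' ⟨hk, h⟩

lemma add_pow_rbar {A : Type*} [Ring A] [Algebra ℂ A] (r : ℕ) (X Y : A)
    (h : Y * X = (-qpow r 2) • (X * Y)) (hr : rbar r ≠ 0)
    (hX : X ^ rbar r = 0) (hY : Y ^ rbar r = 0) : (X + Y) ^ rbar r = 0 := by
  have hp := Nat.pos_of_ne_zero hr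
  refine add_pow_eq_zero_of_root _ X Y h _ hp ?_ ?_ hX hY
  · have := rbar_spec r hr
    rw [superInt_eq r _ hp] at this
    exact (mul_eq_zero.mp this).resolve_left (qpow_ne_zero _ _)
  · intro k hk hk' h'
    apply rbar_min r k hk hk'
    rw [superInt_eq r k hk, h', mul_zero]

lemma mul_pow_eq_zero_of_skew {A : Type*} [Ring A] [Algebra ℂ A] (c : ℂ) (X Y : A)
    (h : Y * X = c • (X * Y)) (n : ℕ) (hn : X ^ n = 0 ∨ Y ^ n = 0) : (X * Y) ^ n = 0 := by
  have hk : ∀ k : ℕ, Y ^ k * X = c ^ k • (X * Y ^ k) := by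
    intro k
    induction k with
    | zero => simp
    | succ k ih =>
      rw [pow_succ, mul_assoc, h, mul_smul_comm, ← mul_assoc, ih, smul_mul_assoc, smul_smul,
        mul_assoc, pow_succ, mul_comm]
  have : ∀ m : ℕ, ∃ d : ℂ, (X * Y) ^ m = d • (X ^ m * Y ^ m) := by
    intro m
    induction m with
    | zero => exact ⟨1, by simp⟩
    | succ m ih =>
      obtain ⟨d, hd⟩ := ih
      refine ⟨d * c ^ m, ?_⟩
      rw [pow_succ, hd, smul_mul_assoc, mul_assoc, ← mul_assoc (Y ^ m), hk, smul_mul_assoc,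
        mul_smul_comm, smul_smul, pow_succ X, pow_succ Y]
      simp only [mul_assoc]
  obtain ⟨d, hd⟩ := this n
  rcases hn with hn | hn <;> simp [hd, hn]

/-! ## The restricted unrolled quantum group -/

/-- The generators. -/
inductive Gen
  | H
  | K
  | Kinv
  | E
  | F

/-- Elements of a `ℂ`-algebra satisfying the defining relations of the restricted unrolled quantum group
of `osp(1|2)`; `E` and `F` are odd, so `[E, F] = E F + F E`.
For `r = 4`, when no super quantum integer vanishes, no nilpotency relation is imposed. -/
structure Relations (r : ℕ) {A : Type*} [Ring A] [Algebra ℂ A] (H K Kinv E F : A) : Prop where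
  HK : H * K = K * H
  HKinv : H * Kinv = Kinv * H
  HE : H * E - E * H = (2 : ℂ) • E
  HF : H * F - F * H = (-2 : ℂ) • F
  KKinv : K * Kinv = 1
  KinvK : Kinv * K = 1
  KE : K * E = qpow r 2 • (E * K)
  KF : K * F = qpow r (-2) • (F * K)
  EF : E * F + F * E = (qpow r 1 - qpow r (-1))⁻¹ • (K - Kinv)
  nilE : rbar r ≠ 0 → E ^ rbar r = 0
  nilF : rbar r ≠ 0 → F ^ rbar r = 0

open FreeAlgebra in
/-- The defining relations on the free algebra on the generators. -/
inductive Rel (r : ℕ) : FreeAlgebra ℂ Gen → FreeAlgebra ℂ Gen → Prop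
  | HK : Rel r (ι ℂ Gen.H * ι ℂ Gen.K) (ι ℂ Gen.K * ι ℂ Gen.H)
  | HKinv : Rel r (ι ℂ Gen.H * ι ℂ Gen.Kinv) (ι ℂ Gen.Kinv * ι ℂ Gen.H)
  | HE : Rel r (ι ℂ Gen.H * ι ℂ Gen.E - ι ℂ Gen.E * ι ℂ Gen.H) ((2 : ℂ) • ι ℂ Gen.E)
  | HF : Rel r (ι ℂ Gen.H * ι ℂ Gen.F - ι ℂ Gen.F * ι ℂ Gen.H) ((-2 : ℂ) • ι ℂ Gen.F)
  | KKinv : Rel r (ι ℂ Gen.K * ι ℂ Gen.Kinv) 1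
  | KinvK : Rel r (ι ℂ Gen.Kinv * ι ℂ Gen.K) 1
  | KE : Rel r (ι ℂ Gen.K * ι ℂ Gen.E) (qpow r 2 • (ι ℂ Gen.E * ι ℂ Gen.K))
  | KF : Rel r (ι ℂ Gen.K * ι ℂ Gen.F) (qpow r (-2) • (ι ℂ Gen.F * ι ℂ Gen.K))
  | EF : Rel r (ι ℂ Gen.E * ι ℂ Gen.F + ι ℂ Gen.F * ι ℂ Gen.E)
      ((qpow r 1 - qpow r (-1))⁻¹ • (ι ℂ Gen.K - ι ℂ Gen.Kinv))
  | nilE : rbar r ≠ 0 → Rel r (ι ℂ Gen.E ^ rbar r) 0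
  | nilF : rbar r ≠ 0 → Rel r (ι ℂ Gen.F ^ rbar r) 0

/-- The restricted unrolled quantum group of `osp(1|2)` at `q = exp(2 π i / r)`. -/
abbrev QGroup (r : ℕ) : Type := RingQuot (Rel r)

/-- The class of a generator in the quantum group. -/
def gen (r : ℕ) (x : Gen) : QGroup r := RingQuot.mkAlgHom ℂ (Rel r) (FreeAlgebra.ι ℂ x)

lemma relations_gen (r : ℕ) :
    Relations r (gen r .H) (gen r .K) (gen r .Kinv) (gen r .E) (gen r .F) where
  HK := by simpa [gen] using RingQuot.mkAlgHom_rel ℂ (Rel.HK (r := r))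
  HKinv := by simpa [gen] using RingQuot.mkAlgHom_rel ℂ (Rel.HKinv (r := r))
  HE := by simpa only [gen, map_sub, map_mul, map_smul] using
    RingQuot.mkAlgHom_rel ℂ (Rel.HE (r := r))
  HF := by simpa only [gen, map_sub, map_mul, map_smul] using
    RingQuot.mkAlgHom_rel ℂ (Rel.HF (r := r))
  KKinv := by simpa [gen] using RingQuot.mkAlgHom_rel ℂ (Rel.KKinv (r := r))
  KinvK := by simpa [gen] using RingQuot.mkAlgHom_rel ℂ (Rel.KinvK (r := r))
  KE := by simpa only [gen, map_sub, map_mul, map_smul] using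
    RingQuot.mkAlgHom_rel ℂ (Rel.KE (r := r))
  KF := by simpa only [gen, map_sub, map_mul, map_smul] using
    RingQuot.mkAlgHom_rel ℂ (Rel.KF (r := r))
  EF := by simpa only [gen, map_sub, map_add, map_mul, map_smul] using
    RingQuot.mkAlgHom_rel ℂ (Rel.EF (r := r))
  nilE h := by simpa only [gen, map_pow, map_zero] using
    RingQuot.mkAlgHom_rel ℂ (Rel.nilE (r := r) h)
  nilF h := by simpa only [gen, map_pow, map_zero] using
    RingQuot.mkAlgHom_rel ℂ (Rel.nilF (r := r) h)

lemma Relations.map {r : ℕ} {A B : Type*} [Ring A] [Algebra ℂ A] [Ring B] [Algebra ℂ B]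
    {H K Ki E F : A} (h : Relations r H K Ki E F) (f : A →ₐ[ℂ] B) :
    Relations r (f H) (f K) (f Ki) (f E) (f F) where
  HK := by rw [← map_mul, h.HK, map_mul]
  HKinv := by rw [← map_mul, h.HKinv, map_mul]
  HE := by rw [← map_mul, ← map_mul, ← map_sub, h.HE, map_smul]
  HF := by rw [← map_mul, ← map_mul, ← map_sub, h.HF, map_smul]
  KKinv := by rw [← map_mul, h.KKinv, map_one]
  KinvK := by rw [← map_mul, h.KinvK, map_one]
  KE := by rw [← map_mul, h.KE, map_smul, map_mul]
  KF := by rw [← map_mul, h.KF, map_smul, map_mul]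
  EF := by rw [← map_mul, ← map_mul, ← map_add, h.EF, map_smul, map_sub]
  nilE hr := by rw [← map_pow, h.nilE hr, map_zero]
  nilF hr := by rw [← map_pow, h.nilF hr, map_zero]

/-- The assignment of the generators underlying `lift`. -/
def genFun {A : Type*} (H K Kinv E F : A) : Gen → A
  | .H => H
  | .K => K
  | .Kinv => Kinv
  | .E => E
  | .F => F

/-- The universal property of the quantum group. -/
def lift {r : ℕ} {A : Type*} [Ring A] [Algebra ℂ A] {H K Kinv E F : A}
    (h : Relations r H K Kinv E F) : QGroup r →ₐ[ℂ] A :=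
  RingQuot.liftAlgHom ℂ ⟨FreeAlgebra.lift ℂ (genFun H K Kinv E F), by
    intro x y hxy
    cases hxy with
    | HK => simpa [genFun] using h.HK
    | HKinv => simpa [genFun] using h.HKinv
    | HE => simpa only [genFun, map_sub, map_mul, map_smul, FreeAlgebra.lift_ι_apply] using h.HE
    | HF => simpa only [genFun, map_sub, map_mul, map_smul, FreeAlgebra.lift_ι_apply] using h.HF
    | KKinv => simpa [genFun] using h.KKinv
    | KinvK => simpa [genFun] using h.KinvK
    | KE => simpa only [genFun, map_mul, map_smul, FreeAlgebra.lift_ι_apply] using h.KE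
    | KF => simpa only [genFun, map_mul, map_smul, FreeAlgebra.lift_ι_apply] using h.KF
    | EF => simpa only [genFun, map_sub, map_add, map_mul, map_smul, FreeAlgebra.lift_ι_apply]
        using h.EF
    | nilE hr => simpa only [genFun, map_pow, map_zero, FreeAlgebra.lift_ι_apply] using h.nilE hr
    | nilF hr => simpa only [genFun, map_pow, map_zero, FreeAlgebra.lift_ι_apply] using h.nilF hr⟩

@[simp] lemma lift_gen {r : ℕ} {A : Type*} [Ring A] [Algebra ℂ A] {H K Kinv E F : A}
    (h : Relations r H K Kinv E F) (x : Gen) : lift h (gen r x) = genFun H K Kinv E F x := by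
  simp [lift, gen]

lemma qgroup_induction {r : ℕ} {p : QGroup r → Prop}
    (hc : ∀ c : ℂ, p (algebraMap ℂ _ c)) (hg : ∀ x : Gen, p (gen r x))
    (hm : ∀ a b, p a → p b → p (a * b)) (ha : ∀ a b, p a → p b → p (a + b)) (x : QGroup r) :
    p x := by
  obtain ⟨y, rfl⟩ := RingQuot.mkAlgHom_surjective ℂ (Rel r) x
  induction y using FreeAlgebra.induction with
  | grade0 c => simpa using hc c
  | grade1 x => exact hg x
  | mul a b iha ihb => rw [map_mul]; exact hm _ _ iha ihb
  | add a b iha ihb => rw [map_add]; exact ha _ _ iha ihb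

/-- `K` as a unit of the quantum group. -/
def Kunit (r : ℕ) : (QGroup r)ˣ where
  val := gen r .K
  inv := gen r .Kinv
  val_inv := (relations_gen r).KKinv
  inv_val := (relations_gen r).KinvK

/-! ## Weight modules -/

lemma weight_of_span {r : ℕ} {V : Type*} [AddCommGroup V] [Module ℂ V] (H K : Module.End ℂ V)
    (h : ⨆ μ : ℂ, H.eigenspace μ ⊓ K.eigenspace (qpow r μ) = ⊤) :
    (⨆ μ : ℂ, H.eigenspace μ = ⊤) ∧ ∀ (μ : ℂ) (v : V), H v = μ • v → K v = qpow r μ • v := by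
  refine ⟨top_le_iff.mp (h ▸ iSup_mono fun μ => inf_le_left), fun μ v hv => ?_⟩
  have hv' : v ∈ (⊤ : Submodule ℂ V) := trivial
  rw [← h, iSup_split_single _ μ, Submodule.mem_sup] at hv'
  obtain ⟨a, ha, b, hb, rfl⟩ := hv'
  have hb1 : b ∈ H.eigenspace μ := by
    have h1 : a + b ∈ H.eigenspace μ := Module.End.mem_eigenspace_iff.mpr hv
    simpa using Submodule.sub_mem _ h1 ha.1
  have hb2 : b ∈ ⨆ (ν : ℂ) (_ : ν ≠ μ), H.eigenspace ν :=
    (iSup₂_mono (fun ν _ => inf_le_left) :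
      (⨆ (ν : ℂ) (_ : ν ≠ μ), H.eigenspace ν ⊓ K.eigenspace (qpow r ν)) ≤ _) hb
  have hb0 : b = 0 := by
    have := (Submodule.disjoint_def.mp (H.eigenspaces_iSupIndep μ)) b hb1 hb2
    exact this
  subst hb0
  simpa using Module.End.mem_eigenspace_iff.mp ha.2

/-- The finite set of eigenvalues of an endomorphism. -/
def eigs {V : Type*} [AddCommGroup V] [Module ℂ V] [FiniteDimensional ℂ V]
    (H : Module.End ℂ V) : Finset ℂ := H.finite_hasEigenvalue.toFinset

/-- For a diagonalizable `H` and an eigenvalue `μ`, the projection onto the `μ`-eigenspace along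
the other eigenspaces (a Lagrange interpolation polynomial in `H`). -/
def eigProj {V : Type*} [AddCommGroup V] [Module ℂ V] [FiniteDimensional ℂ V]
    (H : Module.End ℂ V) (μ : ℂ) : Module.End ℂ V :=
  Polynomial.aeval H (Lagrange.basis (eigs H) id μ)

lemma ext_eig {V W : Type*} [AddCommGroup V] [Module ℂ V]
    [AddCommGroup W] [Module ℂ W] {H : Module.End ℂ V}
    (hd : ⨆ μ : ℂ, H.eigenspace μ = ⊤) {f g : V →ₗ[ℂ] W}
    (h : ∀ (μ : ℂ) (v : V), H v = μ • v → f v = g v) : f = g := by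
  ext v
  have hv : v ∈ ⨆ μ : ℂ, H.eigenspace μ := hd ▸ trivial
  induction hv using Submodule.iSup_induction' with
  | mem μ v hv => exact h μ v (Module.End.mem_eigenspace_iff.mp hv)
  | zero => simp
  | add x y _ _ hx hy => simp [hx, hy]

section

variable {V : Type*} [AddCommGroup V] [Module ℂ V] [FiniteDimensional ℂ V]

lemma mem_eigs {H : Module.End ℂ V} {μ : ℂ} {v : V} (hv : H v = μ • v) (h0 : v ≠ 0) :
    μ ∈ eigs H := by
  simp only [eigs, Set.Finite.mem_toFinset, Set.mem_ofPred_eq]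
  exact Module.End.hasEigenvalue_of_hasEigenvector
    ⟨Module.End.mem_eigenspace_iff.mpr hv, h0⟩

lemma eigProj_apply {H : Module.End ℂ V} {μ ν : ℂ} (hν : ν ∈ eigs H) {v : V}
    (hv : H v = μ • v) : eigProj H ν v = if ν = μ then v else 0 := by
  by_cases h0 : v = 0
  · simp [h0]
  have hμ := mem_eigs hv h0
  have hev : H.HasEigenvector μ v := ⟨Module.End.mem_eigenspace_iff.mpr hv, h0⟩
  rw [eigProj, Module.End.aeval_apply_of_hasEigenvector hev]
  split_ifs with h
  · subst h
    have := Lagrange.eval_basis_self (v := (id : ℂ → ℂ)) (Function.injective_id.injOn) hν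
    simp only [id] at this
    rw [this, one_smul]
  · have := Lagrange.eval_basis_of_ne (v := (id : ℂ → ℂ)) h hμ
    simp only [id] at this
    rw [this, zero_smul]

lemma sum_eigProj {H : Module.End ℂ V} (hd : ⨆ μ : ℂ, H.eigenspace μ = ⊤) :
    ∑ μ ∈ eigs H, eigProj H μ = 1 := by
  refine ext_eig hd fun μ v hv => ?_
  rw [LinearMap.sum_apply, Finset.sum_congr rfl fun ν hν => eigProj_apply hν hv]
  by_cases h0 : v = 0
  · simp [h0]
  · simp [mem_eigs hv h0]

end

/-- A finite dimensional weight module over the restricted unrolled quantum group.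
The `ℤ/2`-grading of the underlying super vector space `V = V₀ ⊕ V₁` is recorded by its grading
involution `par`, which acts on `V_p` by `(-1)^p`. That the action map is parity preserving means
that `H`, `K` act by even and `E`, `F` by odd operators. -/
structure WeightModule (r : ℕ) where
  carrier : Type
  [addCommGroup : AddCommGroup carrier]
  [module : Module ℂ carrier]
  [finiteDimensional : FiniteDimensional ℂ carrier]
  par : Module.End ℂ carrier
  par_sq : par * par = 1
  act : QGroup r →ₐ[ℂ] Module.End ℂ carrier
  par_H : par * act (gen r .H) = act (gen r .H) * par
  par_K : par * act (gen r .K) = act (gen r .K) * par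
  par_E : par * act (gen r .E) = -(act (gen r .E) * par)
  par_F : par * act (gen r .F) = -(act (gen r .F) * par)
  /-- `H` acts semisimply. -/
  diag : ⨆ μ : ℂ, (act (gen r .H)).eigenspace μ = ⊤
  /-- `K` acts by `q^μ` on vectors of `H`-weight `μ`. -/
  K_weight : ∀ (μ : ℂ) (v : carrier),
    act (gen r .H) v = μ • v → act (gen r .K) v = qpow r μ • v

namespace WeightModule

attribute [instance] addCommGroup module finiteDimensional

variable {r : ℕ}

instance : CoeSort (WeightModule r) Type := ⟨carrier⟩

/-- The action of a generator. -/
abbrev op (V : WeightModule r) (x : Gen) : Module.End ℂ V := V.act (gen r x)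

lemma rel (V : WeightModule r) :
    Relations r (V.op .H) (V.op .K) (V.op .Kinv) (V.op .E) (V.op .F) :=
  (relations_gen r).map V.act

lemma weight_span (V : WeightModule r) :
    ⨆ μ : ℂ, (V.op .H).eigenspace μ ⊓ (V.op .K).eigenspace (qpow r μ) = ⊤ := by
  rw [← top_le_iff, ← V.diag]
  exact iSup_mono fun μ v hv => ⟨hv, Module.End.mem_eigenspace_iff.mpr
    (V.K_weight μ v (Module.End.mem_eigenspace_iff.mp hv))⟩

lemma Kinv_weight (V : WeightModule r) (μ : ℂ) (v : V) (h : V.op .H v = μ • v) :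
    V.op .Kinv v = qpow r (-μ) • v := by
  have h1 := congrArg (V.op .Kinv) (V.K_weight μ v h)
  have h2 := LinearMap.congr_fun V.rel.KinvK v
  simp only [Module.End.mul_apply, Module.End.one_apply] at h2
  rw [h2, map_smul] at h1
  conv_rhs => rw [h1, smul_smul, qpow_neg_mul, one_smul]

/-- The part of parity `p`: the vectors with `par v = (-1)^p v`. -/
def part (V : WeightModule r) (p : ZMod 2) : Submodule ℂ V :=
  V.par.eigenspace ((-1) ^ p.val)

/-- `V` is the direct sum of its even and its odd part. -/
lemma isCompl_part (V : WeightModule r) : IsCompl (V.part 0) (V.part 1) := by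
  have hs : ∀ v, V.par (V.par v) = v := fun v => LinearMap.congr_fun V.par_sq v
  have h1 : (1 : ZMod 2).val = 1 := rfl
  constructor
  · rw [Submodule.disjoint_def]
    intro v h0 h1'
    simp only [part, Module.End.mem_eigenspace_iff, ZMod.val_zero, pow_zero, one_smul, h1,
      pow_one, neg_smul] at h0 h1'
    have h2 : v = -v := h0.symm.trans h1'
    have h3 : (2 : ℂ) • v = 0 := by rw [two_smul]; nth_rewrite 2 [h2]; simp
    simpa using h3
  · rw [codisjoint_iff, eq_top_iff]
    intro v _
    rw [Submodule.mem_sup]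
    refine ⟨(1 / 2 : ℂ) • (v + V.par v), ?_, (1 / 2 : ℂ) • (v - V.par v), ?_, ?_⟩
    · simp only [part, Module.End.mem_eigenspace_iff, ZMod.val_zero, pow_zero, one_smul,
        map_smul, map_add, hs, add_comm]
    · simp only [part, Module.End.mem_eigenspace_iff, h1, pow_one, map_smul, map_sub, hs]
      module
    · module

/-! ### The category of weight modules -/

/-- Parity preserving linear maps which commute with the action of the quantum group. -/
@[ext]
structure Hom (V W : WeightModule r) where
  toLin : V →ₗ[ℂ] W
  map_par : ∀ v : V, toLin (V.par v) = W.par (toLin v)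
  map_act : ∀ (x : QGroup r) (v : V), toLin (V.act x v) = W.act x (toLin v)

/-- It suffices to check linearity on generators. -/
lemma map_act_of_gen {V W : WeightModule r} (f : V →ₗ[ℂ] W)
    (h : ∀ (x : Gen) (v : V), f (V.op x v) = W.op x (f v)) (x : QGroup r) (v : V) :
    f (V.act x v) = W.act x (f v) := by
  induction x using qgroup_induction generalizing v with
  | hc c => simp [Module.algebraMap_end_apply]
  | hg x => exact h x v
  | hm a b ha hb => simp [ha, hb]
  | ha a b ha hb => simp [ha, hb]

instance : Category (WeightModule r) where
  Hom := Hom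
  id V := ⟨LinearMap.id, fun _ => rfl, fun _ _ => rfl⟩
  comp f g := ⟨g.toLin ∘ₗ f.toLin, fun v => by simp [f.map_par, g.map_par],
    fun x v => by simp [f.map_act, g.map_act]⟩

@[simp] lemma id_toLin (V : WeightModule r) : Hom.toLin (𝟙 V) = LinearMap.id := rfl

@[simp] lemma comp_toLin {U V W : WeightModule r} (f : U ⟶ V) (g : V ⟶ W) :
    Hom.toLin (f ≫ g) = g.toLin ∘ₗ f.toLin := rfl

@[ext] lemma hom_ext {V W : WeightModule r} {f g : V ⟶ W} (h : f.toLin = g.toLin) : f = g :=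
  Hom.ext h

lemma toLin_injective (V W : WeightModule r) :
    Function.Injective (fun f : V ⟶ W => f.toLin) := fun _ _ h => hom_ext h

section

variable (V W : WeightModule r)

instance : Zero (V ⟶ W) := ⟨⟨0, by simp, by simp⟩⟩
instance : Add (V ⟶ W) := ⟨fun f g => ⟨f.toLin + g.toLin,
  by simp [f.map_par, g.map_par], by simp [f.map_act, g.map_act]⟩⟩
instance : Neg (V ⟶ W) := ⟨fun f => ⟨-f.toLin, by simp [f.map_par], by simp [f.map_act]⟩⟩
instance : Sub (V ⟶ W) := ⟨fun f g => ⟨f.toLin - g.toLin,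
  by simp [f.map_par, g.map_par], by simp [f.map_act, g.map_act]⟩⟩
instance : SMul ℕ (V ⟶ W) := ⟨fun n f => ⟨n • f.toLin,
  by simp [f.map_par], by simp [f.map_act]⟩⟩
instance : SMul ℤ (V ⟶ W) := ⟨fun n f => ⟨n • f.toLin,
  by simp [f.map_par], by simp [f.map_act]⟩⟩
instance : SMul ℂ (V ⟶ W) := ⟨fun n f => ⟨n • f.toLin,
  by simp [f.map_par], by simp [f.map_act]⟩⟩

instance : AddCommGroup (V ⟶ W) :=
  (toLin_injective V W).addCommGroup _ rfl (fun _ _ => rfl) (fun _ => rfl) (fun _ _ => rfl)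
    (fun _ _ => rfl) (fun _ _ => rfl)

/-- The underlying linear map, as an additive homomorphism. -/
def toLinHom : (V ⟶ W) →+ (V →ₗ[ℂ] W) where
  toFun f := f.toLin
  map_zero' := rfl
  map_add' _ _ := rfl

instance : Module ℂ (V ⟶ W) :=
  (toLin_injective V W).module ℂ (toLinHom V W) (fun _ _ => rfl)

end

@[simp] lemma add_toLin {V W : WeightModule r} (f g : V ⟶ W) :
    Hom.toLin (f + g) = f.toLin + g.toLin := rfl

@[simp] lemma zero_toLin (V W : WeightModule r) : Hom.toLin (0 : V ⟶ W) = 0 := rfl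

@[simp] lemma smul_toLin {V W : WeightModule r} (c : ℂ) (f : V ⟶ W) :
    Hom.toLin (c • f) = c • f.toLin := rfl

instance : Preadditive (WeightModule r) where
  add_comp _ _ _ f g h := by ext : 1; simp [LinearMap.comp_add]
  comp_add _ _ _ f g h := by ext : 1; simp [LinearMap.add_comp]

instance : Linear ℂ (WeightModule r) where
  smul_comp _ _ _ c f g := by ext : 1; simp [LinearMap.comp_smul]
  comp_smul _ _ _ f c g := by ext : 1; simp [LinearMap.smul_comp]

/-- An isomorphism from a linear equivalence. -/
def mkIso {V W : WeightModule r} (e : V ≃ₗ[ℂ] W) (hp : ∀ v : V, e (V.par v) = W.par (e v))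
    (h : ∀ (x : Gen) (v : V), e (V.op x v) = W.op x (e v)) : V ≅ W where
  hom := ⟨e.toLinearMap, hp, map_act_of_gen e.toLinearMap h⟩
  inv := ⟨e.symm.toLinearMap, fun w => e.injective (by simp [hp]),
    map_act_of_gen e.symm.toLinearMap fun x w => e.injective (by simp [h])⟩
  hom_inv_id := by ext v; simp
  inv_hom_id := by ext v; simp

/-! ### The monoidal structure -/

end WeightModule

/-- The coproduct `Δ(H) = H ⊗ 1 + 1 ⊗ H`, `Δ(K) = K ⊗ K`, `Δ(E) = 1 ⊗ E + E ⊗ K`,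
`Δ(F) = K⁻¹ ⊗ F + F ⊗ 1` respects the relations; the Koszul sign of an odd operator in the second
tensor factor passing a vector of the first factor is realized by the grading involution `σ`. -/
lemma Relations.tensor {r : ℕ} {A B : Type*} [Ring A] [Algebra ℂ A] [Ring B] [Algebra ℂ B]
    {σ H K Ki E F : A} {H' K' Ki' E' F' : B} (h : Relations r H K Ki E F)
    (h' : Relations r H' K' Ki' E' F') (hσ : σ * σ = 1) (hH : σ * H = H * σ)
    (hK : σ * K = K * σ) (hKi : σ * Ki = Ki * σ) (hE : σ * E = -(E * σ))
    (hF : σ * F = -(F * σ)) :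
    Relations r (H ⊗ₜ[ℂ] (1 : B) + (1 : A) ⊗ₜ[ℂ] H') (K ⊗ₜ[ℂ] K') (Ki ⊗ₜ[ℂ] Ki')
      (σ ⊗ₜ[ℂ] E' + E ⊗ₜ[ℂ] K') ((Ki * σ) ⊗ₜ[ℂ] F' + F ⊗ₜ[ℂ] (1 : B)) where
  HK := by simp [add_mul, mul_add, h.HK, h'.HK]
  HKinv := by simp [add_mul, mul_add, h.HKinv, h'.HKinv]
  HE := by
    have e1 : H * E = E * H + (2 : ℂ) • E := by rw [← h.HE]; abel
    have e2 : H' * E' = E' * H' + (2 : ℂ) • E' := by rw [← h'.HE]; abel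
    simp only [add_mul, mul_add, Algebra.TensorProduct.tmul_mul_tmul, one_mul, mul_one, e1, e2,
      hH, h'.HK, TensorProduct.add_tmul, TensorProduct.tmul_add, TensorProduct.tmul_smul,
      TensorProduct.smul_tmul', smul_add]
    abel
  HF := by
    have e1 : H * F = F * H + (-2 : ℂ) • F := by rw [← h.HF]; abel
    have e2 : H' * F' = F' * H' + (-2 : ℂ) • F' := by rw [← h'.HF]; abel
    have e3 : H * (Ki * σ) = Ki * σ * H := by rw [← mul_assoc, h.HKinv, mul_assoc, ← hH, mul_assoc]
    simp only [add_mul, mul_add, Algebra.TensorProduct.tmul_mul_tmul, one_mul, mul_one, e1, e2,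
      e3, TensorProduct.add_tmul, TensorProduct.tmul_add, TensorProduct.tmul_smul,
      TensorProduct.smul_tmul', smul_add]
    abel
  KKinv := by simp [h.KKinv, h'.KKinv, Algebra.TensorProduct.one_def]
  KinvK := by simp [h.KinvK, h'.KinvK, Algebra.TensorProduct.one_def]
  KE := by
    simp only [add_mul, mul_add, Algebra.TensorProduct.tmul_mul_tmul, h.KE, h'.KE, hK,
      TensorProduct.tmul_smul, TensorProduct.smul_tmul', smul_add]
  KF := by
    have e3 : K * (Ki * σ) = Ki * σ * K := by
      rw [← mul_assoc, h.KKinv, mul_assoc, hK, ← mul_assoc, h.KinvK]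
    simp only [add_mul, mul_add, Algebra.TensorProduct.tmul_mul_tmul, h.KF, h'.KF, e3, one_mul,
      mul_one, TensorProduct.tmul_smul, TensorProduct.smul_tmul', smul_add]
  EF := by
    have e1 : E * F = (qpow r 1 - qpow r (-1))⁻¹ • (K - Ki) - F * E := by rw [← h.EF]; abel
    have e2 : E' * F' = (qpow r 1 - qpow r (-1))⁻¹ • (K' - Ki') - F' * E' := by
      rw [← h'.EF]; abel
    have e3 : σ * (Ki * σ) = Ki := by rw [← mul_assoc, hKi, mul_assoc, hσ, mul_one]
    have e4 : Ki * σ * σ = Ki := by rw [mul_assoc, hσ, mul_one]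
    have e5 : E * Ki = qpow r 2 • (Ki * E) := by
      have := congrArg (fun x => Ki * x * Ki) h.KE
      simpa only [mul_smul_comm, smul_mul_assoc, mul_assoc, h.KKinv, mul_one, ← mul_assoc Ki K,
        h.KinvK, one_mul] using this
    have e6 : E * (Ki * σ) = qpow r 2 • (Ki * E * σ) := by
      rw [← mul_assoc, e5, smul_mul_assoc]
    have e7 : Ki * σ * E = -(Ki * E * σ) := by rw [mul_assoc, hE, mul_neg, mul_assoc]
    have e8 : qpow r 2 * qpow r (-2) = 1 := by rw [mul_comm, qpow_neg_mul]
    simp only [add_mul, mul_add, Algebra.TensorProduct.tmul_mul_tmul, one_mul, mul_one, e1, e2,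
      e3, e4, e6, e7, hF, h'.KF, TensorProduct.tmul_smul, TensorProduct.smul_tmul',
      TensorProduct.sub_tmul, TensorProduct.tmul_sub, TensorProduct.neg_tmul, smul_sub, smul_smul]
    rw [mul_comm (qpow r (-2)), e8, one_smul]
    abel
  nilE hr := by
    have hE2 : (E ⊗ₜ[ℂ] K') ^ rbar r = 0 := by
      rw [Algebra.TensorProduct.tmul_pow, h.nilE hr, TensorProduct.zero_tmul]
    have hE1 : (σ ⊗ₜ[ℂ] E') ^ rbar r = 0 := by
      rw [Algebra.TensorProduct.tmul_pow, h'.nilE hr, TensorProduct.tmul_zero]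
    refine add_pow_rbar r _ _ ?_ hr hE1 hE2
    simp only [Algebra.TensorProduct.tmul_mul_tmul, hE, h'.KE, TensorProduct.tmul_smul,
      TensorProduct.neg_tmul, smul_neg, neg_smul, neg_neg]
  nilF hr := by
    have hF2 : (F ⊗ₜ[ℂ] (1 : B)) ^ rbar r = 0 := by
      rw [Algebra.TensorProduct.tmul_pow, h.nilF hr, TensorProduct.zero_tmul]
    have hF1 : ((Ki * σ) ⊗ₜ[ℂ] F') ^ rbar r = 0 := by
      rw [Algebra.TensorProduct.tmul_pow, h'.nilF hr, TensorProduct.tmul_zero]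
    rw [add_comm]
    refine add_pow_rbar r _ _ ?_ hr hF2 hF1
    have e5 : Ki * F = qpow r 2 • (F * Ki) := by
      have := congrArg (fun x => qpow r 2 • (Ki * x * Ki)) h.KF
      simp only [mul_smul_comm, smul_mul_assoc, mul_assoc, h.KKinv, mul_one, ← mul_assoc Ki K,
        h.KinvK, one_mul, smul_smul] at this
      rw [this, mul_comm (qpow r 2), qpow_neg_mul, one_smul]
    have e6 : Ki * σ * F = (-qpow r 2) • (F * (Ki * σ)) := by
      rw [mul_assoc, hF, mul_neg, ← mul_assoc, e5, smul_mul_assoc, neg_smul, mul_assoc]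
    simp only [Algebra.TensorProduct.tmul_mul_tmul, e6, one_mul, mul_one,
      TensorProduct.smul_tmul']

namespace WeightModule

variable {r : ℕ}

lemma par_Kinv (V : WeightModule r) : V.par * V.op .Kinv = V.op .Kinv * V.par := by
  have := congrArg (fun x => V.op .Kinv * x * V.op .Kinv) V.par_K
  simp only [mul_assoc, V.rel.KKinv, mul_one] at this
  rw [← mul_assoc (V.op .Kinv) (V.op .K), V.rel.KinvK, one_mul] at this
  exact this.symm

lemma map_neg_left' {V W : WeightModule r} (f : Module.End ℂ V) (g : Module.End ℂ W) :
    TensorProduct.map (-f) g = -TensorProduct.map f g := by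
  ext v w; simp [TensorProduct.neg_tmul]

lemma map_neg_right' {V W : WeightModule r} (f : Module.End ℂ V) (g : Module.End ℂ W) :
    TensorProduct.map f (-g) = -TensorProduct.map f g := by
  ext v w; simp [TensorProduct.tmul_neg]

open TensorProduct in
/-- The relations for the action on a tensor product. -/
lemma tensor_rel (V W : WeightModule r) :
    Relations r (A := Module.End ℂ (V ⊗[ℂ] W)) (map (V.op .H) 1 + map 1 (W.op .H)) (map (V.op .K) (W.op .K))
      (map (V.op .Kinv) (W.op .Kinv)) (map V.par (W.op .E) + map (V.op .E) (W.op .K))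
      (map (V.op .Kinv * V.par) (W.op .F) + map (V.op .F) 1) := by
  have := (V.rel.tensor W.rel V.par_sq V.par_H V.par_K V.par_Kinv V.par_E V.par_F).map
    (Module.endTensorEndAlgHom (R := ℂ) (S := ℂ) (A := ℂ) (M := V) (N := W))
  simpa only [map_add, Module.endTensorEndAlgHom_apply, AlgebraTensorModule.map_eq] using this

lemma tensor_span (V W : WeightModule r) :
    ⨆ μ : ℂ, Module.End.eigenspace (TensorProduct.map (V.op .H) (1 : Module.End ℂ W) +
        TensorProduct.map (1 : Module.End ℂ V) (W.op .H)) μ ⊓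
      Module.End.eigenspace (TensorProduct.map (V.op .K) (W.op .K)) (qpow r μ) = ⊤ := by
  rw [eq_top_iff, ← TensorProduct.span_tmul_eq_top, Submodule.span_le]
  rintro _ ⟨v, w, rfl⟩
  have hv : v ∈ ⨆ μ : ℂ, (V.op .H).eigenspace μ ⊓ (V.op .K).eigenspace (qpow r μ) :=
    V.weight_span ▸ trivial
  have hw : w ∈ ⨆ μ : ℂ, (W.op .H).eigenspace μ ⊓ (W.op .K).eigenspace (qpow r μ) :=
    W.weight_span ▸ trivial
  rw [SetLike.mem_coe]
  induction hv using Submodule.iSup_induction' with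
  | mem μ v hv =>
    induction hw using Submodule.iSup_induction' with
    | mem ν w hw =>
      refine Submodule.mem_iSup_of_mem (μ + ν) ⟨?_, ?_⟩
      · have h1 := Module.End.mem_eigenspace_iff.mp hv.1
        have h2 := Module.End.mem_eigenspace_iff.mp hw.1
        rw [SetLike.mem_coe, Module.End.mem_eigenspace_iff]
        simp [h1, h2, add_smul, TensorProduct.smul_tmul']
      · have h1 := Module.End.mem_eigenspace_iff.mp hv.2
        have h2 := Module.End.mem_eigenspace_iff.mp hw.2
        rw [SetLike.mem_coe, Module.End.mem_eigenspace_iff]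
        simp [h1, h2, qpow_add, TensorProduct.smul_tmul', smul_smul, mul_comm]
    | zero => simp
    | add x y _ _ hx hy => rw [TensorProduct.tmul_add]; exact Submodule.add_mem _ hx hy
  | zero => simp
  | add x y _ _ hx hy => rw [TensorProduct.add_tmul]; exact Submodule.add_mem _ hx hy

open TensorProduct in
/-- The tensor product of weight modules: the tensor product of super vector spaces, on which the
quantum group acts through the coproduct `Δ(H) = H ⊗ 1 + 1 ⊗ H`, `Δ(K) = K ⊗ K`,
`Δ(E) = 1 ⊗ E + E ⊗ K`, `Δ(F) = K⁻¹ ⊗ F + F ⊗ 1` with the Koszul rule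
`(x ⊗ y)(v ⊗ w) = (-1)^{|y||v|} xv ⊗ yw`. -/
@[reducible] def tensor (V W : WeightModule r) : WeightModule r where
  carrier := V ⊗[ℂ] W
  par := map V.par W.par
  par_sq := by rw [← TensorProduct.map_mul, V.par_sq, W.par_sq, TensorProduct.map_one]
  act := lift (tensor_rel V W)
  par_H := by
    simp only [lift_gen, genFun, add_mul, mul_add, ← TensorProduct.map_mul, V.par_H, W.par_H,
      one_mul, mul_one]
  par_K := by
    simp only [lift_gen, genFun, ← TensorProduct.map_mul, V.par_K, W.par_K]
  par_E := by
    simp only [lift_gen, genFun, add_mul, mul_add, ← TensorProduct.map_mul, V.par_E, W.par_E,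
      W.par_K, neg_add, map_neg_left', map_neg_right']
  par_F := by
    have e : V.par * (V.op .Kinv * V.par) = V.op .Kinv * V.par * V.par := by
      rw [← mul_assoc, V.par_Kinv]
    simp only [lift_gen, genFun, add_mul, mul_add, ← TensorProduct.map_mul, e, V.par_F, W.par_F,
      one_mul, mul_one, neg_add, map_neg_left', map_neg_right']
  diag := by
    simp only [lift_gen, genFun]
    exact (weight_of_span _ _ (tensor_span V W)).1
  K_weight := by
    simp only [lift_gen, genFun]
    exact (weight_of_span _ _ (tensor_span V W)).2

/-- The action of the generators on a tensor product. -/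
lemma tensor_op (V W : WeightModule r) (x : Gen) : (tensor V W).op x =
    genFun (TensorProduct.map (V.op .H) 1 + TensorProduct.map 1 (W.op .H))
      (TensorProduct.map (V.op .K) (W.op .K)) (TensorProduct.map (V.op .Kinv) (W.op .Kinv))
      (TensorProduct.map V.par (W.op .E) + TensorProduct.map (V.op .E) (W.op .K))
      (TensorProduct.map (V.op .Kinv * V.par) (W.op .F) + TensorProduct.map (V.op .F) 1) x :=
  lift_gen (tensor_rel V W) x

/-- The relations for the trivial module. -/
lemma unit_rel (r : ℕ) : Relations r (A := Module.End ℂ ℂ) 0 1 1 0 0 where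
  HK := by simp
  HKinv := by simp
  HE := by simp
  HF := by simp
  KKinv := by simp
  KinvK := by simp
  KE := by simp
  KF := by simp
  EF := by simp
  nilE h := zero_pow h
  nilF h := zero_pow h

/-- The trivial module. -/
@[reducible] def unit (r : ℕ) : WeightModule r where
  carrier := ℂ
  par := 1
  par_sq := one_mul 1
  act := lift (unit_rel r)
  par_H := by simp
  par_K := by simp
  par_E := by simp [genFun]
  par_F := by simp [genFun]
  diag := by
    rw [eq_top_iff]
    refine le_trans ?_ (le_iSup _ (0 : ℂ))
    intro v _
    simp [genFun]
  K_weight := by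
    intro μ v h
    simp only [lift_gen, genFun, LinearMap.zero_apply] at h
    rcases smul_eq_zero.mp h.symm with h | h
    · simp [genFun, h, qpow_zero]
    · simp [h]

lemma unit_op (x : Gen) : (unit r).op x = genFun 0 1 1 0 0 x := lift_gen (unit_rel r) x

open TensorProduct in
/-- The tensor product of two morphisms. -/
def tensorHom {V V' W W' : WeightModule r} (f : V ⟶ V') (g : W ⟶ W') :
    tensor V W ⟶ tensor V' W' where
  toLin := TensorProduct.map f.toLin g.toLin
  map_par v := by
    have : TensorProduct.map f.toLin g.toLin ∘ₗ TensorProduct.map V.par W.par =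
        TensorProduct.map V'.par W'.par ∘ₗ TensorProduct.map f.toLin g.toLin := by
      ext v w; simp [f.map_par, g.map_par]
    exact LinearMap.congr_fun this v
  map_act := map_act_of_gen (V := tensor V W) (W := tensor V' W')
    (TensorProduct.map f.toLin g.toLin) fun x v => by
    have : TensorProduct.map f.toLin g.toLin ∘ₗ (tensor V W).op x =
        (tensor V' W').op x ∘ₗ TensorProduct.map f.toLin g.toLin := by
      rw [tensor_op, tensor_op]
      refine TensorProduct.ext' fun v w => ?_
      cases x <;> simp [genFun, f.map_par, f.map_act, g.map_act]
    exact LinearMap.congr_fun this v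

open TensorProduct in
/-- The associator. -/
def assoc (U V W : WeightModule r) : tensor (tensor U V) W ≅ tensor U (tensor V W) :=
  mkIso (TensorProduct.assoc ℂ U V W)
    (fun v => by
      have : (TensorProduct.assoc ℂ U V W).toLinearMap ∘ₗ (tensor (tensor U V) W).par =
          (tensor U (tensor V W)).par ∘ₗ (TensorProduct.assoc ℂ U V W).toLinearMap :=
        TensorProduct.ext_threefold fun u v w => rfl
      exact LinearMap.congr_fun this v)
    (fun x v => by
      have : (TensorProduct.assoc ℂ U V W).toLinearMap ∘ₗ (tensor (tensor U V) W).op x =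
          (tensor U (tensor V W)).op x ∘ₗ (TensorProduct.assoc ℂ U V W).toLinearMap := by
        rw [tensor_op, tensor_op]
        simp only [tensor_op, genFun]
        refine TensorProduct.ext_threefold fun u v w => ?_
        cases x <;> simp [TensorProduct.add_tmul, TensorProduct.tmul_add, add_assoc]
      exact LinearMap.congr_fun this v)

open TensorProduct in
/-- The left unitor. -/
def leftUnitor (V : WeightModule r) : tensor (unit r) V ≅ V :=
  mkIso (TensorProduct.lid ℂ V)
    (fun v => by
      have : (TensorProduct.lid ℂ V).toLinearMap ∘ₗ (tensor (unit r) V).par =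
          V.par ∘ₗ (TensorProduct.lid ℂ V).toLinearMap := by
        refine TensorProduct.ext' fun c v => ?_
        change c • V.par v = V.par (c • v)
        rw [map_smul]
      exact LinearMap.congr_fun this v)
    (fun x v => by
      have : (TensorProduct.lid ℂ V).toLinearMap ∘ₗ (tensor (unit r) V).op x =
          V.op x ∘ₗ (TensorProduct.lid ℂ V).toLinearMap := by
        rw [tensor_op]
        simp only [unit_op, genFun]
        refine TensorProduct.ext' fun c v => ?_
        cases x <;>
          simp only [LinearMap.comp_apply, LinearMap.add_apply, TensorProduct.map_tmul,
            LinearEquiv.coe_coe, LinearMap.zero_apply, TensorProduct.zero_tmul, add_zero, zero_add, Module.End.one_apply, mul_one] <;>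
          exact (map_smul (V.op _) c v).symm
      exact LinearMap.congr_fun this v)

open TensorProduct in
/-- The right unitor. -/
def rightUnitor (V : WeightModule r) : tensor V (unit r) ≅ V :=
  mkIso (TensorProduct.rid ℂ V)
    (fun v => by
      have : (TensorProduct.rid ℂ V).toLinearMap ∘ₗ (tensor V (unit r)).par =
          V.par ∘ₗ (TensorProduct.rid ℂ V).toLinearMap := by
        refine TensorProduct.ext' fun v c => ?_
        change c • V.par v = V.par (c • v)
        rw [map_smul]
      exact LinearMap.congr_fun this v)
    (fun x v => by
      have : (TensorProduct.rid ℂ V).toLinearMap ∘ₗ (tensor V (unit r)).op x =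
          V.op x ∘ₗ (TensorProduct.rid ℂ V).toLinearMap := by
        rw [tensor_op]
        simp only [unit_op, genFun]
        refine TensorProduct.ext' fun v c => ?_
        cases x <;>
          simp only [LinearMap.comp_apply, LinearMap.add_apply, TensorProduct.map_tmul,
            LinearEquiv.coe_coe, LinearMap.zero_apply, TensorProduct.tmul_zero, add_zero, zero_add, Module.End.one_apply] <;>
          exact (map_smul (V.op _) c v).symm
      exact LinearMap.congr_fun this v)

instance : MonoidalCategoryStruct (WeightModule r) where
  tensorObj := tensor
  whiskerLeft U _ _ f := tensorHom (𝟙 U) f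
  whiskerRight f U := tensorHom f (𝟙 U)
  tensorHom := tensorHom
  tensorUnit := unit r
  associator := assoc
  leftUnitor := leftUnitor
  rightUnitor := rightUnitor

instance : MonoidalCategory (WeightModule r) := MonoidalCategory.ofTensorHom
  (id_tensorHom_id := fun V W => by
    apply hom_ext; exact TensorProduct.map_id)
  (tensorHom_comp_tensorHom := fun f g h k => by
    apply hom_ext; exact (TensorProduct.map_comp _ _ _ _).symm)
  (associator_naturality := fun f g h => by
    apply hom_ext; exact TensorProduct.ext_threefold fun _ _ _ => rfl)
  (leftUnitor_naturality := fun {V W} f => by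
    apply hom_ext; exact TensorProduct.ext' fun (c : ℂ) (v : V) => (map_smul f.toLin c v).symm)
  (rightUnitor_naturality := fun {V W} f => by
    apply hom_ext; exact TensorProduct.ext' fun (v : V) (c : ℂ) => (map_smul f.toLin c v).symm)
  (pentagon := fun U V W X => by
    apply hom_ext; exact TensorProduct.ext_fourfold fun _ _ _ _ => rfl)
  (triangle := fun V W => by
    apply hom_ext
    exact TensorProduct.ext_threefold fun (v : V) (c : ℂ) (w : W) => TensorProduct.tmul_smul c v w)

instance : MonoidalPreadditive (WeightModule r) where
  whiskerLeft_zero := by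
    intros; apply hom_ext
    exact TensorProduct.ext' fun v w => TensorProduct.tmul_zero _ _
  zero_whiskerRight := by
    intros; apply hom_ext
    exact TensorProduct.ext' fun v w => TensorProduct.zero_tmul _ _
  whiskerLeft_add _ _ := by
    apply hom_ext; exact TensorProduct.ext' fun v w => TensorProduct.tmul_add _ _ _
  add_whiskerRight _ _ := by
    apply hom_ext; exact TensorProduct.ext' fun v w => TensorProduct.add_tmul _ _ _

instance : MonoidalLinear ℂ (WeightModule r) where
  whiskerLeft_smul _ _ _ _ _ := by
    apply hom_ext; exact TensorProduct.ext' fun v w => TensorProduct.tmul_smul _ _ _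
  smul_whiskerRight _ _ _ _ _ := by
    apply hom_ext; exact TensorProduct.ext' fun v w => TensorProduct.smul_tmul' _ _ _

/-! ### Duals -/

end WeightModule

open MulOpposite in
/-- The antipode `S(H) = -H`, `S(K) = K⁻¹`, `S(E) = -E K⁻¹`, `S(F) = -K F`, which is a
super anti-homomorphism, respects the relations; the Koszul signs are realized by the grading
involution `σ`. -/
lemma Relations.dual {r : ℕ} {A : Type*} [Ring A] [Algebra ℂ A]
    {σ H K Ki E F : A} (h : Relations r H K Ki E F) (hσ : σ * σ = 1) (hH : σ * H = H * σ)
    (hK : σ * K = K * σ) (hKi : σ * Ki = Ki * σ) (hE : σ * E = -(E * σ))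
    (hF : σ * F = -(F * σ)) :
    Relations r (op (-H)) (op Ki) (op K) (op (σ * -(E * Ki))) (op (σ * -(K * F))) := by
  have e5 : E * Ki = qpow r 2 • (Ki * E) := by
    have := congrArg (fun x => Ki * x * Ki) h.KE
    simpa only [mul_smul_comm, smul_mul_assoc, mul_assoc, h.KKinv, mul_one, ← mul_assoc Ki K,
      h.KinvK, one_mul] using this
  have e6 : F * Ki = qpow r (-2) • (Ki * F) := by
    have := congrArg (fun x => Ki * x * Ki) h.KF
    simpa only [mul_smul_comm, smul_mul_assoc, mul_assoc, h.KKinv, mul_one, ← mul_assoc Ki K,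
      h.KinvK, one_mul] using this
  have e7 : H * E = E * H + (2 : ℂ) • E := by rw [← h.HE]; abel
  have e8 : H * F = F * H + (-2 : ℂ) • F := by rw [← h.HF]; abel
  exact
  { HK := by rw [← op_mul, ← op_mul, mul_neg, neg_mul, h.HKinv]
    HKinv := by rw [← op_mul, ← op_mul, mul_neg, neg_mul, h.HK]
    HE := by
      rw [← op_mul, ← op_mul, ← MulOpposite.op_sub, ← op_smul]
      congr 1
      have : H * (σ * (E * Ki)) = σ * (E * Ki) * H + (2 : ℂ) • (σ * (E * Ki)) := by
        rw [← mul_assoc, ← hH, mul_assoc, ← mul_assoc H, e7, add_mul, mul_add, smul_mul_assoc,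
          mul_smul_comm, mul_assoc E, h.HKinv]
        simp only [mul_assoc]
      simp only [mul_neg, neg_mul, neg_neg, this, smul_neg]
      abel
    HF := by
      rw [← op_mul, ← op_mul, ← MulOpposite.op_sub, ← op_smul]
      congr 1
      have : H * (σ * (K * F)) = σ * (K * F) * H + (-2 : ℂ) • (σ * (K * F)) := by
        rw [← mul_assoc, ← hH, mul_assoc, ← mul_assoc H, h.HK, mul_assoc K, e8, mul_add, mul_add,
          mul_smul_comm, mul_smul_comm]
        simp only [mul_assoc]
      simp only [mul_neg, neg_mul, neg_neg, this, smul_neg]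
      abel
    KKinv := by rw [← op_mul, h.KKinv, op_one]
    KinvK := by rw [← op_mul, h.KinvK, op_one]
    KE := by
      rw [← op_mul, ← op_mul, ← op_smul]
      congr 1
      simp only [mul_neg, neg_mul, smul_neg]
      congr 1
      rw [← mul_assoc Ki σ, ← hKi, mul_assoc σ Ki, ← mul_assoc Ki E, ← mul_smul_comm,
        ← smul_mul_assoc, ← e5, mul_assoc]
    KF := by
      rw [← op_mul, ← op_mul, ← op_smul]
      congr 1
      simp only [mul_neg, neg_mul, smul_neg]
      congr 1
      rw [mul_assoc, mul_assoc, e6, ← mul_assoc Ki σ, ← hKi, mul_assoc σ Ki, ← mul_assoc Ki K,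
        h.KinvK, one_mul, mul_smul_comm, mul_smul_comm, ← mul_assoc K Ki, h.KKinv, one_mul]
    EF := by
      rw [← op_mul, ← op_mul, ← MulOpposite.op_add, ← MulOpposite.op_sub, ← op_smul]
      congr 1
      have s1 : ∀ x, σ * (σ * x) = x := fun x => by rw [← mul_assoc, hσ, one_mul]
      have a1 : σ * (K * F) * (σ * (E * Ki)) = -(F * E) := by
        have : K * F * σ = -(σ * (K * F)) := by
          rw [← mul_assoc σ, hK, mul_assoc K σ, hF, mul_neg, neg_neg, mul_assoc]
        rw [mul_assoc, ← mul_assoc (K * F), this, neg_mul, mul_neg, mul_assoc σ, s1, mul_assoc K,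
          ← mul_assoc F, ← mul_assoc K]
        have c : K * (F * E) = F * E * K := by
          rw [← mul_assoc, h.KF, smul_mul_assoc, mul_assoc, h.KE, mul_smul_comm, smul_smul,
            qpow_neg_mul, one_smul, mul_assoc]
        rw [c, mul_assoc, h.KKinv, mul_one]
      have a2 : σ * (E * Ki) * (σ * (K * F)) = -(E * F) := by
        have : E * Ki * σ = -(σ * (E * Ki)) := by
          rw [← mul_assoc σ, hE, mul_assoc E, ← hKi, neg_mul, neg_neg, mul_assoc]
        rw [mul_assoc, ← mul_assoc (E * Ki), this, neg_mul, mul_neg, mul_assoc σ, s1, mul_assoc E,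
          ← mul_assoc Ki, h.KinvK, one_mul]
      simp only [mul_neg, neg_mul, neg_neg, a1, a2]
      rw [← neg_add, add_comm, h.EF, ← smul_neg, neg_sub]
    nilE := fun hr => by
      rw [← op_pow, op_eq_zero_iff]
      have hp : (E * Ki) ^ rbar r = 0 :=
        mul_pow_eq_zero_of_skew (qpow r (-2)) E Ki (by
          rw [e5, smul_smul, qpow_neg_mul, one_smul]) _ (Or.inl (h.nilE hr))
      refine mul_pow_eq_zero_of_skew (-1) σ (-(E * Ki)) ?_ _ (Or.inr ?_)
      · rw [mul_neg, neg_mul, mul_assoc, ← hKi, ← mul_assoc, ← mul_assoc, hE]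
        simp
      · rw [neg_pow, hp, mul_zero]
    nilF := fun hr => by
      rw [← op_pow, op_eq_zero_iff]
      have hp : (K * F) ^ rbar r = 0 :=
        mul_pow_eq_zero_of_skew (qpow r 2) K F (by
          rw [h.KF, smul_smul, mul_comm, qpow_neg_mul, one_smul]) _ (Or.inr (h.nilF hr))
      refine mul_pow_eq_zero_of_skew (-1) σ (-(K * F)) ?_ _ (Or.inr ?_)
      · rw [mul_neg, neg_mul, mul_assoc, ← mul_assoc σ, hK, mul_assoc K σ, hF]
        simp
      · rw [neg_pow, hp, mul_zero] }

/-- The transpose, as an algebra homomorphism. -/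
def transposeHom (V : Type*) [AddCommGroup V] [Module ℂ V] :
    (Module.End ℂ V)ᵐᵒᵖ →ₐ[ℂ] Module.End ℂ (Module.Dual ℂ V) where
  toFun f := f.unop.dualMap
  map_one' := rfl
  map_mul' _ _ := rfl
  map_zero' := by ext; simp
  map_add' _ _ := by ext; simp
  commutes' c := by ext; simp [Module.algebraMap_end_apply]

namespace WeightModule

variable {r : ℕ}

lemma dual_rel (V : WeightModule r) :
    Relations r (A := Module.End ℂ (Module.Dual ℂ V)) (LinearMap.dualMap (-V.op .H))
      (LinearMap.dualMap (V.op .Kinv)) (LinearMap.dualMap (V.op .K))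
      (LinearMap.dualMap (V.par * -(V.op .E * V.op .Kinv)))
      (LinearMap.dualMap (V.par * -(V.op .K * V.op .F))) :=
  (V.rel.dual V.par_sq V.par_H V.par_K V.par_Kinv V.par_E V.par_F).map (transposeHom V)

lemma dual_span (V : WeightModule r) :
    ⨆ μ : ℂ, Module.End.eigenspace (LinearMap.dualMap (-V.op .H)) μ ⊓
      Module.End.eigenspace (LinearMap.dualMap (V.op .Kinv)) (qpow r μ) = ⊤ := by
  rw [eq_top_iff]
  intro f _
  have hf : f = ∑ μ ∈ eigs (V.op .H), f ∘ₗ eigProj (V.op .H) μ := by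
    ext v
    have := congrArg f (LinearMap.congr_fun (sum_eigProj V.diag) v)
    simpa [LinearMap.sum_apply] using this.symm
  rw [hf]
  refine Submodule.sum_mem _ fun μ hμ => Submodule.mem_iSup_of_mem (-μ) ⟨?_, ?_⟩
  · rw [SetLike.mem_coe, Module.End.mem_eigenspace_iff]
    refine ext_eig V.diag fun ν v hv => ?_
    simp only [LinearMap.dualMap_apply, LinearMap.comp_apply, LinearMap.neg_apply,
      LinearMap.smul_apply, map_neg, hv, map_smul, eigProj_apply hμ hv]
    split_ifs with hh
    · subst hh; simp
    · simp
  · rw [SetLike.mem_coe, Module.End.mem_eigenspace_iff]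
    refine ext_eig V.diag fun ν v hv => ?_
    simp only [LinearMap.dualMap_apply, LinearMap.comp_apply, V.Kinv_weight ν v hv,
      LinearMap.smul_apply, map_smul, eigProj_apply hμ hv]
    split_ifs with hh
    · subst hh; simp
    · simp

/-- The dual of a weight module: the linear dual, with `f` of parity `p` if it vanishes on the part
of parity `p + 1`, and with action `(x · f)(v) = (-1)^{|f||x|} f(S(x) v)`, where
`S(H) = -H`, `S(K) = K⁻¹`, `S(E) = -E K⁻¹`, `S(F) = -K F`. -/
@[reducible] def dual (V : WeightModule r) : WeightModule r where
  carrier := Module.Dual ℂ V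
  par := LinearMap.dualMap V.par
  par_sq := by
    ext f v
    exact congrArg f (LinearMap.congr_fun V.par_sq v)
  act := lift (dual_rel V)
  par_H := by
    simp only [lift_gen, genFun]
    ext f v
    have := LinearMap.congr_fun V.par_H v
    simp only [Module.End.mul_apply] at this
    simp [this]
  par_K := by
    simp only [lift_gen, genFun]
    ext f v
    have := LinearMap.congr_fun V.par_Kinv v
    simp only [Module.End.mul_apply] at this
    simp [this]
  par_E := by
    simp only [lift_gen, genFun]
    have e : V.par * -(V.op .E * V.op .Kinv) * V.par =
        -(V.par * (V.par * -(V.op .E * V.op .Kinv))) := by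
      simp only [mul_assoc, neg_mul, mul_neg, ← V.par_Kinv]
      rw [← mul_assoc (V.op .E), ← neg_eq_iff_eq_neg.mpr V.par_E]
      simp [mul_assoc]
    ext f v
    have := congrArg f (LinearMap.congr_fun e v)
    simpa using this
  par_F := by
    simp only [lift_gen, genFun]
    have e : V.par * -(V.op .K * V.op .F) * V.par =
        -(V.par * (V.par * -(V.op .K * V.op .F))) := by
      simp only [mul_assoc, neg_mul, mul_neg]
      rw [← neg_eq_iff_eq_neg.mpr V.par_F, mul_neg, ← mul_assoc (V.op .K), ← V.par_K]
      simp [mul_assoc]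
    ext f v
    have := congrArg f (LinearMap.congr_fun e v)
    simpa using this
  diag := by
    simp only [lift_gen, genFun]
    exact (weight_of_span _ _ (dual_span V)).1
  K_weight := by
    simp only [lift_gen, genFun]
    exact (weight_of_span _ _ (dual_span V)).2

/-! ### The braiding -/

open TensorProduct in
/-- The Koszul symmetry `v ⊗ w ↦ (-1)^{|v||w|} w ⊗ v`; the sign operator is
`(1 ⊗ 1 + σ ⊗ 1 + 1 ⊗ σ - σ ⊗ σ) / 2`. -/
def koszul (V W : WeightModule r) : V ⊗[ℂ] W →ₗ[ℂ] W ⊗[ℂ] V :=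
  (TensorProduct.comm ℂ V W).toLinearMap ∘ₗ
    ((1 / 2 : ℂ) • (map 1 1 + map V.par 1 + map 1 W.par - map V.par W.par))

lemma koszul_apply (V W : WeightModule r) (a b : ℕ) (v : V) (w : W)
    (hv : V.par v = (-1 : ℂ) ^ a • v) (hw : W.par w = (-1 : ℂ) ^ b • w) :
    koszul V W (v ⊗ₜ w) = (-1 : ℂ) ^ (a * b) • (w ⊗ₜ[ℂ] v) := by
  have hs : ∀ n : ℕ, (-1 : ℂ) ^ n = 1 ∨ (-1 : ℂ) ^ n = -1 := neg_one_pow_eq_or ℂ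
  rw [pow_mul]
  rcases hs a with ha | ha <;> rcases hs b with hb | hb <;> rw [ha] at hv ⊢ <;>
    rw [hb] at hw <;> (try rw [hb]) <;>
    simp only [koszul, LinearMap.comp_apply, LinearMap.smul_apply, LinearMap.sub_apply,
      LinearMap.add_apply, TensorProduct.map_tmul, hv, hw, Module.End.one_apply, one_smul,
      neg_smul, TensorProduct.neg_tmul, TensorProduct.tmul_neg, LinearEquiv.coe_coe, map_smul,
      map_add, map_sub, map_neg, TensorProduct.comm_tmul, one_pow, neg_neg] <;> module

open TensorProduct in
/-- The operator `Υ` on `V ⊗ W`, which multiplies `v ⊗ w` by `q^{λ μ / 2}` for `v` of weight `λ` and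
`w` of weight `μ`. -/
def upsilon (V W : WeightModule r) : Module.End ℂ (V ⊗[ℂ] W) :=
  ∑ l ∈ eigs (V.op .H), ∑ m ∈ eigs (W.op .H),
    qpow r (l * m / 2) • map (eigProj (V.op .H) l) (eigProj (W.op .H) m)

lemma upsilon_apply (V W : WeightModule r) (l m : ℂ) (v : V) (w : W)
    (hv : V.op .H v = l • v) (hw : W.op .H w = m • w) :
    upsilon V W (v ⊗ₜ w) = qpow r (l * m / 2) • (v ⊗ₜ[ℂ] w) := by
  by_cases hv0 : v = 0
  · simp [hv0]
  by_cases hw0 : w = 0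
  · simp [hw0]
  have h1 := mem_eigs hv hv0
  have h2 := mem_eigs hw hw0
  simp only [upsilon, LinearMap.sum_apply, LinearMap.smul_apply, TensorProduct.map_tmul]
  rw [Finset.sum_eq_single_of_mem l h1, Finset.sum_eq_single_of_mem m h2]
  · rw [eigProj_apply h1 hv, eigProj_apply h2 hw, if_pos rfl, if_pos rfl]
  · intro k hk hkm
    rw [eigProj_apply hk hw, if_neg hkm]; simp
  · intro k hk hkm
    refine Finset.sum_eq_zero fun j hj => ?_
    rw [eigProj_apply hk hv, if_neg hkm]; simp

open TensorProduct in
/-- The action on `V ⊗ W` of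
`R̃ = ∑_{l < r̄} (-1)^l q^{l(l-1)/2} (q - q⁻¹)^l / [l]! · E^l ⊗ F^l`, where by the Koszul rule
`(E^l ⊗ F^l)(v ⊗ w) = (-1)^{l |v|} E^l v ⊗ F^l w`. -/
def rMatrix (V W : WeightModule r) : Module.End ℂ (V ⊗[ℂ] W) :=
  ∑ l ∈ Finset.range (rbar r),
    ((-1) ^ l * qpow r ((l : ℂ) * ((l : ℂ) - 1) / 2) * (qpow r 1 - qpow r (-1)) ^ l /
        superFact r l) •
      map (V.op .E ^ l * V.par ^ l) (W.op .F ^ l)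

/-- The linear map `τ ∘ Υ ∘ R̃ : V ⊗ W → W ⊗ V`. -/
def braidMap (V W : WeightModule r) : V ⊗[ℂ] W →ₗ[ℂ] W ⊗[ℂ] V :=
  koszul V W ∘ₗ upsilon V W ∘ₗ rMatrix V W

/-! ### The duality maps -/

/-- The action of `K^n` for an integer `n`. -/
def Kpow (V : WeightModule r) (n : ℤ) : Module.End ℂ V := V.act ↑(Kunit r ^ n)

/-- `f ⊗ v ↦ f(v)`. -/
def evLMap (V : WeightModule r) : Module.Dual ℂ V ⊗[ℂ] V →ₗ[ℂ] ℂ := contractLeft ℂ V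

/-- `1 ↦ ∑ i, v_i ⊗ v_i^∨`. -/
def coevLMap (V : WeightModule r) : ℂ →ₗ[ℂ] V ⊗[ℂ] Module.Dual ℂ V := coevaluation ℂ V

/-- `v ⊗ f ↦ (-1)^{|f||v|} f(K^{1-s} v)`. -/
def evRMap (s : ℤ) (V : WeightModule r) : V ⊗[ℂ] Module.Dual ℂ V →ₗ[ℂ] ℂ :=
  contractLeft ℂ V ∘ₗ koszul V (dual V) ∘ₗ TensorProduct.map (V.Kpow (1 - s)) LinearMap.id

/-- `1 ↦ ∑ i, (-1)^{|v_i|} v_i^∨ ⊗ K^{s-1} v_i`. -/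
def coevRMap (s : ℤ) (V : WeightModule r) : ℂ →ₗ[ℂ] Module.Dual ℂ V ⊗[ℂ] V :=
  TensorProduct.map LinearMap.id (V.Kpow (s - 1)) ∘ₗ koszul V (dual V) ∘ₗ coevaluation ℂ V

/-- The braiding `B` has components `τ ∘ Υ ∘ R̃`. -/
def IsStandardBraiding (B : BraidedCategory (WeightModule r)) : Prop :=
  ∀ V W : WeightModule r, Hom.toLin (B.braiding V W).hom = braidMap V W

/-- The pivotal structure `P` has the four duality maps determined by the integer `s`. -/
structure IsStandardPivotal (s : ℤ) (P : PivotalStructure (dual (r := r))) : Prop where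
  evL : ∀ V : WeightModule r, Hom.toLin (P.evL V) = evLMap V
  coevL : ∀ V : WeightModule r, Hom.toLin (P.coevL V) = coevLMap V
  evR : ∀ V : WeightModule r, Hom.toLin (P.evR V) = evRMap s V
  coevR : ∀ V : WeightModule r, Hom.toLin (P.coevR V) = coevRMap s V

end WeightModule

end Osp

end

/-!
The braiding and the duality maps are explicit, so most of the axioms are checked on homogeneous
weight vectors, where `c(v ⊗ w)` is the sum `braidMap_tmul`. It is `U`-linear because the
quasi-`R`-matrix `R̃ = ∑ l, c_l E^l ⊗ F^l` intertwines the coproduct with its image under the bar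
involution (`rMatrix_E`, `rMatrix_F`): by the formulas for `E F^l` and `E^l F` the difference of the
two sides telescopes, and its last term vanishes as `E^{r̄} = F^{r̄} = 0`. It is invertible because
`R̃` is `1` plus a nilpotent operator. The hexagon identities follow from the `q`-binomial formula
for `Δ(E)^n` and `Δ(F)^n`, since `c_{k+j}` times the Gauss binomial is `c_k c_j` up to a power of
`q` and a sign (`rCoeff_add`).

The maps on the right duals are those on the left duals composed with the pivot `σ K^{1-s}`, where
`σ` is the grading involution. As `q^{2s} = 1`, conjugation by `K^{1-s}` is the square of the
antipode, so these maps are `U`-linear. Both duality functors are transposition, and the pivot is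
grouplike, so they agree as monoidal functors (`pivotal`).

In any braided category with a pivotal structure, `θ_V = ptr_R(c_{V,V})` compares two ways of seeing
`V` as a dual of `V^∨`: the right duality, and the left duality transported along the braiding
(`ptr_braiding`). Hence `θ` is invertible, and as the two dualities identify `W^∨ ⊗ V^∨` with
`(V ⊗ W)^∨` in the same way, `θ` is balanced (`ptr_braiding_tensor`); both hold for every `s`. Thus
only `θ_{V^∨} = (θ_V)^∨` depends on `s`.

On a vector of weight `λ` the twist is a combination of the operators `F^k E^k`
(`toLin_ptr_braiding`). A Verma module of highest weight `λ` has dimension `r̄` and is generated by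
a vector killed by `E`, so its twist is the scalar `q^{λ²/2 + (1-s)λ}`. Its dual is generated by a
vector of weight `μ = 2(r̄ - 1) - λ` killed by `E`, and so has the twist `q^{μ²/2 + (1-s)μ}`. The
quotient of the two scalars is `q^{(λ-μ)(r̄-s)}`; it is `1` for every complex `λ` only if `s = r̄`
(`eq_rbar_of_dual`).

Conversely let `s = r̄`. On vectors of weight `z` both `θ_V` and the transpose of `θ_{V^∨}` are
polynomials of degree less than `r̄` in `F E`, with coefficients that depend on `z` but not on `V`.
Let `dualDefect r z` be their difference. It vanishes at the eigenvalue of `F E` on the vector of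
weight `z` in the Verma module of highest weight `z + 2j`, for `j = 0, …, r̄ - 1`, since there the
two twists are equal scalars. Outside a countable set of weights these `r̄` eigenvalues are
distinct, so the polynomial is zero; its values are continuous in `z`, so it is zero for all `z`
(`dualDefect_eq_zero`). This proves duality for all weight modules without classifying them.
-/

noncomputable section

namespace Osp

/-! ### Roots of unity and the coefficients of the `R`-matrix -/

lemma qpow_sub (r : ℕ) (a b : ℂ) : qpow r (a - b) = qpow r a * (qpow r b)⁻¹ := by
  rw [sub_eq_add_neg, qpow_add, eq_inv_of_mul_eq_one_left (qpow_neg_mul r b)]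

lemma qpow_neg (r : ℕ) (a : ℂ) : qpow r (-a) = (qpow r a)⁻¹ :=
  eq_inv_of_mul_eq_one_left (qpow_neg_mul r a)

lemma qpow_eq_one_iff {r : ℕ} (hr : r ≠ 0) (z : ℂ) : qpow r z = 1 ↔ ∃ n : ℤ, z = n * r := by
  have hr' : (r : ℂ) ≠ 0 := by exact_mod_cast hr
  rw [qpow, Complex.exp_eq_one_iff]
  refine exists_congr fun n => ?_
  rw [div_eq_iff hr', show (n : ℂ) * (2 * Real.pi * Complex.I) * r =
    2 * Real.pi * Complex.I * (n * r) by ring]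
  exact mul_right_inj' Complex.two_pi_I_ne_zero

lemma qpow_two_ne_one {r : ℕ} (hr : 3 ≤ r) : qpow r 2 ≠ 1 := by
  rw [Ne, qpow_eq_one_iff (by omega)]
  rintro ⟨n, hn⟩
  have hn' : (2 : ℤ) = n * r := by exact_mod_cast hn
  have := Int.le_of_dvd (by norm_num) ⟨n, hn'.trans (mul_comm _ _)⟩
  omega

lemma neg_qpow_two_ne_one {r : ℕ} (hr : 3 ≤ r) (h4 : r ≠ 4) : -qpow r 2 ≠ 1 := by
  intro h
  have h2 : qpow r 4 = 1 := by
    rw [show (4 : ℂ) = 2 + 2 by norm_num, qpow_add, ← neg_mul_neg, h, one_mul]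
  rw [qpow_eq_one_iff (by omega)] at h2
  obtain ⟨n, hn⟩ := h2
  have hn' : (4 : ℤ) = n * r := by exact_mod_cast hn
  have hle := Int.le_of_dvd (by norm_num) ⟨n, hn'.trans (mul_comm _ _)⟩
  have : r = 3 := by omega
  subst this
  omega

lemma qpow_sub_inv_ne_zero {r : ℕ} (hr : 3 ≤ r) : qpow r 1 - qpow r (-1) ≠ 0 := by
  intro h
  refine qpow_two_ne_one hr ?_
  have : qpow r 2 = qpow r 1 * qpow r 1 := by rw [← qpow_add]; norm_num
  rw [this]
  nth_rewrite 1 [sub_eq_zero.mp h]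
  exact qpow_neg_mul r 1

lemma sum_range_pow_rbar {r : ℕ} (h : rbar r ≠ 0) :
    ∑ i ∈ Finset.range (rbar r), (-qpow r 2) ^ i = 0 := by
  have := rbar_spec r h
  rw [superInt_eq r _ (Nat.pos_of_ne_zero h)] at this
  exact (mul_eq_zero.mp this).resolve_left (qpow_ne_zero _ _)

lemma sum_range_pow_ne_zero {r k : ℕ} (hk : 0 < k) (hk' : k < rbar r) :
    ∑ i ∈ Finset.range k, (-qpow r 2) ^ i ≠ 0 := fun h =>
  rbar_min r k hk hk' (by rw [superInt_eq r k hk, h, mul_zero])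

lemma rbar_ne_zero {r : ℕ} (hr : 3 ≤ r) (h4 : r ≠ 4) : rbar r ≠ 0 := by
  have hne : {n : ℕ | 0 < n ∧ superInt r n = 0}.Nonempty := by
    refine ⟨2 * r, by omega, ?_⟩
    rw [superInt_eq r _ (by omega)]
    refine mul_eq_zero_of_right _ ?_
    have h1 : (-qpow r 2) ^ (2 * r) = 1 := by
      rw [neg_pow, pow_mul, neg_one_sq, one_pow, one_mul, ← qpow_mul_nat,
        qpow_eq_one_iff (by omega)]
      exact ⟨4, by push_cast; ring⟩
    have h2 := geom_sum_mul (-qpow r 2) (2 * r)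
    rw [h1, sub_self] at h2
    exact (mul_eq_zero.mp h2).resolve_right (sub_ne_zero.mpr (neg_qpow_two_ne_one hr h4))
  exact (Nat.sInf_mem hne).1.ne'

/-- The coefficient of `E^l ⊗ F^l` in the quasi-`R`-matrix. -/
def rCoeff (r l : ℕ) : ℂ :=
  (-1) ^ l * qpow r ((l : ℂ) * ((l : ℂ) - 1) / 2) * (qpow r 1 - qpow r (-1)) ^ l / superFact r l

lemma rCoeff_zero (r : ℕ) : rCoeff r 0 = 1 := by simp [rCoeff, superFact, qpow_zero]

lemma superFact_ne_zero {r l : ℕ} (h : l < rbar r) : superFact r l ≠ 0 :=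
  Finset.prod_ne_zero_iff.mpr fun i hi =>
    rbar_min r _ i.succ_pos (by have := Finset.mem_range.mp hi; omega)

lemma rCoeff_succ {r l : ℕ} (h : l + 1 < rbar r) :
    rCoeff r (l + 1) * superInt r (l + 1) =
      -(rCoeff r l * qpow r l * (qpow r 1 - qpow r (-1))) := by
  have h1 := superFact_ne_zero (show l < rbar r by omega)
  have h2 := rbar_min r _ l.succ_pos h
  have h3 : superFact r (l + 1) = superFact r l * superInt r (l + 1) :=
    Finset.prod_range_succ _ _
  have h4 : qpow r (((l + 1 : ℕ) : ℂ) * (((l + 1 : ℕ) : ℂ) - 1) / 2) =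
      qpow r ((l : ℂ) * ((l : ℂ) - 1) / 2) * qpow r l := by
    rw [← qpow_add]; congr 1; push_cast; ring
  rw [rCoeff, rCoeff, h3, h4]
  simp only [Nat.succ_eq_add_one] at h2
  field_simp
  ring

lemma superFact_eq (r l : ℕ) :
    superFact r l = qpow r (-((l : ℂ) * ((l : ℂ) - 1) / 2)) *
      ∏ i ∈ Finset.range l, ∑ m ∈ Finset.range (i + 1), (-qpow r 2) ^ m := by
  induction l with
  | zero => simp [superFact, qpow_zero]
  | succ l ih =>
    have h : superFact r (l + 1) = superFact r l * superInt r (l + 1) :=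
      Finset.prod_range_succ _ _
    have h4 : qpow r (-(((l + 1 : ℕ) : ℂ) * (((l + 1 : ℕ) : ℂ) - 1) / 2)) =
        qpow r (-((l : ℂ) * ((l : ℂ) - 1) / 2)) * qpow r (1 - (l + 1 : ℕ)) := by
      rw [← qpow_add]; congr 1; push_cast; ring
    rw [h, ih, superInt_eq r _ l.succ_pos, Finset.prod_range_succ _ l, h4]
    ring

/-- The addition rule for the coefficients of the quasi-`R`-matrix, which makes it a `q`-exponential;
it is what the hexagon identities reduce to. -/
lemma rCoeff_add {r k j : ℕ} (h : k + j < rbar r) :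
    rCoeff r (k + j) * gauss (-qpow r 2) k j * qpow r (-(2 * j * k)) =
      rCoeff r k * rCoeff r j := by
  have g := gauss_fact (-qpow r 2) k j
  have hk := superFact_ne_zero (show k < rbar r by omega)
  have hj := superFact_ne_zero (show j < rbar r by omega)
  have hkj := superFact_ne_zero h
  have e1 := superFact_eq r k
  have e2 := superFact_eq r j
  have e3 := superFact_eq r (k + j)
  rw [← g] at e3
  have e : superFact r k * superFact r j * gauss (-qpow r 2) k j =
      superFact r (k + j) * qpow r (j * k) := by
    rw [e1, e2, e3]
    have : qpow r (-((k : ℂ) * ((k : ℂ) - 1) / 2)) * qpow r (-((j : ℂ) * ((j : ℂ) - 1) / 2)) =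
        qpow r (-(((k + j : ℕ) : ℂ) * (((k + j : ℕ) : ℂ) - 1) / 2)) * qpow r (j * k) := by
      rw [← qpow_add, ← qpow_add]; congr 1; push_cast; ring
    linear_combination ((∏ i ∈ Finset.range k, ∑ m ∈ Finset.range (i + 1), (-qpow r 2) ^ m) *
      (∏ i ∈ Finset.range j, ∑ m ∈ Finset.range (i + 1), (-qpow r 2) ^ m) *
        gauss (-qpow r 2) k j) * this
  have e' : gauss (-qpow r 2) k j =
      superFact r (k + j) * qpow r (j * k) / (superFact r k * superFact r j) := by
    rw [← e]; field_simp
  have h4 : qpow r (((k + j : ℕ) : ℂ) * (((k + j : ℕ) : ℂ) - 1) / 2) * qpow r (j * k) *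
      qpow r (-(2 * j * k)) = qpow r ((k : ℂ) * ((k : ℂ) - 1) / 2) *
        qpow r ((j : ℂ) * ((j : ℂ) - 1) / 2) := by
    rw [← qpow_add, ← qpow_add, ← qpow_add]; congr 1; push_cast; ring
  rw [e', rCoeff, rCoeff, rCoeff]
  field_simp
  linear_combination ((-1) ^ (k + j) * (qpow r 1 - qpow r (-1)) ^ (k + j)) * h4

/-! ### Homogeneous weight vectors -/

namespace WeightModule

variable {r : ℕ}

/-- `v` is a vector of `H`-weight `μ` and of parity `a` modulo `2`. -/
structure Homog (V : WeightModule r) (μ : ℂ) (a : ℕ) (v : V) : Prop where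
  wt : V.op .H v = μ • v
  par : V.par v = (-1 : ℂ) ^ a • v

lemma par_par (V : WeightModule r) (v : V) : V.par (V.par v) = v :=
  LinearMap.congr_fun V.par_sq v

lemma H_par (V : WeightModule r) (v : V) : V.op .H (V.par v) = V.par (V.op .H v) :=
  (LinearMap.congr_fun V.par_H v).symm

lemma K_par (V : WeightModule r) (v : V) : V.op .K (V.par v) = V.par (V.op .K v) :=
  (LinearMap.congr_fun V.par_K v).symm

lemma Kinv_par (V : WeightModule r) (v : V) : V.op .Kinv (V.par v) = V.par (V.op .Kinv v) :=
  (LinearMap.congr_fun V.par_Kinv v).symm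

lemma E_par (V : WeightModule r) (v : V) : V.op .E (V.par v) = -V.par (V.op .E v) := by
  have := LinearMap.congr_fun V.par_E v
  simp only [Module.End.mul_apply, LinearMap.neg_apply] at this
  rw [this, neg_neg]

lemma F_par (V : WeightModule r) (v : V) : V.op .F (V.par v) = -V.par (V.op .F v) := by
  have := LinearMap.congr_fun V.par_F v
  simp only [Module.End.mul_apply, LinearMap.neg_apply] at this
  rw [this, neg_neg]

/-- Linear maps out of a weight module which agree on homogeneous weight vectors are equal. -/
lemma ext_homog {V : WeightModule r} {X : Type*} [AddCommGroup X] [Module ℂ X]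
    {f g : V →ₗ[ℂ] X} (h : ∀ μ a v, V.Homog μ a v → f v = g v) : f = g := by
  refine ext_eig V.diag fun μ v hv => ?_
  have h0 := h μ 0 (v + V.par v) ⟨by rw [map_add, H_par, hv, map_smul, smul_add],
    by rw [map_add, par_par, pow_zero, one_smul, add_comm]⟩
  have h1 := h μ 1 (v - V.par v) ⟨by rw [map_sub, H_par, hv, map_smul, smul_sub],
    by rw [map_sub, par_par, pow_one, neg_smul, one_smul, neg_sub]⟩
  have e : v = (1 / 2 : ℂ) • ((v + V.par v) + (v - V.par v)) := by module
  rw [e, map_smul, map_smul, map_add f (v + V.par v), map_add g (v + V.par v), h0, h1]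

lemma ext_homog₂ {V W : WeightModule r} {X : Type*} [AddCommGroup X] [Module ℂ X]
    {f g : V ⊗[ℂ] W →ₗ[ℂ] X}
    (h : ∀ l a v, V.Homog l a v → ∀ m b w, W.Homog m b w → f (v ⊗ₜ w) = g (v ⊗ₜ w)) : f = g := by
  refine TensorProduct.ext (ext_homog fun l a v hv => ext_homog fun m b w hw => ?_)
  exact h l a v hv m b w hw

lemma ext_homog₃ {U V W : WeightModule r} {X : Type*} [AddCommGroup X] [Module ℂ X]
    {f g : U ⊗[ℂ] V ⊗[ℂ] W →ₗ[ℂ] X}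
    (h : ∀ k c u, U.Homog k c u → ∀ l a v, V.Homog l a v → ∀ m b w, W.Homog m b w →
      f (u ⊗ₜ v ⊗ₜ w) = g (u ⊗ₜ v ⊗ₜ w)) : f = g := by
  refine TensorProduct.ext (ext_homog₂ fun k c u hu l a v hv => ext_homog fun m b w hw => ?_)
  exact h k c u hu l a v hv m b w hw

namespace Homog

variable {V : WeightModule r} {μ : ℂ} {a : ℕ} {v : V}

lemma K (h : V.Homog μ a v) : V.op .K v = qpow r μ • v := V.K_weight μ v h.wt

lemma Kinv (h : V.Homog μ a v) : V.op .Kinv v = qpow r (-μ) • v := V.Kinv_weight μ v h.wt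

lemma E (h : V.Homog μ a v) : V.Homog (μ + 2) (a + 1) (V.op .E v) where
  wt := by
    have := LinearMap.congr_fun V.rel.HE v
    simp only [LinearMap.sub_apply, Module.End.mul_apply, h.wt, map_smul,
      LinearMap.smul_apply] at this
    rw [sub_eq_iff_eq_add] at this
    rw [this]; module
  par := by
    have := V.E_par v
    rw [h.par, map_smul] at this
    rw [pow_succ, mul_neg_one, neg_smul, this, neg_neg]

lemma F (h : V.Homog μ a v) : V.Homog (μ - 2) (a + 1) (V.op .F v) where
  wt := by
    have := LinearMap.congr_fun V.rel.HF v
    simp only [LinearMap.sub_apply, Module.End.mul_apply, h.wt, map_smul,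
      LinearMap.smul_apply] at this
    rw [sub_eq_iff_eq_add] at this
    rw [this]; module
  par := by
    have := V.F_par v
    rw [h.par, map_smul] at this
    rw [pow_succ, mul_neg_one, neg_smul, this, neg_neg]

lemma E_pow (h : V.Homog μ a v) (l : ℕ) :
    V.Homog (μ + 2 * l) (a + l) ((V.op .E ^ l) v) := by
  induction l with
  | zero => simpa using h
  | succ l ih =>
    rw [pow_succ']
    have := ih.E
    rw [show μ + 2 * l + 2 = μ + 2 * ((l + 1 : ℕ) : ℂ) by push_cast; ring] at this
    exact this

lemma F_pow (h : V.Homog μ a v) (l : ℕ) :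
    V.Homog (μ - 2 * l) (a + l) ((V.op .F ^ l) v) := by
  induction l with
  | zero => simpa using h
  | succ l ih =>
    rw [pow_succ']
    have := ih.F
    rw [show μ - 2 * l - 2 = μ - 2 * ((l + 1 : ℕ) : ℂ) by push_cast; ring] at this
    exact this

lemma par_pow (h : V.Homog μ a v) (l : ℕ) : (V.par ^ l) v = (-1 : ℂ) ^ (l * a) • v := by
  induction l with
  | zero => simp
  | succ l ih => rw [pow_succ', Module.End.mul_apply, ih, map_smul, h.par, smul_smul, ← pow_add,
      Nat.succ_mul]

lemma smul (h : V.Homog μ a v) (c : ℂ) : V.Homog μ a (c • v) :=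
  ⟨by rw [map_smul, h.wt, smul_comm], by rw [map_smul, h.par, smul_comm]⟩

lemma map {W : WeightModule r} (h : V.Homog μ a v) (f : V ⟶ W) : W.Homog μ a (f.toLin v) :=
  ⟨by rw [← f.map_act, h.wt, map_smul], by rw [← f.map_par, h.par, map_smul]⟩

lemma tmul {W : WeightModule r} {ν : ℂ} {b : ℕ} {w : W} (hv : V.Homog μ a v)
    (hw : W.Homog ν b w) : (tensor V W).Homog (μ + ν) (a + b) (v ⊗ₜ[ℂ] w) where
  wt := by
    rw [tensor_op]
    simp [genFun, hv.wt, hw.wt, add_smul, TensorProduct.smul_tmul']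
  par := by
    simp [hv.par, hw.par, pow_add, TensorProduct.smul_tmul', smul_smul, mul_comm]

end Homog

end WeightModule

end Osp

namespace Osp

/-! ### Commutation of `E` and `F` with powers -/

lemma superInt_eq' (r n : ℕ) :
    superInt r n = qpow r (1 - n) * ∑ i ∈ Finset.range n, (-qpow r 2) ^ i := by
  rcases Nat.eq_zero_or_pos n with rfl | h
  · simp [superInt]
  · exact superInt_eq r n h

lemma superInt_succ (r n : ℕ) :
    superInt r (n + 1) = qpow r (-1) * superInt r n + (-1) ^ n * qpow r n := by
  rw [superInt_eq', superInt_eq', Finset.sum_range_succ, neg_pow, ← qpow_mul_nat, mul_add,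
    ← mul_assoc, ← mul_assoc, ← qpow_add, mul_comm _ ((-1 : ℂ) ^ n), mul_assoc, ← qpow_add]
  congr 3
  · push_cast; ring_nf
  · push_cast; ring_nf

lemma superInt_succ' (r n : ℕ) :
    superInt r (n + 1) = -(qpow r 1 * superInt r n) + qpow r (-n) := by
  have h : ∑ i ∈ Finset.range (n + 1), (-qpow r 2) ^ i =
      -(qpow r 2) * ∑ i ∈ Finset.range n, (-qpow r 2) ^ i + 1 := by
    rw [Finset.sum_range_succ', Finset.mul_sum]
    simp [pow_succ']
  have e : qpow r (1 - (n + 1 : ℕ)) * qpow r 2 = qpow r 1 * qpow r (1 - n) := by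
    rw [← qpow_add, ← qpow_add]; congr 1; push_cast; ring
  have e' : qpow r (1 - (n + 1 : ℕ)) = qpow r (-n) := by congr 1; push_cast; ring
  rw [superInt_eq', superInt_eq', h]
  linear_combination -(∑ i ∈ Finset.range n, (-qpow r 2) ^ i) * e + e'

namespace Relations

variable {r : ℕ} {A : Type*} [Ring A] [Algebra ℂ A] {H K Ki E F : A}

lemma KiE (h : Relations r H K Ki E F) : Ki * E = qpow r (-2) • (E * Ki) := by
  have := congrArg (fun x => qpow r (-2) • (Ki * x * Ki)) h.KE
  simp only [mul_smul_comm, smul_mul_assoc, mul_assoc, h.KKinv, mul_one, ← mul_assoc Ki K,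
    h.KinvK, one_mul, smul_smul, qpow_neg_mul, one_smul] at this
  exact this.symm

lemma KiF (h : Relations r H K Ki E F) : Ki * F = qpow r 2 • (F * Ki) := by
  have := congrArg (fun x => qpow r 2 • (Ki * x * Ki)) h.KF
  simp only [mul_smul_comm, smul_mul_assoc, mul_assoc, h.KKinv, mul_one, ← mul_assoc Ki K,
    h.KinvK, one_mul, smul_smul, mul_comm (qpow r 2), qpow_neg_mul, one_smul] at this
  exact this.symm

lemma K_E_pow (h : Relations r H K Ki E F) (l : ℕ) :
    K * E ^ l = qpow r (2 * l) • (E ^ l * K) := by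
  induction l with
  | zero => simp [qpow_zero]
  | succ l ih =>
    rw [pow_succ, ← mul_assoc, ih, smul_mul_assoc, mul_assoc, h.KE, mul_smul_comm, smul_smul,
      mul_assoc, ← qpow_add]
    congr 2; push_cast; ring

lemma Ki_F_pow (h : Relations r H K Ki E F) (l : ℕ) :
    Ki * F ^ l = qpow r (2 * l) • (F ^ l * Ki) := by
  induction l with
  | zero => simp [qpow_zero]
  | succ l ih =>
    rw [pow_succ, ← mul_assoc, ih, smul_mul_assoc, mul_assoc, h.KiF, mul_smul_comm, smul_smul,
      mul_assoc, ← qpow_add]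
    congr 2; push_cast; ring

lemma EF' (h : Relations r H K Ki E F) :
    E * F = (qpow r 1 - qpow r (-1))⁻¹ • (K - Ki) - F * E := by rw [← h.EF]; abel

/-- The commutator formula which makes the quasi-`R`-matrix intertwine the coproduct of `E`. -/
lemma E_F_pow (h : Relations r H K Ki E F) (l : ℕ) :
    E * F ^ (l + 1) = (-1 : ℂ) ^ (l + 1) • (F ^ (l + 1) * E) +
      ((qpow r 1 - qpow r (-1))⁻¹ * superInt r (l + 1)) •
        (qpow r (-l) • (F ^ l * K) - ((-1) ^ l * qpow r l) • (F ^ l * Ki)) := by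
  induction l with
  | zero =>
    simp [superInt, qpow_zero, h.EF']
    abel
  | succ l ih =>
    rw [pow_succ F (l + 1), ← mul_assoc, ih, add_mul, smul_mul_assoc, mul_assoc, h.EF',
      smul_mul_assoc, sub_mul, smul_mul_assoc, smul_mul_assoc, mul_assoc (F ^ l), h.KF,
      mul_assoc (F ^ l), h.KiF, mul_sub, mul_smul_comm, mul_smul_comm, mul_smul_comm, mul_sub,
      ← mul_assoc (F ^ l), ← mul_assoc (F ^ l), ← pow_succ, ← mul_assoc _ F E]
    generalize F ^ (l + 1) * K = X
    generalize F ^ (l + 1) * Ki = Y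
    generalize F ^ (l + 1) * F * E = Z
    have h1 : superInt r (l + 1 + 1) * qpow r (-(l + 1 : ℕ)) =
        superInt r (l + 1) * qpow r (-l) * qpow r (-2) + (-1) ^ (l + 1) := by
      have e : qpow r (-1) * qpow r (-(l + 1 : ℕ)) = qpow r (-l) * qpow r (-2) := by
        rw [← qpow_add, ← qpow_add]; congr 1; push_cast; ring
      rw [superInt_succ]
      have := qpow_neg_mul r (l + 1 : ℕ)
      linear_combination superInt r (l + 1) * e + (-1) ^ (l + 1) * this
    have h2 : superInt r (l + 1 + 1) * ((-1) ^ (l + 1) * qpow r (l + 1 : ℕ)) =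
        superInt r (l + 1) * ((-1) ^ l * qpow r l) * qpow r 2 + (-1) ^ (l + 1) := by
      have e : qpow r 1 * qpow r (l + 1 : ℕ) = qpow r l * qpow r 2 := by
        rw [← qpow_add, ← qpow_add]; congr 1; push_cast; ring
      rw [superInt_succ']
      have := qpow_neg_mul r (l + 1 : ℕ)
      linear_combination (-1) ^ l * superInt r (l + 1) * e + (-1) ^ (l + 1) * this
    push_cast at h1 h2 ⊢
    match_scalars
    · linear_combination -(qpow r 1 - qpow r (-1))⁻¹ * h1
    · linear_combination (qpow r 1 - qpow r (-1))⁻¹ * h2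
    · ring

/-- The commutator formula which makes the quasi-`R`-matrix intertwine the coproduct of `F`. -/
lemma E_pow_F (h : Relations r H K Ki E F) (l : ℕ) :
    E ^ (l + 1) * F = (-1 : ℂ) ^ (l + 1) • (F * E ^ (l + 1)) +
      ((qpow r 1 - qpow r (-1))⁻¹ * superInt r (l + 1)) •
        (qpow r l • (E ^ l * K) - ((-1) ^ l * qpow r (-l)) • (E ^ l * Ki)) := by
  induction l with
  | zero =>
    simp [superInt, qpow_zero, h.EF']
    abel
  | succ l ih =>
    have e1 : E * (E ^ l * K) = E ^ (l + 1) * K := by rw [← mul_assoc, ← pow_succ']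
    have e2 : E * (E ^ l * Ki) = E ^ (l + 1) * Ki := by rw [← mul_assoc, ← pow_succ']
    have e3 : Ki * E ^ (l + 1) = qpow r (-(2 * (l + 1 : ℕ))) • (E ^ (l + 1) * Ki) := by
      have := congrArg (fun x => qpow r (-(2 * (l + 1 : ℕ))) • (Ki * x * Ki)) (h.K_E_pow (l + 1))
      simp only [mul_smul_comm, smul_mul_assoc, mul_assoc, h.KKinv, mul_one, ← mul_assoc Ki K,
        h.KinvK, one_mul, smul_smul, qpow_neg_mul, one_smul] at this
      exact this.symm
    rw [pow_succ' E (l + 1), mul_assoc, ih, mul_add, mul_smul_comm, ← mul_assoc E F, h.EF',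
      mul_smul_comm, mul_sub, mul_smul_comm, mul_smul_comm, e1, e2, sub_mul, smul_mul_assoc,
      sub_mul, h.K_E_pow, e3, mul_assoc F]
    generalize E ^ (l + 1) * K = X
    generalize E ^ (l + 1) * Ki = Y
    generalize F * (E * E ^ (l + 1)) = Z
    have h1 : superInt r (l + 1 + 1) * qpow r (l + 1 : ℕ) =
        superInt r (l + 1) * qpow r l + (-1) ^ (l + 1) * qpow r (2 * (l + 1 : ℕ)) := by
      have e : qpow r (-1) * qpow r (l + 1 : ℕ) = qpow r l := by
        rw [← qpow_add]; congr 1; push_cast; ring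
      have e' : qpow r (l + 1 : ℕ) * qpow r (l + 1 : ℕ) = qpow r (2 * (l + 1 : ℕ)) := by
        rw [← qpow_add]; congr 1; push_cast; ring
      rw [superInt_succ]
      linear_combination superInt r (l + 1) * e + (-1) ^ (l + 1) * e'
    have h2 : superInt r (l + 1 + 1) * ((-1) ^ (l + 1) * qpow r (-(l + 1 : ℕ))) =
        superInt r (l + 1) * ((-1) ^ l * qpow r (-l)) +
          (-1) ^ (l + 1) * qpow r (-(2 * (l + 1 : ℕ))) := by
      have e : qpow r 1 * qpow r (-(l + 1 : ℕ)) = qpow r (-l) := by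
        rw [← qpow_add]; congr 1; push_cast; ring
      have e' : qpow r (-(l + 1 : ℕ)) * qpow r (-(l + 1 : ℕ)) = qpow r (-(2 * (l + 1 : ℕ))) := by
        rw [← qpow_add]; congr 1; push_cast; ring
      rw [superInt_succ']
      linear_combination (-1) ^ l * superInt r (l + 1) * e + (-1) ^ (l + 1) * e'
    push_cast at h1 h2 ⊢
    match_scalars
    · linear_combination -(qpow r 1 - qpow r (-1))⁻¹ * h1
    · linear_combination (qpow r 1 - qpow r (-1))⁻¹ * h2
    · ring

end Relations

/-- A sum `∑ l, c l • t l` intertwines `X + Y` and `X + Z` as soon as the commutator of `X` with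
its `(l + 1)`-st term is the failure of its `l`-th term to intertwine `Y` and `Z`, because the
difference of the two sides then telescopes. For the quasi-`R`-matrix `X` is the summand of the
coproduct that both sides share. -/
lemma sum_mul_add_eq {A : Type*} [Ring A] [Algebra ℂ A] (n : ℕ) (c : ℕ → ℂ) (t : ℕ → A)
    (X Y Z : A) (h0 : t 0 * X = X * t 0)
    (hs : ∀ l, l + 1 < n →
      c (l + 1) • (X * t (l + 1) - t (l + 1) * X) = c l • (t l * Y - Z * t l))
    (hn : ∀ l, l + 1 = n → t l * Y = Z * t l) :
    (∑ l ∈ Finset.range n, c l • t l) * (X + Y) = (X + Z) * ∑ l ∈ Finset.range n, c l • t l := by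
  have key : ∀ m, m < n → (∑ l ∈ Finset.range (m + 1), c l • t l) * (X + Y) -
      (X + Z) * ∑ l ∈ Finset.range (m + 1), c l • t l = c m • (t m * Y - Z * t m) := by
    intro m
    induction m with
    | zero =>
      intro _
      simp only [zero_add, Finset.sum_range_one, mul_add, add_mul, smul_mul_assoc, mul_smul_comm, h0]
      module
    | succ m ih =>
      intro hm
      rw [Finset.sum_range_succ, add_mul, mul_add (X + Z), add_sub_add_comm, ih (by omega),
        ← hs m hm]
      simp only [mul_add, add_mul, smul_mul_assoc, mul_smul_comm]
      module
  rcases n with _ | n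
  · simp
  · rw [← sub_eq_zero, key n (by omega), hn n rfl, sub_self, smul_zero]

namespace WeightModule

variable {r : ℕ}

/-! ### The braiding on homogeneous vectors -/

/-- The braiding on homogeneous weight vectors; every later identity is checked on this formula. -/
lemma braidMap_tmul {V W : WeightModule r} {l m : ℂ} {a b : ℕ} {v : V} {w : W}
    (hv : V.Homog l a v) (hw : W.Homog m b w) :
    braidMap V W (v ⊗ₜ w) = ∑ k ∈ Finset.range (rbar r),
      (rCoeff r k * (-1) ^ (k * a) * qpow r ((l + 2 * k) * (m - 2 * k) / 2) *
        (-1) ^ ((a + k) * (b + k))) • ((W.op .F ^ k) w ⊗ₜ[ℂ] (V.op .E ^ k) v) := by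
  simp only [braidMap, rMatrix, LinearMap.comp_apply, LinearMap.sum_apply, LinearMap.smul_apply,
    TensorProduct.map_tmul, map_sum, map_smul]
  refine Finset.sum_congr rfl fun k _ => ?_
  have hE := hv.E_pow k
  have hF := hw.F_pow k
  rw [Module.End.mul_apply, hv.par_pow, map_smul, ← TensorProduct.smul_tmul', map_smul, map_smul,
    upsilon_apply V W _ _ _ _ hE.wt hF.wt, map_smul, koszul_apply V W _ _ _ _ hE.par hF.par,
    smul_smul, smul_smul, smul_smul]
  rfl

/-- The operator `τ ∘ Υ`. -/
def twistMap (V W : WeightModule r) : V ⊗[ℂ] W →ₗ[ℂ] W ⊗[ℂ] V := koszul V W ∘ₗ upsilon V W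

lemma twistMap_tmul {V W : WeightModule r} {l m : ℂ} {a b : ℕ} {v : V} {w : W}
    (hv : V.Homog l a v) (hw : W.Homog m b w) :
    twistMap V W (v ⊗ₜ w) = (qpow r (l * m / 2) * (-1) ^ (a * b)) • (w ⊗ₜ[ℂ] v) := by
  rw [twistMap, LinearMap.comp_apply, upsilon_apply V W _ _ _ _ hv.wt hw.wt, map_smul,
    koszul_apply V W _ _ _ _ hv.par hw.par, smul_smul]

open TensorProduct (map)

/-- The operator `τ ∘ Υ` carries the twisted coproducts of `E` and `F`, which appear on the right of
`rMatrix_E` and `rMatrix_F`, to the coproducts on `W ⊗ V`. There is one lemma for each summand. -/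
lemma twistMap_par_E (V W : WeightModule r) :
    twistMap V W ∘ₗ map V.par (W.op .E) = map (W.op .E) (V.op .K) ∘ₗ twistMap V W := by
  refine ext_homog₂ fun l a v hv m b w hw => ?_
  simp only [LinearMap.comp_apply, TensorProduct.map_tmul, hv.par, twistMap_tmul hv hw,
    map_smul, hv.K, ← TensorProduct.smul_tmul', TensorProduct.tmul_smul, twistMap_tmul hv hw.E,
    smul_smul]
  congr 1
  have : qpow r (l * (m + 2) / 2) = qpow r (l * m / 2) * qpow r l := by
    rw [← qpow_add]; congr 1; ring
  rw [this]
  have : (-1 : ℂ) ^ a * (-1) ^ a = 1 := by rw [← mul_pow]; simp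
  rw [mul_add, pow_add, mul_one]
  linear_combination (qpow r (l * m / 2) * qpow r l * (-1) ^ (a * b)) * this

lemma twistMap_E_Kinv (V W : WeightModule r) :
    twistMap V W ∘ₗ map (V.op .E) (W.op .Kinv) = map W.par (V.op .E) ∘ₗ twistMap V W := by
  refine ext_homog₂ fun l a v hv m b w hw => ?_
  simp only [LinearMap.comp_apply, TensorProduct.map_tmul, hw.par, twistMap_tmul hv hw,
    map_smul, hw.Kinv, ← TensorProduct.smul_tmul', TensorProduct.tmul_smul,
    twistMap_tmul hv.E hw, smul_smul]
  congr 1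
  have : qpow r (-m) * qpow r ((l + 2) * m / 2) = qpow r (l * m / 2) := by
    rw [← qpow_add]; congr 1; ring
  rw [← mul_assoc, this, add_mul, pow_add, one_mul, mul_assoc]

lemma twistMap_K_par_F (V W : WeightModule r) :
    twistMap V W ∘ₗ map (V.op .K * V.par) (W.op .F) = map (W.op .F) 1 ∘ₗ twistMap V W := by
  refine ext_homog₂ fun l a v hv m b w hw => ?_
  simp only [LinearMap.comp_apply, TensorProduct.map_tmul, Module.End.mul_apply, hv.par,
    twistMap_tmul hv hw, map_smul, hv.K, ← TensorProduct.smul_tmul',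
    twistMap_tmul hv hw.F, smul_smul, Module.End.one_apply]
  congr 1
  have : qpow r l * qpow r (l * (m - 2) / 2) = qpow r (l * m / 2) := by
    rw [← qpow_add]; congr 1; ring
  rw [← this]
  have : (-1 : ℂ) ^ a * (-1) ^ a = 1 := by rw [← mul_pow]; simp
  rw [mul_add, pow_add, mul_one]
  linear_combination (qpow r l * qpow r (l * (m - 2) / 2) * (-1) ^ (a * b)) * this

lemma twistMap_F (V W : WeightModule r) :
    twistMap V W ∘ₗ map (V.op .F) 1 = map (W.op .Kinv * W.par) (V.op .F) ∘ₗ twistMap V W := by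
  refine ext_homog₂ fun l a v hv m b w hw => ?_
  simp only [LinearMap.comp_apply, TensorProduct.map_tmul, Module.End.mul_apply, hw.par,
    twistMap_tmul hv hw, map_smul, hw.Kinv, ← TensorProduct.smul_tmul',
    twistMap_tmul hv.F hw, smul_smul, Module.End.one_apply]
  congr 1
  have : qpow r ((l - 2) * m / 2) = qpow r (l * m / 2) * qpow r (-m) := by
    rw [← qpow_add]; congr 1; ring
  rw [this, add_mul, pow_add, one_mul]
  ring

lemma rMatrix_eq (V W : WeightModule r) : rMatrix V W = ∑ l ∈ Finset.range (rbar r),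
    rCoeff r l • map (V.op .E ^ l * V.par ^ l) (W.op .F ^ l) := rfl

lemma par_mul_E_pow (V : WeightModule r) (l : ℕ) :
    V.par * V.op .E ^ l = (-1 : ℂ) ^ l • (V.op .E ^ l * V.par) := by
  induction l with
  | zero => simp
  | succ l ih =>
    rw [pow_succ, ← mul_assoc, ih, smul_mul_assoc, mul_assoc, V.par_E, pow_succ, mul_neg, mul_smul,
      mul_assoc]
    simp

lemma par_pow_mul_E (V : WeightModule r) (l : ℕ) :
    V.par ^ l * V.op .E = (-1 : ℂ) ^ l • (V.op .E * V.par ^ l) := by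
  induction l with
  | zero => simp
  | succ l ih =>
    rw [pow_succ, mul_assoc, V.par_E, mul_neg, ← mul_assoc, ih, smul_mul_assoc, pow_succ, mul_smul,
      mul_assoc]
    simp

lemma par_pow_mul_F (V : WeightModule r) (l : ℕ) :
    V.par ^ l * V.op .F = (-1 : ℂ) ^ l • (V.op .F * V.par ^ l) := by
  induction l with
  | zero => simp
  | succ l ih =>
    rw [pow_succ, mul_assoc, V.par_F, mul_neg, ← mul_assoc, ih, smul_mul_assoc, pow_succ, mul_smul,
      mul_assoc]
    simp

lemma par_pow_mul_Kinv (V : WeightModule r) (l : ℕ) :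
    V.par ^ l * V.op .Kinv = V.op .Kinv * V.par ^ l :=
  (Commute.pow_left V.par_Kinv l).eq

lemma par_pow_add_two (V : WeightModule r) (l : ℕ) : V.par ^ (l + 2) = V.par ^ l := by
  rw [pow_add, pow_two, V.par_sq, mul_one]

lemma neg_one_sq_pow (l : ℕ) : (-1 : ℂ) ^ l * (-1) ^ l = 1 := by rw [← mul_pow]; simp

/-- The quasi-`R`-matrix intertwines the coproduct of `E` with its image under the bar involution. -/
lemma rMatrix_E (hr : 3 ≤ r) (h0 : rbar r ≠ 0) (V W : WeightModule r) :
    rMatrix V W * (map V.par (W.op .E) + map (V.op .E) (W.op .K)) =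
      (map V.par (W.op .E) + map (V.op .E) (W.op .Kinv)) * rMatrix V W := by
  rw [rMatrix_eq]
  refine sum_mul_add_eq _ _ _ _ _ _ ?_ (fun l hl => ?_) (fun l hl => ?_)
  · simp
  · have hc := rCoeff_succ hl
    have hq := qpow_sub_inv_ne_zero hr
    simp only [← TensorProduct.map_mul, W.rel.Ki_F_pow]
    have e1 : V.par * (V.op .E ^ (l + 1) * V.par ^ (l + 1)) =
        (-1 : ℂ) ^ (l + 1) • (V.op .E ^ (l + 1) * V.par ^ l) := by
      rw [← mul_assoc, par_mul_E_pow, smul_mul_assoc, mul_assoc, ← pow_succ', par_pow_add_two]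
    have e2 : V.op .E ^ (l + 1) * V.par ^ (l + 1) * V.par = V.op .E ^ (l + 1) * V.par ^ l := by
      rw [mul_assoc, ← pow_succ, par_pow_add_two]
    have e3 : V.op .E ^ l * V.par ^ l * V.op .E =
        (-1 : ℂ) ^ l • (V.op .E ^ (l + 1) * V.par ^ l) := by
      rw [mul_assoc, par_pow_mul_E, mul_smul_comm, ← mul_assoc, ← pow_succ]
    have e4 : V.op .E * (V.op .E ^ l * V.par ^ l) = V.op .E ^ (l + 1) * V.par ^ l := by
      rw [← mul_assoc, ← pow_succ']
    rw [e1, e2, e3, e4, W.rel.E_F_pow]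
    generalize V.op .E ^ (l + 1) * V.par ^ l = X
    simp only [TensorProduct.map_add_right, TensorProduct.map_smul_left,
      TensorProduct.map_smul_right, sub_eq_add_neg, map_neg_right']
    generalize map X (W.op .F ^ l * W.op .K) = Y1
    generalize map X (W.op .F ^ l * W.op .Kinv) = Y2
    generalize map X (W.op .F ^ (l + 1) * W.op .E) = Y3
    rw [← sub_eq_add_neg] at *
    have hs := neg_one_sq_pow l
    have hql : qpow r l * qpow r (-l) = 1 := by rw [mul_comm, qpow_neg_mul]
    have hql' : qpow r l * qpow r l = qpow r (2 * l) := by rw [← qpow_add, two_mul]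
    have hqq : (qpow r 1 - qpow r (-1)) * (qpow r 1 - qpow r (-1))⁻¹ = 1 := mul_inv_cancel₀ hq
    generalize (qpow r 1 - qpow r (-1))⁻¹ = κ at *
    match_scalars
    · rw [pow_succ]; linear_combination (rCoeff r (l + 1)) * hs
    · rw [pow_succ]
      linear_combination (-(-1) ^ l * κ * qpow r (-l)) * hc +
        ((-1) ^ l * rCoeff r l * qpow r l * qpow r (-l)) * hqq + (-1) ^ l * rCoeff r l * hql
    · rw [pow_succ]
      linear_combination (κ * qpow r l * (-1) ^ l * (-1) ^ l) * hc -
        ((-1) ^ l * (-1) ^ l * rCoeff r l * qpow r l * qpow r l) * hqq -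
        (-1) ^ l * (-1) ^ l * rCoeff r l * hql' - rCoeff r l * qpow r (2 * l) * hs
  · simp only [← TensorProduct.map_mul]
    have e3 : V.op .E ^ l * V.par ^ l * V.op .E = 0 := by
      rw [mul_assoc, par_pow_mul_E, mul_smul_comm, ← mul_assoc, ← pow_succ, hl, V.rel.nilE h0,
        zero_mul, smul_zero]
    have e4 : V.op .E * (V.op .E ^ l * V.par ^ l) = 0 := by
      rw [← mul_assoc, ← pow_succ', hl, V.rel.nilE h0, zero_mul]
    rw [e3, e4, TensorProduct.map_zero_left, TensorProduct.map_zero_left]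

/-- The quasi-`R`-matrix intertwines the coproduct of `F` with its image under the bar involution. -/
lemma rMatrix_F (hr : 3 ≤ r) (h0 : rbar r ≠ 0) (V W : WeightModule r) :
    rMatrix V W * (map (V.op .F) 1 + map (V.op .Kinv * V.par) (W.op .F)) =
      (map (V.op .F) 1 + map (V.op .K * V.par) (W.op .F)) * rMatrix V W := by
  rw [rMatrix_eq]
  refine sum_mul_add_eq _ _ _ _ _ _ ?_ (fun l hl => ?_) (fun l hl => ?_)
  · simp
  · have hc := rCoeff_succ hl
    have hq := qpow_sub_inv_ne_zero hr
    simp only [← TensorProduct.map_mul, one_mul, mul_one]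
    have e1 : V.op .F * (V.op .E ^ (l + 1) * V.par ^ (l + 1)) =
        (V.op .F * V.op .E ^ (l + 1)) * V.par ^ (l + 1) := by rw [mul_assoc]
    have e2 : V.op .E ^ (l + 1) * V.par ^ (l + 1) * V.op .F =
        (-1 : ℂ) ^ (l + 1) • (V.op .E ^ (l + 1) * V.op .F * V.par ^ (l + 1)) := by
      rw [mul_assoc, par_pow_mul_F, mul_smul_comm, mul_assoc]
    have e3 : V.op .E ^ l * V.par ^ l * (V.op .Kinv * V.par) =
        V.op .E ^ l * V.op .Kinv * V.par ^ (l + 1) := by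
      rw [mul_assoc, ← mul_assoc (V.par ^ l), par_pow_mul_Kinv, mul_assoc (V.op .Kinv), ← pow_succ,
        mul_assoc]
    have e4 : V.op .K * V.par * (V.op .E ^ l * V.par ^ l) =
        ((-1 : ℂ) ^ l * qpow r (2 * l)) • (V.op .E ^ l * V.op .K * V.par ^ (l + 1)) := by
      rw [mul_assoc, ← mul_assoc V.par, par_mul_E_pow, smul_mul_assoc, mul_smul_comm, mul_assoc,
        ← pow_succ', ← mul_assoc, V.rel.K_E_pow, smul_mul_assoc, smul_smul]
    rw [e1, e2, e3, e4, V.rel.E_pow_F, ← pow_succ, ← pow_succ', add_mul, smul_mul_assoc,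
      smul_mul_assoc, sub_mul, smul_mul_assoc, smul_mul_assoc]
    generalize W.op .F ^ (l + 1) = X
    simp only [TensorProduct.map_add_left, TensorProduct.map_smul_left, sub_eq_add_neg,
      map_neg_left']
    generalize map (V.op .E ^ l * V.op .K * V.par ^ (l + 1)) X = Y1
    generalize map (V.op .E ^ l * V.op .Kinv * V.par ^ (l + 1)) X = Y2
    generalize map (V.op .F * V.op .E ^ (l + 1) * V.par ^ (l + 1)) X = Y3
    rw [← sub_eq_add_neg] at *
    have hs := neg_one_sq_pow l
    have hql : qpow r l * qpow r (-l) = 1 := by rw [mul_comm, qpow_neg_mul]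
    have hql' : qpow r l * qpow r l = qpow r (2 * l) := by rw [← qpow_add, two_mul]
    have hqq : (qpow r 1 - qpow r (-1)) * (qpow r 1 - qpow r (-1))⁻¹ = 1 := mul_inv_cancel₀ hq
    generalize (qpow r 1 - qpow r (-1))⁻¹ = κ at *
    match_scalars
    · rw [pow_succ]; linear_combination -(rCoeff r (l + 1)) * hs
    · rw [pow_succ]
      linear_combination ((-1) ^ l * κ * qpow r l) * hc -
        ((-1) ^ l * rCoeff r l * qpow r l * qpow r l) * hqq - (-1) ^ l * rCoeff r l * hql'
    · rw [pow_succ]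
      linear_combination -(κ * qpow r (-l) * (-1) ^ l * (-1) ^ l) * hc +
        ((-1) ^ l * (-1) ^ l * rCoeff r l * qpow r l * qpow r (-l)) * hqq +
        (-1) ^ l * (-1) ^ l * rCoeff r l * hql + rCoeff r l * hs
  · simp only [← TensorProduct.map_mul]
    rw [← pow_succ, ← pow_succ', hl, W.rel.nilF h0, TensorProduct.map_zero_right,
      TensorProduct.map_zero_right]

end WeightModule

end Osp

namespace Osp

namespace WeightModule

variable {r : ℕ}

open TensorProduct (map)

/-! ### The braiding -/

lemma Homog.of_even {V : WeightModule r} {μ ν : ℂ} {a b : ℕ} {v : V} (h : V.Homog μ a v)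
    (hμ : μ = ν) (hab : Even (a + b)) : V.Homog ν b v := by
  refine ⟨hμ ▸ h.wt, ?_⟩
  rw [h.par]
  congr 1
  have h1 : (-1 : ℂ) ^ a * (-1) ^ b = 1 := by rw [← pow_add, hab.neg_one_pow]
  have h2 := neg_one_sq_pow b
  linear_combination (-1) ^ b * h1 - (-1) ^ a * h2

lemma Homog.sum {V : WeightModule r} {μ : ℂ} {a : ℕ} {ι : Type*} {s : Finset ι} {v : ι → V}
    (h : ∀ i ∈ s, V.Homog μ a (v i)) : V.Homog μ a (∑ i ∈ s, v i) :=
  ⟨by rw [map_sum, Finset.smul_sum]; exact Finset.sum_congr rfl fun i hi => (h i hi).wt,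
    by rw [map_sum, Finset.smul_sum]; exact Finset.sum_congr rfl fun i hi => (h i hi).par⟩

lemma homog_braidMap {V W : WeightModule r} {l m : ℂ} {a b : ℕ} {v : V} {w : W}
    (hv : V.Homog l a v) (hw : W.Homog m b w) :
    (tensor W V).Homog (l + m) (a + b) (braidMap V W (v ⊗ₜ w)) := by
  rw [braidMap_tmul hv hw]
  refine Homog.sum fun k _ => Homog.smul ?_ _
  refine ((hw.F_pow k).tmul (hv.E_pow k)).of_even (by ring) ⟨a + b + k, by ring⟩

lemma braidMap_eq (V W : WeightModule r) : braidMap V W = twistMap V W ∘ₗ rMatrix V W := rfl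

/-- The braiding as a morphism of weight modules. -/
def braidHom (hr : 3 ≤ r) (h0 : rbar r ≠ 0) (V W : WeightModule r) : tensor V W ⟶ tensor W V where
  toLin := braidMap V W
  map_par v := by
    have : braidMap V W ∘ₗ (tensor V W).par = (tensor W V).par ∘ₗ braidMap V W :=
      ext_homog₂ fun l a v hv m b w hw => by
        rw [LinearMap.comp_apply, LinearMap.comp_apply, (hv.tmul hw).par, map_smul,
          (homog_braidMap hv hw).par]
    exact LinearMap.congr_fun this v
  map_act := map_act_of_gen (V := tensor V W) (W := tensor W V) (braidMap V W) fun x v => by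
    have : braidMap V W ∘ₗ (tensor V W).op x = (tensor W V).op x ∘ₗ braidMap V W := by
      cases x with
      | H =>
        refine ext_homog₂ fun l a v hv m b w hw => ?_
        rw [LinearMap.comp_apply, LinearMap.comp_apply, (hv.tmul hw).wt, map_smul,
          (homog_braidMap hv hw).wt]
      | K =>
        refine ext_homog₂ fun l a v hv m b w hw => ?_
        rw [LinearMap.comp_apply, LinearMap.comp_apply, (hv.tmul hw).K, map_smul,
          (homog_braidMap hv hw).K]
      | Kinv =>
        refine ext_homog₂ fun l a v hv m b w hw => ?_
        rw [LinearMap.comp_apply, LinearMap.comp_apply, (hv.tmul hw).Kinv, map_smul,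
          (homog_braidMap hv hw).Kinv]
      | E =>
        rw [tensor_op, tensor_op]
        simp only [genFun]
        have h := rMatrix_E hr h0 V W
        rw [braidMap_eq, LinearMap.comp_assoc, ← Module.End.mul_eq_comp, h, Module.End.mul_eq_comp,
          ← LinearMap.comp_assoc, LinearMap.comp_add, twistMap_par_E, twistMap_E_Kinv, add_comm,
          ← LinearMap.add_comp, LinearMap.comp_assoc]
      | F =>
        rw [tensor_op, tensor_op]
        simp only [genFun]
        have h := rMatrix_F hr h0 V W
        rw [braidMap_eq, LinearMap.comp_assoc, ← Module.End.mul_eq_comp,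
          add_comm (map (V.op .Kinv * V.par) (W.op .F)), h, Module.End.mul_eq_comp,
          ← LinearMap.comp_assoc, LinearMap.comp_add, twistMap_K_par_F, twistMap_F,
          ← LinearMap.add_comp, LinearMap.comp_assoc]
    exact LinearMap.congr_fun this v

/-- `(E σ)^l = ± E^l σ^l`, so that the quasi-`R`-matrix is a polynomial in `E σ ⊗ F`. -/
lemma exists_E_par_pow (V : WeightModule r) (l : ℕ) :
    ∃ c : ℂ, V.op .E ^ l * V.par ^ l = c • (V.op .E * V.par) ^ l := by
  induction l with
  | zero => exact ⟨1, by simp⟩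
  | succ l ih =>
    obtain ⟨c, hc⟩ := ih
    refine ⟨(-1) ^ l * c, ?_⟩
    have h := par_mul_E_pow V
    have e : V.op .E * V.par ^ l = (-1 : ℂ) ^ l • (V.par ^ l * V.op .E) := by
      rw [par_pow_mul_E, smul_smul, neg_one_sq_pow, one_smul]
    rw [pow_succ (V.op .E), pow_succ V.par, mul_assoc, ← mul_assoc (V.op .E) (V.par ^ l), e,
      smul_mul_assoc, mul_smul_comm, mul_assoc, ← mul_assoc, hc, smul_mul_assoc, smul_smul,
      ← pow_succ]

/-- The quasi-`R`-matrix is `1` plus a multiple of the nilpotent operator `E σ ⊗ F`. -/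
lemma isUnit_rMatrix (h0 : rbar r ≠ 0) (V W : WeightModule r) : IsUnit (rMatrix V W) := by
  choose c hc using exists_E_par_pow V
  set T : Module.End ℂ (V ⊗[ℂ] W) := map (V.op .E * V.par) (W.op .F) with hT
  have hpow : ∀ l, map (V.op .E ^ l * V.par ^ l) (W.op .F ^ l) = c l • T ^ l := fun l => by
    rw [hc, TensorProduct.map_smul_left, hT, TensorProduct.map_pow]
  have hnil : IsNilpotent T := ⟨rbar r, by
    rw [hT, TensorProduct.map_pow, W.rel.nilF h0, TensorProduct.map_zero_right]⟩
  obtain ⟨n, hn⟩ := Nat.exists_eq_succ_of_ne_zero h0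
  rw [rMatrix_eq, hn, Finset.sum_range_succ', add_comm]
  have h1 : rCoeff r 0 • map (V.op .E ^ 0 * V.par ^ 0) (W.op .F ^ 0) = 1 := by
    simp [rCoeff_zero]
  rw [h1]
  refine IsNilpotent.isUnit_one_add ?_
  have h2 : ∑ k ∈ Finset.range n,
      rCoeff r (k + 1) • map (V.op .E ^ (k + 1) * V.par ^ (k + 1)) (W.op .F ^ (k + 1)) =
      T * ∑ k ∈ Finset.range n, (rCoeff r (k + 1) * c (k + 1)) • T ^ k := by
    rw [Finset.mul_sum]
    refine Finset.sum_congr rfl fun k _ => ?_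
    rw [hpow, smul_smul, mul_smul_comm, ← pow_succ']
  rw [h2]
  refine Commute.isNilpotent_mul_right ?_ hnil
  exact Commute.sum_right _ _ _ fun k _ => (Commute.pow_right (Commute.refl T) k).smul_right _

/-- An inverse of `τ ∘ Υ` is built from the spectral projections of `H` with the exponents negated. -/
lemma exists_twistMap_comp (V W : WeightModule r) :
    ∃ g : W ⊗[ℂ] V →ₗ[ℂ] V ⊗[ℂ] W, g ∘ₗ twistMap V W = LinearMap.id := by
  let u : Module.End ℂ (W ⊗[ℂ] V) := ∑ m ∈ eigs (W.op .H), ∑ l ∈ eigs (V.op .H),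
    qpow r (-(l * m / 2)) • map (eigProj (W.op .H) m) (eigProj (V.op .H) l)
  have hu : ∀ (l m : ℂ) (v : V) (w : W), V.op .H v = l • v → W.op .H w = m • w →
      u (w ⊗ₜ v) = qpow r (-(l * m / 2)) • (w ⊗ₜ[ℂ] v) := by
    intro l m v w hv hw
    by_cases hv0 : v = 0
    · simp [hv0]
    by_cases hw0 : w = 0
    · simp [hw0]
    have h1 := mem_eigs hv hv0
    have h2 := mem_eigs hw hw0
    simp only [u, LinearMap.sum_apply, LinearMap.smul_apply, TensorProduct.map_tmul]
    rw [Finset.sum_eq_single_of_mem m h2, Finset.sum_eq_single_of_mem l h1]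
    · rw [eigProj_apply h1 hv, eigProj_apply h2 hw, if_pos rfl, if_pos rfl]
    · intro k hk hkm
      rw [eigProj_apply hk hv, if_neg hkm]; simp
    · intro k hk hkm
      refine Finset.sum_eq_zero fun j hj => ?_
      rw [eigProj_apply hk hw, if_neg hkm]; simp
  refine ⟨koszul W V ∘ₗ u, ext_homog₂ fun l a v hv m b w hw => ?_⟩
  rw [LinearMap.comp_apply, twistMap_tmul hv hw, map_smul, LinearMap.comp_apply,
    hu _ _ _ _ hv.wt hw.wt, map_smul, koszul_apply W V _ _ _ _ hw.par hv.par, smul_smul, smul_smul,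
    mul_comm b a]
  have h1 := qpow_neg_mul r (l * m / 2)
  have h2 := neg_one_sq_pow (a * b)
  have : qpow r (l * m / 2) * (-1) ^ (a * b) * (qpow r (-(l * m / 2)) * (-1) ^ (a * b)) = 1 := by
    linear_combination (-1) ^ (a * b) * (-1) ^ (a * b) * h1 + h2
  rw [← mul_assoc] at this
  rw [this, one_smul]
  rfl

lemma braidMap_bijective (h0 : rbar r ≠ 0) (V W : WeightModule r) :
    Function.Bijective (braidMap V W) := by
  have hinj : Function.Injective (braidMap V W) := by
    obtain ⟨g, hg⟩ := exists_twistMap_comp V W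
    rw [braidMap_eq, LinearMap.coe_comp]
    refine Function.Injective.comp
      (Function.LeftInverse.injective (g := g) fun x => LinearMap.congr_fun hg x) ?_
    exact ((Module.End.isUnit_iff _).mp (isUnit_rMatrix h0 V W)).1
  refine ⟨hinj, ?_⟩
  refine (LinearMap.injective_iff_surjective_of_finrank_eq_finrank ?_).mp hinj
  rw [Module.finrank_tensorProduct, Module.finrank_tensorProduct, mul_comm]

/-- A morphism of weight modules which is bijective is an isomorphism. -/
def isoOfBijective {V W : WeightModule r} (f : V ⟶ W) (h : Function.Bijective f.toLin) : V ≅ W :=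
  mkIso (LinearEquiv.ofBijective f.toLin h) f.map_par fun _ v => f.map_act _ v

/-- The braiding isomorphism. -/
def braidIso (hr : 3 ≤ r) (h0 : rbar r ≠ 0) (V W : WeightModule r) : V ⊗ W ≅ W ⊗ V :=
  isoOfBijective (V := tensor V W) (W := tensor W V) (braidHom hr h0 V W) (braidMap_bijective h0 V W)

/-! ### Naturality and the hexagon identities -/

lemma toLin_E_pow {V W : WeightModule r} (f : V ⟶ W) (k : ℕ) (v : V) :
    f.toLin ((V.op .E ^ k) v) = (W.op .E ^ k) (f.toLin v) := by
  have := f.map_act (gen r .E ^ k) v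
  simpa only [map_pow] using this

lemma toLin_F_pow {V W : WeightModule r} (f : V ⟶ W) (k : ℕ) (v : V) :
    f.toLin ((V.op .F ^ k) v) = (W.op .F ^ k) (f.toLin v) := by
  have := f.map_act (gen r .F ^ k) v
  simpa only [map_pow] using this

lemma braidMap_natural {V V' W W' : WeightModule r} (f : V ⟶ V') (g : W ⟶ W') :
    braidMap V' W' ∘ₗ map f.toLin g.toLin = map g.toLin f.toLin ∘ₗ braidMap V W := by
  refine ext_homog₂ fun l a v hv m b w hw => ?_
  rw [LinearMap.comp_apply, LinearMap.comp_apply, TensorProduct.map_tmul,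
    braidMap_tmul (hv.map f) (hw.map g), braidMap_tmul hv hw, map_sum]
  refine Finset.sum_congr rfl fun k _ => ?_
  rw [map_smul, TensorProduct.map_tmul, toLin_E_pow, toLin_F_pow]

/-- For a function supported on `k + j < n`, summing over the triangle is summing over the square. In
the hexagon identities the support condition comes from `E^{r̄} = F^{r̄} = 0`. -/
lemma sum_antidiagonal_eq_sum_range {M : Type*} [AddCommMonoid M] (n : ℕ) (f : ℕ → ℕ → M)
    (h : ∀ k j, n ≤ k + j → f k j = 0) :
    ∑ l ∈ Finset.range n, ∑ p ∈ Finset.HasAntidiagonal.antidiagonal l, f p.1 p.2 =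
      ∑ k ∈ Finset.range n, ∑ j ∈ Finset.range n, f k j := by
  rw [← Finset.sum_product', Finset.sum_sigma']
  refine Finset.sum_bij_ne_zero (fun x _ _ => x.2) ?_ ?_ ?_ ?_
  · rintro ⟨l, k, j⟩ h1 _
    simp only [Finset.mem_sigma, Finset.mem_range, Finset.HasAntidiagonal.mem_antidiagonal] at h1
    simp only [Finset.mem_product, Finset.mem_range]
    omega
  · rintro ⟨l, k, j⟩ h1 _ ⟨l', k', j'⟩ h2 _ h3
    simp only [Finset.mem_sigma, Finset.mem_range, Finset.HasAntidiagonal.mem_antidiagonal] at h1 h2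
    simp only [Prod.mk.injEq] at h3
    obtain ⟨rfl, rfl⟩ := h3
    obtain ⟨_, rfl⟩ := h1
    obtain ⟨_, rfl⟩ := h2
    rfl
  · rintro ⟨k, j⟩ h1 h2
    refine ⟨⟨k + j, k, j⟩, ?_, h2, rfl⟩
    simp only [Finset.mem_sigma, Finset.mem_range, Finset.HasAntidiagonal.mem_antidiagonal, and_true]
    by_contra h3
    exact h2 (h k j (by omega))
  · intros; rfl

/-- The `q`-binomial formula for the powers of `F` on a tensor product. -/
lemma tensor_F_pow (V W : WeightModule r) {l : ℂ} {a : ℕ} {v : V} (hv : V.Homog l a v) (w : W)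
    (n : ℕ) : ((tensor V W).op .F ^ n) (v ⊗ₜ w) =
      ∑ p ∈ Finset.HasAntidiagonal.antidiagonal n,
        (gauss (-qpow r 2) p.1 p.2 * (-1) ^ (a * p.2) * qpow r (-(l * p.2))) •
          ((V.op .F ^ p.1) v ⊗ₜ[ℂ] (W.op .F ^ p.2) w) := by
  have hc : map (V.op .Kinv * V.par) (W.op .F) * map (V.op .F) (1 : Module.End ℂ W) =
      (-qpow r 2) • (map (V.op .F) (1 : Module.End ℂ W) * map (V.op .Kinv * V.par) (W.op .F)) := by
    rw [← TensorProduct.map_mul, ← TensorProduct.map_mul, mul_assoc, V.par_F, mul_neg, ← mul_assoc,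
      V.rel.KiF, smul_mul_assoc, ← neg_smul, TensorProduct.map_smul_left, one_mul, mul_one,
      mul_assoc]
  have hp : ∀ j : ℕ, ((V.op .Kinv * V.par) ^ j) v = ((-1) ^ (a * j) * qpow r (-(l * j))) • v := by
    intro j
    induction j with
    | zero => simp [qpow_zero]
    | succ j ih =>
      rw [pow_succ', Module.End.mul_apply, ih, map_smul, Module.End.mul_apply, hv.par, map_smul,
        hv.Kinv, smul_smul, smul_smul]
      congr 1
      have : qpow r (-(l * (j + 1 : ℕ))) = qpow r (-(l * j)) * qpow r (-l) := by
        rw [← qpow_add]; congr 1; push_cast; ring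
      rw [this, Nat.mul_succ, pow_add]
      ring
  rw [tensor_op]
  simp only [genFun]
  rw [add_comm, add_pow_gauss _ _ _ hc, LinearMap.sum_apply]
  refine Finset.sum_congr rfl fun p _ => ?_
  rw [LinearMap.smul_apply, TensorProduct.map_pow, TensorProduct.map_pow, ← TensorProduct.map_mul,
    TensorProduct.map_tmul, Module.End.mul_apply, hp, map_smul, ← TensorProduct.smul_tmul',
    smul_smul, one_pow, one_mul, mul_assoc]

/-- The `q`-binomial formula for the powers of `E` on a tensor product. -/
lemma tensor_E_pow (V W : WeightModule r) {l m : ℂ} {a b : ℕ} {v : V} {w : W} (hv : V.Homog l a v)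
    (hw : W.Homog m b w) (n : ℕ) : ((tensor V W).op .E ^ n) (v ⊗ₜ w) =
      ∑ p ∈ Finset.HasAntidiagonal.antidiagonal n,
        (gauss (-qpow r 2) p.1 p.2 * (-1) ^ (p.1 * (a + p.2)) * qpow r (m * p.2)) •
          ((V.op .E ^ p.2) v ⊗ₜ[ℂ] (W.op .E ^ p.1) w) := by
  have hc : map (V.op .E) (W.op .K) * map V.par (W.op .E) =
      (-qpow r 2) • (map V.par (W.op .E) * map (V.op .E) (W.op .K)) := by
    rw [← TensorProduct.map_mul, ← TensorProduct.map_mul, V.par_E, W.rel.KE,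
      TensorProduct.map_smul_right, map_neg_left', smul_neg, neg_smul, neg_neg]
  have hp : ∀ j : ℕ, (W.op .K ^ j) w = qpow r (m * j) • w := by
    intro j
    induction j with
    | zero => simp [qpow_zero]
    | succ j ih =>
      rw [pow_succ', Module.End.mul_apply, ih, map_smul, hw.K, smul_smul, ← qpow_add]
      congr 2; push_cast; ring
  rw [tensor_op]
  simp only [genFun]
  rw [add_pow_gauss _ _ _ hc, LinearMap.sum_apply]
  refine Finset.sum_congr rfl fun p _ => ?_
  rw [LinearMap.smul_apply, TensorProduct.map_pow, TensorProduct.map_pow, ← TensorProduct.map_mul,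
    TensorProduct.map_tmul, Module.End.mul_apply, Module.End.mul_apply, hp,
    (hv.E_pow p.2).par_pow, map_smul, ← TensorProduct.smul_tmul', TensorProduct.tmul_smul,
    smul_smul, smul_smul, mul_assoc]

lemma E_pow_eq_zero (h0 : rbar r ≠ 0) (V : WeightModule r) {n : ℕ} (h : rbar r ≤ n) :
    V.op .E ^ n = 0 := pow_eq_zero_of_le h (V.rel.nilE h0)

lemma F_pow_eq_zero (h0 : rbar r ≠ 0) (V : WeightModule r) {n : ℕ} (h : rbar r ≤ n) :
    V.op .F ^ n = 0 := pow_eq_zero_of_le h (V.rel.nilF h0)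

/-- The hexagon identity for `X ⊗ (Y ⊗ Z) ⟶ (Y ⊗ Z) ⊗ X` on homogeneous vectors. -/
lemma braidMap_tensor_right (h0 : rbar r ≠ 0) {X Y Z : WeightModule r} {l m n : ℂ} {a b c : ℕ}
    {x : X} {y : Y} {z : Z} (hx : X.Homog l a x) (hy : Y.Homog m b y) (hz : Z.Homog n c z) :
    TensorProduct.assoc ℂ Y Z X (braidMap X (tensor Y Z) (x ⊗ₜ (y ⊗ₜ z))) =
      map LinearMap.id (braidMap X Z)
        (TensorProduct.assoc ℂ Y X Z (braidMap X Y (x ⊗ₜ y) ⊗ₜ z)) := by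
  rw [braidMap_tmul hx (hy.tmul hz), braidMap_tmul hx hy]
  simp only [tensor_F_pow Y Z hy, TensorProduct.sum_tmul, map_sum, ← TensorProduct.smul_tmul',
    map_smul, TensorProduct.assoc_tmul, Finset.smul_sum, smul_smul, TensorProduct.map_tmul,
    LinearMap.id_apply]
  have e1 : ∀ k, braidMap X Z ((X.op .E ^ k) x ⊗ₜ z) = _ := fun k =>
    braidMap_tmul (hx.E_pow k) hz
  simp only [e1, TensorProduct.tmul_sum, TensorProduct.tmul_smul, Finset.smul_sum, smul_smul,
    ← Module.End.mul_apply, ← pow_add]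
  have e2 := sum_antidiagonal_eq_sum_range (rbar r) (fun k j =>
    ((rCoeff r (k + j) * (-1) ^ ((k + j) * a) *
      qpow r ((l + 2 * (k + j : ℕ)) * (m + n - 2 * (k + j : ℕ)) / 2) *
      (-1) ^ ((a + (k + j)) * (b + c + (k + j)))) * (gauss (-qpow r 2) k j * (-1) ^ (b * j) *
        qpow r (-(m * j)))) •
      ((Y.op .F ^ k) y ⊗ₜ[ℂ] ((Z.op .F ^ j) z ⊗ₜ[ℂ] (X.op .E ^ (k + j)) x))) (fun k j h => by
      simp [E_pow_eq_zero h0 X h])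
  refine Eq.trans (Finset.sum_congr rfl fun t _ => Finset.sum_congr rfl fun p hp => ?_)
    (e2.trans (Finset.sum_congr rfl fun k hk => Finset.sum_congr rfl fun j hj => ?_))
  · rw [← Finset.HasAntidiagonal.mem_antidiagonal.mp hp]
  · rw [add_comm j k]
    rcases le_or_gt (rbar r) (k + j) with h | h
    · simp [E_pow_eq_zero h0 X h]
    · congr 1
      have hc := rCoeff_add h
      have hs : (-1 : ℂ) ^ ((k + j) * a) * (-1) ^ ((a + (k + j)) * (b + c + (k + j))) *
          (-1) ^ (b * j) = (-1) ^ (k * a) * (-1) ^ ((a + k) * (b + k)) * (-1) ^ (j * (a + k)) *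
            (-1) ^ ((a + k + j) * (c + j)) := by
        rw [← pow_add, ← pow_add, ← pow_add, ← pow_add, ← pow_add,
          show (k + j) * a + (a + (k + j)) * (b + c + (k + j)) + b * j =
            (k * a + (a + k) * (b + k) + j * (a + k) + (a + k + j) * (c + j)) + 2 * (b * j) by ring,
          pow_add, pow_mul _ 2, neg_one_sq, one_pow, mul_one]
      have hq : qpow r ((l + 2 * (k + j : ℕ)) * (m + n - 2 * (k + j : ℕ)) / 2) *
          qpow r (-(m * j)) = qpow r (-(2 * j * k)) * qpow r ((l + 2 * k) * (m - 2 * k) / 2) *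
            qpow r ((l + 2 * k + 2 * j) * (n - 2 * j) / 2) := by
        rw [← qpow_add, ← qpow_add, ← qpow_add]; congr 1; push_cast; ring
      generalize (-1 : ℂ) ^ ((k + j) * a) = s1 at *
      generalize (-1 : ℂ) ^ ((a + (k + j)) * (b + c + (k + j))) = s2 at *
      generalize (-1 : ℂ) ^ (b * j) = s3 at *
      generalize (-1 : ℂ) ^ (k * a) = s4 at *
      generalize (-1 : ℂ) ^ ((a + k) * (b + k)) = s5 at *
      generalize (-1 : ℂ) ^ (j * (a + k)) = s6 at *
      generalize (-1 : ℂ) ^ ((a + k + j) * (c + j)) = s7 at *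
      generalize qpow r ((l + 2 * (k + j : ℕ)) * (m + n - 2 * (k + j : ℕ)) / 2) = q1 at *
      generalize qpow r (-(m * j)) = q2 at *
      generalize qpow r (-(2 * j * k)) = q3 at *
      generalize qpow r ((l + 2 * k) * (m - 2 * k) / 2) = q4 at *
      generalize qpow r ((l + 2 * k + 2 * j) * (n - 2 * j) / 2) = q5 at *
      generalize gauss (-qpow r 2) k j = g at *
      linear_combination (rCoeff r (k + j) * g * q1 * q2) * hs +
        (rCoeff r (k + j) * g * s4 * s5 * s6 * s7) * hq + (q4 * q5 * s4 * s5 * s6 * s7) * hc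

/-- The hexagon identity for `(X ⊗ Y) ⊗ Z ⟶ Z ⊗ (X ⊗ Y)` on homogeneous vectors. -/
lemma braidMap_tensor_left (h0 : rbar r ≠ 0) {X Y Z : WeightModule r} {l m n : ℂ} {a b c : ℕ}
    {x : X} {y : Y} {z : Z} (hx : X.Homog l a x) (hy : Y.Homog m b y) (hz : Z.Homog n c z) :
    (TensorProduct.assoc ℂ Z X Y).symm (braidMap (tensor X Y) Z ((x ⊗ₜ y) ⊗ₜ z)) =
      map (braidMap X Z) LinearMap.id
        ((TensorProduct.assoc ℂ X Z Y).symm (x ⊗ₜ braidMap Y Z (y ⊗ₜ z))) := by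
  rw [braidMap_tmul (hx.tmul hy) hz, braidMap_tmul hy hz]
  simp only [tensor_E_pow X Y hx hy, TensorProduct.tmul_sum, map_sum, TensorProduct.tmul_smul,
    map_smul, TensorProduct.assoc_symm_tmul, Finset.smul_sum, smul_smul, TensorProduct.map_tmul,
    LinearMap.id_apply]
  have e1 : ∀ k, braidMap X Z (x ⊗ₜ (Z.op .F ^ k) z) = _ := fun k =>
    braidMap_tmul hx (hz.F_pow k)
  simp only [e1, TensorProduct.sum_tmul, ← TensorProduct.smul_tmul', Finset.smul_sum, smul_smul,
    ← Module.End.mul_apply, ← pow_add]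
  have e2 := sum_antidiagonal_eq_sum_range (rbar r) (fun k j =>
    ((rCoeff r (k + j) * (-1) ^ ((k + j) * (a + b)) *
      qpow r ((l + m + 2 * (k + j : ℕ)) * (n - 2 * (k + j : ℕ)) / 2) *
      (-1) ^ ((a + b + (k + j)) * (c + (k + j)))) * (gauss (-qpow r 2) k j * (-1) ^ (k * (a + j)) *
        qpow r (m * j))) •
      (((Z.op .F ^ (k + j)) z ⊗ₜ[ℂ] (X.op .E ^ j) x) ⊗ₜ[ℂ] (Y.op .E ^ k) y)) (fun k j h => by
      simp [F_pow_eq_zero h0 Z h])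
  refine Eq.trans (Finset.sum_congr rfl fun t _ => Finset.sum_congr rfl fun p hp => ?_)
    (e2.trans (Finset.sum_congr rfl fun k hk => Finset.sum_congr rfl fun j hj => ?_))
  · rw [← Finset.HasAntidiagonal.mem_antidiagonal.mp hp]
  · rw [add_comm j k]
    rcases le_or_gt (rbar r) (k + j) with h | h
    · simp [F_pow_eq_zero h0 Z h]
    · congr 1
      have hc := rCoeff_add h
      have hs : (-1 : ℂ) ^ ((k + j) * (a + b)) * (-1) ^ ((a + b + (k + j)) * (c + (k + j))) *
          (-1) ^ (k * (a + j)) = (-1) ^ (k * b) * (-1) ^ ((b + k) * (c + k)) * (-1) ^ (j * a) *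
            (-1) ^ ((a + j) * (c + k + j)) := by
        rw [← pow_add, ← pow_add, ← pow_add, ← pow_add, ← pow_add,
          show (k + j) * (a + b) + (a + b + (k + j)) * (c + (k + j)) + k * (a + j) =
            (k * b + (b + k) * (c + k) + j * a + (a + j) * (c + k + j)) +
              2 * (k * a + j * b + k * j) by ring,
          pow_add, pow_mul _ 2, neg_one_sq, one_pow, mul_one]
      have hq : qpow r ((l + m + 2 * (k + j : ℕ)) * (n - 2 * (k + j : ℕ)) / 2) *
          qpow r (m * j) = qpow r (-(2 * j * k)) * qpow r ((m + 2 * k) * (n - 2 * k) / 2) *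
            qpow r ((l + 2 * j) * (n - 2 * k - 2 * j) / 2) := by
        rw [← qpow_add, ← qpow_add, ← qpow_add]; congr 1; push_cast; ring
      generalize (-1 : ℂ) ^ ((k + j) * (a + b)) = s1 at *
      generalize (-1 : ℂ) ^ ((a + b + (k + j)) * (c + (k + j))) = s2 at *
      generalize (-1 : ℂ) ^ (k * (a + j)) = s3 at *
      generalize (-1 : ℂ) ^ (k * b) = s4 at *
      generalize (-1 : ℂ) ^ ((b + k) * (c + k)) = s5 at *
      generalize (-1 : ℂ) ^ (j * a) = s6 at *
      generalize (-1 : ℂ) ^ ((a + j) * (c + k + j)) = s7 at *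
      generalize qpow r ((l + m + 2 * (k + j : ℕ)) * (n - 2 * (k + j : ℕ)) / 2) = q1 at *
      generalize qpow r (m * j) = q2 at *
      generalize qpow r (-(2 * j * k)) = q3 at *
      generalize qpow r ((m + 2 * k) * (n - 2 * k) / 2) = q4 at *
      generalize qpow r ((l + 2 * j) * (n - 2 * k - 2 * j) / 2) = q5 at *
      generalize gauss (-qpow r 2) k j = g at *
      linear_combination (rCoeff r (k + j) * g * q1 * q2) * hs +
        (rCoeff r (k + j) * g * s4 * s5 * s6 * s7) * hq + (q4 * q5 * s4 * s5 * s6 * s7) * hc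

/-- The braided category of weight modules, with braiding `τ ∘ Υ ∘ R̃`. -/
@[reducible] def braided (hr : 3 ≤ r) (h0 : rbar r ≠ 0) : BraidedCategory (WeightModule r) where
  braiding := braidIso hr h0
  braiding_naturality_right X Y Z f := hom_ext (braidMap_natural (𝟙 X) f)
  braiding_naturality_left f Z := hom_ext (braidMap_natural f (𝟙 Z))
  hexagon_forward X Y Z := by
    apply hom_ext
    refine ext_homog₃ fun l a x hx m b y hy n c z hz => ?_
    exact braidMap_tensor_right h0 hx hy hz
  hexagon_reverse X Y Z := by
    apply hom_ext
    refine (LinearMap.cancel_right (TensorProduct.assoc ℂ X Y Z).surjective).mp ?_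
    refine ext_homog₃ fun l a x hx m b y hy n c z hz => ?_
    exact braidMap_tensor_left h0 hx hy hz

lemma isStandardBraiding_braided (hr : 3 ≤ r) (h0 : rbar r ≠ 0) :
    IsStandardBraiding (braided hr h0) := fun _ _ => rfl

end WeightModule

end Osp

namespace Osp

namespace WeightModule

variable {r : ℕ}

open TensorProduct (map)

/-! ### Evaluation and coevaluation -/

lemma dual_op (V : WeightModule r) (x : Gen) : (dual V).op x =
    genFun (LinearMap.dualMap (-V.op .H)) (LinearMap.dualMap (V.op .Kinv))
      (LinearMap.dualMap (V.op .K)) (LinearMap.dualMap (V.par * -(V.op .E * V.op .Kinv)))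
      (LinearMap.dualMap (V.par * -(V.op .K * V.op .F))) x :=
  lift_gen (dual_rel V) x

lemma K_Kinv (V : WeightModule r) (v : V) : V.op .K (V.op .Kinv v) = v :=
  LinearMap.congr_fun V.rel.KKinv v

lemma Kinv_K (V : WeightModule r) (v : V) : V.op .Kinv (V.op .K v) = v :=
  LinearMap.congr_fun V.rel.KinvK v

/-- A linear functional on a tensor product which is invariant under the action of the generators,
as a morphism to the unit object. -/
def homToUnit (V W : WeightModule r) (f : V ⊗[ℂ] W →ₗ[ℂ] ℂ)
    (hp : ∀ v w, f (V.par v ⊗ₜ W.par w) = f (v ⊗ₜ w))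
    (hH : ∀ v w, f (V.op .H v ⊗ₜ w) + f (v ⊗ₜ W.op .H w) = 0)
    (hK : ∀ v w, f (V.op .K v ⊗ₜ W.op .K w) = f (v ⊗ₜ w))
    (hE : ∀ v w, f (V.par v ⊗ₜ W.op .E w) + f (V.op .E v ⊗ₜ W.op .K w) = 0)
    (hF : ∀ v w, f (V.op .Kinv (V.par v) ⊗ₜ W.op .F w) + f (V.op .F v ⊗ₜ w) = 0) :
    tensor V W ⟶ unit r where
  toLin := f
  map_par v := by
    have : f ∘ₗ (tensor V W).par = f := TensorProduct.ext' fun v w => hp v w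
    exact LinearMap.congr_fun this v
  map_act := map_act_of_gen (V := tensor V W) (W := unit r) f fun x v => by
    have : f ∘ₗ (tensor V W).op x = (unit r).op x ∘ₗ f := by
      rw [tensor_op, unit_op]
      refine TensorProduct.ext' fun v w => ?_
      cases x with
      | H => simpa [genFun] using hH v w
      | K => simpa [genFun] using hK v w
      | Kinv =>
        have := hK (V.op .Kinv v) (W.op .Kinv w)
        rw [K_Kinv, K_Kinv] at this
        simpa [genFun] using this.symm
      | E => simpa [genFun] using hE v w
      | F => simpa [genFun] using hF v w
    exact LinearMap.congr_fun this v

/-- An invariant vector of a tensor product, as a morphism from the unit object. -/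
def homFromUnit (V W : WeightModule r) (f : ℂ →ₗ[ℂ] V ⊗[ℂ] W)
    (hp : map V.par W.par (f 1) = f 1)
    (hH : map (V.op .H) 1 (f 1) + map 1 (W.op .H) (f 1) = 0)
    (hK : map (V.op .K) (W.op .K) (f 1) = f 1)
    (hE : map V.par (W.op .E) (f 1) + map (V.op .E) (W.op .K) (f 1) = 0)
    (hF : map (V.op .Kinv * V.par) (W.op .F) (f 1) + map (V.op .F) 1 (f 1) = 0) :
    unit r ⟶ tensor V W where
  toLin := f
  map_par v := by
    have : f = (tensor V W).par ∘ₗ f := LinearMap.ext_ring hp.symm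
    exact LinearMap.congr_fun this v
  map_act := map_act_of_gen (V := unit r) (W := tensor V W) f fun x v => by
    have : f ∘ₗ (unit r).op x = (tensor V W).op x ∘ₗ f := by
      rw [tensor_op, unit_op]
      refine LinearMap.ext_ring ?_
      cases x with
      | H => simpa [genFun] using hH.symm
      | K => simpa [genFun] using hK.symm
      | Kinv =>
        have := congrArg (map (V.op .Kinv) (W.op .Kinv)) hK
        rw [← LinearMap.comp_apply, ← TensorProduct.map_comp, ← Module.End.mul_eq_comp,
          ← Module.End.mul_eq_comp, V.rel.KinvK, W.rel.KinvK, TensorProduct.map_one] at this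
        simpa [genFun] using this
      | E => simpa [genFun] using hE.symm
      | F => simpa [genFun] using hF.symm
    exact LinearMap.congr_fun this v

/-- The left evaluation `f ⊗ v ↦ f(v)`. -/
def evLHom (V : WeightModule r) : tensor (dual V) V ⟶ unit r :=
  homToUnit (dual V) V (evLMap V)
    (fun f v => by simp [evLMap, par_par])
    (fun f v => by rw [dual_op]; simp [genFun, evLMap])
    (fun f v => by rw [dual_op]; simp [genFun, evLMap, Kinv_K])
    (fun f v => by rw [dual_op]; simp [genFun, evLMap, Kinv_K])
    (fun f v => by
      rw [dual_op, dual_op]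
      simp [genFun, evLMap])

lemma map_neg_left {M N : Type*} [AddCommGroup M] [Module ℂ M] [AddCommGroup N] [Module ℂ N]
    (f : Module.End ℂ M) (g : Module.End ℂ N) : map (-f) g = -map f g := by
  ext; simp [TensorProduct.neg_tmul]

/-- The coevaluation moves an endomorphism from one tensor factor to the other. -/
lemma map_dualMap_coevaluation (V : Type*) [AddCommGroup V] [Module ℂ V] [FiniteDimensional ℂ V]
    (A B : Module.End ℂ V) :
    map A (LinearMap.dualMap B) (coevaluation ℂ V 1) = map (A * B) 1 (coevaluation ℂ V 1) := by
  have key : ∀ A B : Module.End ℂ V, dualTensorHomEquiv ℂ V V (TensorProduct.comm ℂ _ _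
      (map A (LinearMap.dualMap B) (coevaluation ℂ V 1))) = A * B := by
    intro A B
    ext v
    rw [coevaluation_apply_one]
    simp only [map_sum, TensorProduct.map_tmul, TensorProduct.comm_tmul]
    rw [LinearMap.sum_apply]
    have := congrArg A ((Module.Basis.ofVectorSpace ℂ V).sum_repr (B v))
    rw [map_sum] at this
    rw [Module.End.mul_apply, ← this]
    refine Finset.sum_congr rfl fun i _ => ?_
    rw [map_smul]
    simp [dualTensorHomEquiv, dualTensorHom_apply]
  apply (TensorProduct.comm ℂ V (Module.Dual ℂ V)).injective
  apply (dualTensorHomEquiv ℂ V V).injective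
  have h := key (A * B) 1
  rw [mul_one] at h
  rw [key]
  exact h.symm

/-- The left coevaluation `1 ↦ ∑ i, v_i ⊗ v_i^∨`. -/
def coevLHom (V : WeightModule r) : unit r ⟶ tensor V (dual V) :=
  homFromUnit V (dual V) (coevLMap V)
    (by
      rw [coevLMap, map_dualMap_coevaluation, V.par_sq, TensorProduct.map_one]; rfl)
    (by
      rw [coevLMap, dual_op]
      simp only [genFun]
      rw [map_dualMap_coevaluation, one_mul, map_neg_left]
      simp)
    (by
      rw [coevLMap, dual_op]
      simp only [genFun]
      rw [map_dualMap_coevaluation, V.rel.KKinv, TensorProduct.map_one]; rfl)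
    (by
      rw [coevLMap, dual_op, dual_op]
      simp only [genFun]
      rw [map_dualMap_coevaluation, map_dualMap_coevaluation, ← mul_assoc, V.par_sq, one_mul,
        map_neg_left]
      simp)
    (by
      rw [coevLMap, dual_op]
      simp only [genFun]
      rw [map_dualMap_coevaluation, mul_assoc, ← mul_assoc V.par, V.par_sq, one_mul, mul_neg,
        ← mul_assoc, V.rel.KinvK, one_mul, map_neg_left]
      simp)

/-- The left duality. -/
@[reducible] def leftPairing (V : WeightModule r) : ExactPairing V (dual V) where
  coevaluation' := coevLHom V
  evaluation' := evLHom V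
  coevaluation_evaluation' := hom_ext (contractLeft_assoc_coevaluation ℂ V)
  evaluation_coevaluation' := hom_ext (contractLeft_assoc_coevaluation' ℂ V)

/-! ### The pivot -/

lemma Homog.Kpow {V : WeightModule r} {μ : ℂ} {a : ℕ} {v : V} (h : V.Homog μ a v) (n : ℤ) :
    V.Kpow n v = qpow r (n * μ) • v := by
  have hnat : ∀ n : ℕ, V.Kpow n v = qpow r (n * μ) • v := by
    intro n
    simp only [WeightModule.Kpow, zpow_natCast, Units.val_pow_eq_pow_val, map_pow]
    induction n with
    | zero => simp [qpow_zero]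
    | succ n ih =>
      rw [pow_succ', Module.End.mul_apply, ih, map_smul]
      have := h.K
      rw [show V.act ↑(Kunit r) v = _ from this, smul_smul, ← qpow_add]
      congr 2; push_cast; ring
  have hneg : ∀ n : ℕ, V.Kpow (-n) v = qpow r (-n * μ) • v := by
    intro n
    simp only [WeightModule.Kpow, zpow_neg, zpow_natCast, ← inv_pow, Units.val_pow_eq_pow_val,
      map_pow]
    induction n with
    | zero => simp [qpow_zero]
    | succ n ih =>
      rw [pow_succ', Module.End.mul_apply, ih, map_smul]
      have := h.Kinv
      rw [show V.act ↑(Kunit r)⁻¹ v = _ from this, smul_smul, ← qpow_add]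
      congr 2; push_cast; ring
  obtain ⟨m, rfl | rfl⟩ := n.eq_nat_or_neg
  · rw [hnat]; simp
  · rw [hneg]; simp

/-- The pivot `σ K^{1-s}`: the right evaluation is `v ⊗ f ↦ f(σ K^{1-s} v)`, the Koszul sign being
absorbed by the grading involution `σ`. -/
def pivot (s : ℤ) (V : WeightModule r) : Module.End ℂ V := V.par * V.Kpow (1 - s)

/-- The inverse of the pivot. -/
def pivotInv (s : ℤ) (V : WeightModule r) : Module.End ℂ V := V.Kpow (s - 1) * V.par

lemma Homog.pivot {V : WeightModule r} {μ : ℂ} {a : ℕ} {v : V} (h : V.Homog μ a v) (s : ℤ) :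
    V.pivot s v = ((-1) ^ a * qpow r ((1 - s) * μ)) • v := by
  rw [WeightModule.pivot, Module.End.mul_apply, h.Kpow, map_smul, h.par, smul_smul, mul_comm]
  push_cast; rfl

lemma Homog.pivotInv {V : WeightModule r} {μ : ℂ} {a : ℕ} {v : V} (h : V.Homog μ a v) (s : ℤ) :
    V.pivotInv s v = ((-1) ^ a * qpow r ((s - 1) * μ)) • v := by
  rw [WeightModule.pivotInv, Module.End.mul_apply, h.par, map_smul, h.Kpow, smul_smul]
  push_cast; rfl

lemma pivot_mul_pivotInv (s : ℤ) (V : WeightModule r) : V.pivot s * V.pivotInv s = 1 := by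
  refine ext_homog fun μ a v hv => ?_
  rw [Module.End.mul_apply, hv.pivotInv, map_smul, hv.pivot, smul_smul]
  have h1 : qpow r ((s - 1) * μ) * qpow r ((1 - s) * μ) = 1 := by
    rw [← qpow_add, ← qpow_zero r]; congr 1; ring
  have h2 := neg_one_sq_pow a
  have : (-1) ^ a * qpow r ((s - 1) * μ) * ((-1) ^ a * qpow r ((1 - s) * μ)) = 1 := by
    linear_combination (-1) ^ a * (-1) ^ a * h1 + h2
  rw [this, one_smul]; rfl

lemma pivotInv_mul_pivot (s : ℤ) (V : WeightModule r) : V.pivotInv s * V.pivot s = 1 :=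
  mul_eq_one_comm.mp (pivot_mul_pivotInv s V)

lemma pivot_par (s : ℤ) (V : WeightModule r) (v : V) :
    V.pivot s (V.par v) = V.par (V.pivot s v) := by
  have : V.pivot s * V.par = V.par * V.pivot s := ext_homog fun μ a v hv => by
    simp only [Module.End.mul_apply, hv.pivot, hv.par, map_smul, smul_smul, mul_comm]
  exact LinearMap.congr_fun this v

lemma pivot_H (s : ℤ) (V : WeightModule r) (v : V) :
    V.pivot s (V.op .H v) = V.op .H (V.pivot s v) := by
  have : V.pivot s * V.op .H = V.op .H * V.pivot s := ext_homog fun μ a v hv => by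
    simp only [Module.End.mul_apply, hv.pivot, hv.wt, map_smul, smul_smul, mul_comm]
  exact LinearMap.congr_fun this v

lemma pivot_K (s : ℤ) (V : WeightModule r) (v : V) :
    V.pivot s (V.op .K v) = V.op .K (V.pivot s v) := by
  have : V.pivot s * V.op .K = V.op .K * V.pivot s := ext_homog fun μ a v hv => by
    simp only [Module.End.mul_apply, hv.pivot, hv.K, map_smul, smul_smul, mul_comm]
  exact LinearMap.congr_fun this v

/-- Here `q^{2 s} = 1` enters: it makes `K^{1-s}` implement the square of the antipode. -/
lemma qpow_pivot_add {s : ℤ} (hs : qpow r (2 * (s : ℂ)) = 1) (μ : ℂ) :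
    qpow r ((1 - s) * (μ + 2)) = qpow r ((1 - s) * μ) * qpow r 2 := by
  rw [show (1 - (s : ℂ)) * (μ + 2) = (1 - s) * μ + 2 + -(2 * s) by ring, qpow_add, qpow_add,
    qpow_neg, hs, inv_one, mul_one]

lemma qpow_pivot_sub {s : ℤ} (hs : qpow r (2 * (s : ℂ)) = 1) (μ : ℂ) :
    qpow r ((1 - s) * (μ - 2)) = qpow r ((1 - s) * μ) * qpow r (-2) := by
  rw [show (1 - (s : ℂ)) * (μ - 2) = (1 - s) * μ + -2 + 2 * s by ring, qpow_add, qpow_add,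
    hs, mul_one]

lemma pivot_E {s : ℤ} (hs : qpow r (2 * (s : ℂ)) = 1) (V : WeightModule r) (v : V) :
    V.pivot s (V.op .E v) = -(qpow r 2 • V.op .E (V.pivot s v)) := by
  have : V.pivot s * V.op .E = -(qpow r 2 • (V.op .E * V.pivot s)) := ext_homog fun μ a v hv => by
    simp only [Module.End.mul_apply, hv.E.pivot, hv.pivot, map_smul, smul_smul,
      qpow_pivot_add hs, LinearMap.neg_apply, LinearMap.smul_apply, pow_succ]
    module
  exact LinearMap.congr_fun this v

lemma pivot_F {s : ℤ} (hs : qpow r (2 * (s : ℂ)) = 1) (V : WeightModule r) (v : V) :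
    V.pivot s (V.op .F v) = -(qpow r (-2) • V.op .F (V.pivot s v)) := by
  have : V.pivot s * V.op .F = -(qpow r (-2) • (V.op .F * V.pivot s)) :=
    ext_homog fun μ a v hv => by
      simp only [Module.End.mul_apply, hv.F.pivot, hv.pivot, map_smul, smul_smul,
        qpow_pivot_sub hs, LinearMap.neg_apply, LinearMap.smul_apply, pow_succ]
      module
  exact LinearMap.congr_fun this v

lemma evRMap_tmul (s : ℤ) (V : WeightModule r) (v : V) (f : Module.Dual ℂ V) :
    evRMap s V (v ⊗ₜ f) = f (V.pivot s v) := by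
  have h : ∀ w : V, contractLeft ℂ V (koszul V (dual V) (w ⊗ₜ[ℂ] f)) = f (V.par w) := by
    intro w
    simp [koszul, par_par]
    ring
  rw [evRMap, LinearMap.comp_apply, LinearMap.comp_apply, TensorProduct.map_tmul]
  exact h _

/-- The right evaluation `v ⊗ f ↦ (-1)^{|f||v|} f(K^{1-s} v)`. -/
def evRHom {s : ℤ} (hs : qpow r (2 * (s : ℂ)) = 1) (V : WeightModule r) :
    tensor V (dual V) ⟶ unit r :=
  homToUnit V (dual V) (evRMap s V)
    (fun v f => by
      simp only [evRMap_tmul, LinearMap.dualMap_apply, pivot_par, par_par])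
    (fun v f => by
      rw [dual_op]
      simp only [genFun, evRMap_tmul, LinearMap.dualMap_apply, pivot_H, LinearMap.neg_apply,
        map_neg, add_neg_cancel])
    (fun v f => by
      rw [dual_op]
      simp only [genFun, evRMap_tmul, LinearMap.dualMap_apply, pivot_K, Kinv_K])
    (fun v f => by
      rw [dual_op, dual_op]
      simp only [genFun, evRMap_tmul, LinearMap.dualMap_apply, pivot_par, pivot_E hs,
        Module.End.mul_apply, LinearMap.neg_apply, Kinv_par, E_par, map_neg, par_par, neg_neg]
      have : V.op .Kinv (V.op .E (V.pivot s v)) =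
          qpow r (-2) • V.op .E (V.op .Kinv (V.pivot s v)) :=
        LinearMap.congr_fun V.rel.KiE _
      rw [map_smul, this, smul_smul, mul_comm, qpow_neg_mul, one_smul, add_neg_cancel])
    (fun v f => by
      rw [dual_op]
      simp only [genFun, evRMap_tmul, LinearMap.dualMap_apply, pivot_par, pivot_F hs,
        Module.End.mul_apply, LinearMap.neg_apply, Kinv_par, F_par, K_par, map_neg, par_par, neg_neg]
      have e : V.pivot s (V.op .Kinv v) = V.op .Kinv (V.pivot s v) := by
        have := V.pivot_K s (V.op .Kinv v)
        rw [K_Kinv] at this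
        rw [this, Kinv_K]
      have : V.op .K (V.op .F (V.op .Kinv (V.pivot s v))) =
          qpow r (-2) • V.op .F (V.op .K (V.op .Kinv (V.pivot s v))) :=
        LinearMap.congr_fun V.rel.KF _
      rw [e, this, K_Kinv, add_neg_cancel])

lemma coevRMap_one (s : ℤ) (V : WeightModule r) : coevRMap s V 1 =
    TensorProduct.comm ℂ V (Module.Dual ℂ V) (map (V.pivotInv s) 1 (coevaluation ℂ V 1)) := by
  have h1 : map V.par (LinearMap.dualMap V.par) (coevaluation ℂ V 1) = coevaluation ℂ V 1 := by
    rw [map_dualMap_coevaluation, V.par_sq, TensorProduct.map_one]; rfl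
  have h2 : map (1 : Module.End ℂ V) (LinearMap.dualMap V.par) (coevaluation ℂ V 1) =
      map V.par 1 (coevaluation ℂ V 1) := by
    rw [map_dualMap_coevaluation, one_mul]
  have h3 : koszul V (dual V) (coevaluation ℂ V 1) =
      TensorProduct.comm ℂ V (Module.Dual ℂ V) (map V.par 1 (coevaluation ℂ V 1)) := by
    rw [koszul, LinearMap.comp_apply, LinearMap.smul_apply, LinearMap.sub_apply,
      LinearMap.add_apply, LinearMap.add_apply, h1]
    refine congrArg (TensorProduct.comm ℂ V (Module.Dual ℂ V)) ?_
    rw [show map (1 : Module.End ℂ V) (dual V).par (coevaluation ℂ V 1) = _ from h2,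
      TensorProduct.map_one, Module.End.one_apply]
    module
  rw [coevRMap, LinearMap.comp_apply, LinearMap.comp_apply, h3]
  generalize coevaluation ℂ V 1 = t
  have : map (LinearMap.id : Module.Dual ℂ V →ₗ[ℂ] Module.Dual ℂ V) (V.Kpow (s - 1)) ∘ₗ
      (TensorProduct.comm ℂ V (Module.Dual ℂ V)).toLinearMap ∘ₗ
        map V.par (1 : Module.End ℂ (Module.Dual ℂ V)) =
      (TensorProduct.comm ℂ V (Module.Dual ℂ V)).toLinearMap ∘ₗ map (V.pivotInv s) 1 :=
    TensorProduct.ext' fun _ _ => rfl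
  exact LinearMap.congr_fun this t

/-- All endomorphisms applied to the right coevaluation can be collected in the factor `V`, so its
invariance reduces to commutation relations with the inverse of the pivot. -/
lemma map_coevRMap_one (s : ℤ) (V : WeightModule r) (A B : Module.End ℂ V) :
    map (LinearMap.dualMap A) B (coevRMap s V 1) =
      TensorProduct.comm ℂ V (Module.Dual ℂ V)
        (map (B * V.pivotInv s * A) 1 (coevaluation ℂ V 1)) := by
  rw [← map_dualMap_coevaluation, coevRMap_one]
  generalize coevaluation ℂ V 1 = t
  have : map (LinearMap.dualMap A) B ∘ₗ
      (TensorProduct.comm ℂ V (Module.Dual ℂ V)).toLinearMap ∘ₗ map (V.pivotInv s) 1 =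
      (TensorProduct.comm ℂ V (Module.Dual ℂ V)).toLinearMap ∘ₗ
        map (B * V.pivotInv s) (LinearMap.dualMap A) :=
    TensorProduct.ext' fun _ _ => rfl
  exact LinearMap.congr_fun this t

lemma add_map_coevRMap_one (s : ℤ) (V : WeightModule r) (A B C D : Module.End ℂ V)
    (h : ∀ v, B (V.pivotInv s (A v)) + D (V.pivotInv s (C v)) = 0) :
    map (LinearMap.dualMap A) B (coevRMap s V 1) +
      map (LinearMap.dualMap C) D (coevRMap s V 1) = 0 := by
  have h' : B * V.pivotInv s * A + D * V.pivotInv s * C = 0 := LinearMap.ext h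
  rw [map_coevRMap_one, map_coevRMap_one, ← map_add, ← LinearMap.add_apply,
    ← TensorProduct.map_add_left, h', TensorProduct.map_zero_left]
  simp

lemma map_coevRMap_one_eq (s : ℤ) (V : WeightModule r) (A B : Module.End ℂ V)
    (h : ∀ v, B (V.pivotInv s (A v)) = V.pivotInv s v) :
    map (LinearMap.dualMap A) B (coevRMap s V 1) = coevRMap s V 1 := by
  have h' : B * V.pivotInv s * A = V.pivotInv s := LinearMap.ext h
  rw [map_coevRMap_one, h', coevRMap_one]

lemma pivot_pivotInv (s : ℤ) (V : WeightModule r) (v : V) : V.pivot s (V.pivotInv s v) = v :=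
  LinearMap.congr_fun (pivot_mul_pivotInv s V) v

lemma pivotInv_pivot (s : ℤ) (V : WeightModule r) (v : V) : V.pivotInv s (V.pivot s v) = v :=
  LinearMap.congr_fun (pivotInv_mul_pivot s V) v

/-- The right coevaluation `1 ↦ ∑ i, (-1)^{|v_i|} v_i^∨ ⊗ K^{s-1} v_i`. -/
def coevRHom {s : ℤ} (hs : qpow r (2 * (s : ℂ)) = 1) (V : WeightModule r) :
    unit r ⟶ tensor (dual V) V :=
  have hinj : Function.Injective (V.pivot s) :=
    Function.LeftInverse.injective (pivotInv_pivot s V)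
  homFromUnit (dual V) V (coevRMap s V)
    (map_coevRMap_one_eq s V _ _ fun v => hinj (by
      rw [pivot_par, pivot_pivotInv, pivot_pivotInv, par_par]))
    (by
      rw [dual_op]
      refine add_map_coevRMap_one s V _ _ 1 _ fun v => hinj ?_
      simp only [map_add, map_zero, Module.End.one_apply, pivot_pivotInv, pivot_H,
        LinearMap.neg_apply, neg_add_cancel])
    (by
      rw [dual_op]
      refine map_coevRMap_one_eq s V _ _ fun v => hinj ?_
      rw [pivot_K, pivot_pivotInv, pivot_pivotInv, K_Kinv])
    (by
      rw [dual_op]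
      refine add_map_coevRMap_one s V _ _ _ _ fun v => hinj ?_
      simp only [map_add, map_zero, pivot_pivotInv, pivot_E hs, pivot_K, Module.End.mul_apply,
        LinearMap.neg_apply, E_par, map_neg, smul_neg, neg_neg]
      have : V.op .K (V.op .E (V.op .Kinv v)) = qpow r 2 • V.op .E (V.op .K (V.op .Kinv v)) :=
        LinearMap.congr_fun V.rel.KE _
      rw [K_par, this, K_Kinv, map_smul, add_neg_cancel])
    (by
      rw [dual_op, dual_op]
      simp only [genFun]
      have e : LinearMap.dualMap (V.op .K) * (dual V).par =
          LinearMap.dualMap (V.par * V.op .K) := rfl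
      rw [e]
      refine add_map_coevRMap_one s V _ _ _ 1 fun v => hinj ?_
      simp only [map_add, map_zero, pivot_pivotInv, pivot_F hs, Module.End.mul_apply,
        LinearMap.neg_apply, F_par, map_neg, smul_neg, neg_neg, Module.End.one_apply]
      have : V.op .K (V.op .F v) = qpow r (-2) • V.op .F (V.op .K v) :=
        LinearMap.congr_fun V.rel.KF _
      rw [this, map_smul, add_neg_cancel])

lemma coevRMap_one_eq_sum (s : ℤ) (V : WeightModule r) : coevRMap s V 1 =
    ∑ i, (Module.Basis.ofVectorSpace ℂ V).coord i ⊗ₜ[ℂ]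
      V.pivotInv s (Module.Basis.ofVectorSpace ℂ V i) := by
  rw [coevRMap_one, coevaluation_apply_one]
  simp

/-- The right duality. -/
@[reducible] def rightPairing {s : ℤ} (hs : qpow r (2 * (s : ℂ)) = 1) (V : WeightModule r) :
    ExactPairing (dual V) V where
  coevaluation' := coevRHom hs V
  evaluation' := evRHom hs V
  coevaluation_evaluation' := by
    apply hom_ext
    refine TensorProduct.ext (LinearMap.ext fun v => LinearMap.ext_ring ?_)
    change map (evRMap s V) LinearMap.id ((TensorProduct.assoc ℂ V (Module.Dual ℂ V) V).symm
      (v ⊗ₜ coevRMap s V 1)) = (1 : ℂ) ⊗ₜ[ℂ] ((1 : ℂ) • v)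
    rw [coevRMap_one_eq_sum, TensorProduct.tmul_sum, map_sum, map_sum, one_smul]
    simp only [TensorProduct.assoc_symm_tmul, TensorProduct.map_tmul, evRMap_tmul,
      LinearMap.id_apply]
    have h := congrArg (V.pivotInv s)
      ((Module.Basis.ofVectorSpace ℂ V).sum_repr (V.pivot s v))
    rw [pivotInv_pivot, map_sum] at h
    refine Eq.trans ?_ (congrArg (fun x => (1 : ℂ) ⊗ₜ[ℂ] x) h)
    simp only [TensorProduct.tmul_sum]
    refine Finset.sum_congr rfl fun i _ => ?_
    rw [map_smul, ← TensorProduct.smul_tmul, smul_eq_mul, mul_one]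
    rfl
  evaluation_coevaluation' := by
    apply hom_ext
    refine TensorProduct.ext (LinearMap.ext_ring (LinearMap.ext fun f => ?_))
    change map LinearMap.id (evRMap s V) (TensorProduct.assoc ℂ (Module.Dual ℂ V) V
      (Module.Dual ℂ V) (coevRMap s V 1 ⊗ₜ f)) = ((1 : ℂ) • f) ⊗ₜ[ℂ] (1 : ℂ)
    rw [coevRMap_one_eq_sum, TensorProduct.sum_tmul, map_sum, map_sum, one_smul]
    simp only [TensorProduct.assoc_tmul, TensorProduct.map_tmul, evRMap_tmul, pivot_pivotInv,
      LinearMap.id_apply]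
    have h := (Module.Basis.ofVectorSpace ℂ V).sum_dual_apply_smul_coord f
    refine Eq.trans ?_ (congrArg (fun x => x ⊗ₜ[ℂ] (1 : ℂ)) h)
    simp only [TensorProduct.sum_tmul]
    refine Finset.sum_congr rfl fun i _ => ?_
    rw [TensorProduct.smul_tmul, smul_eq_mul, mul_one]

/-! ### The pivotal structure -/

/-- The duality functor of the left duality is transposition, without signs as morphisms are even. -/
lemma toLin_rightAdjointMate {V W : WeightModule r} (f : V ⟶ W) :
    Hom.toLin (@rightAdjointMate _ _ _ V W (@HasRightDual.mk _ _ _ V (dual V) (leftPairing V))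
      (@HasRightDual.mk _ _ _ W (dual W) (leftPairing W)) f) = LinearMap.dualMap f.toLin := by
  refine LinearMap.ext fun g => LinearMap.ext fun v => ?_
  have := @rightAdjointMate_comp_evaluation _ _ _ V W
    (@HasRightDual.mk _ _ _ V (dual V) (leftPairing V))
    (@HasRightDual.mk _ _ _ W (dual W) (leftPairing W)) f
  exact LinearMap.congr_fun (congrArg Hom.toLin this) (g ⊗ₜ[ℂ] v)

/-- The duality functor of the right duality is transposition as well. -/
lemma toLin_leftAdjointMate {s : ℤ} (hs : qpow r (2 * (s : ℂ)) = 1) {V W : WeightModule r}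
    (f : V ⟶ W) :
    Hom.toLin (@leftAdjointMate _ _ _ V W (@HasLeftDual.mk _ _ _ V (dual V) (rightPairing hs V))
      (@HasLeftDual.mk _ _ _ W (dual W) (rightPairing hs W)) f) = LinearMap.dualMap f.toLin := by
  refine LinearMap.ext fun g => LinearMap.ext fun v => ?_
  have h := @leftAdjointMate_comp_evaluation _ _ _ V W
    (@HasLeftDual.mk _ _ _ V (dual V) (rightPairing hs V))
    (@HasLeftDual.mk _ _ _ W (dual W) (rightPairing hs W)) f
  have h' := LinearMap.congr_fun (congrArg Hom.toLin h) (V.pivotInv s v ⊗ₜ[ℂ] g)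
  have e1 : evRMap s V (V.pivotInv s v ⊗ₜ _) = evRMap s W (f.toLin (V.pivotInv s v) ⊗ₜ g) := h'
  rw [evRMap_tmul, evRMap_tmul, pivot_pivotInv] at e1
  refine e1.trans ?_
  have e2 : W.pivot s (f.toLin (V.pivotInv s v)) = f.toLin (V.pivot s (V.pivotInv s v)) := by
    rw [pivot, Module.End.mul_apply, Kpow, ← f.map_act, ← f.map_par]
    rfl
  rw [e2, pivot_pivotInv]
  rfl

lemma leftPairing_tensor_evaluation (V W : WeightModule r) :
    @ExactPairing.evaluation _ _ _ (V ⊗ W) (dual W ⊗ dual V)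
      (@ExactPairing.tensor _ _ _ V W (dual V) (dual W) (leftPairing V) (leftPairing W)) =
    (α_ (dual W) (dual V) (V ⊗ W)).hom ≫ dual W ◁ (α_ (dual V) V W).inv ≫
      dual W ◁ (evLHom V ▷ W) ≫ dual W ◁ (λ_ W).hom ≫ evLHom W := by
  let := leftPairing V
  let := leftPairing W
  rw [ExactPairing.tensor_evaluation]
  simp [monoidalComp]
  rfl

lemma rightPairing_tensor_evaluation {s : ℤ} (hs : qpow r (2 * (s : ℂ)) = 1)
    (V W : WeightModule r) :
    @ExactPairing.evaluation _ _ _ (dual W ⊗ dual V) (V ⊗ W)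
      (@ExactPairing.tensor _ _ _ (dual W) (dual V) W V (rightPairing hs W) (rightPairing hs V)) =
    (α_ V W (dual W ⊗ dual V)).hom ≫ V ◁ (α_ W (dual W) (dual V)).inv ≫
      V ◁ (evRHom hs W ▷ dual V) ≫ V ◁ (λ_ (dual V)).hom ≫ evRHom hs V := by
  let := rightPairing hs V
  let := rightPairing hs W
  rw [ExactPairing.tensor_evaluation]
  simp [monoidalComp]
  rfl

/-- The identification of `W^∨ ⊗ V^∨` with `(V ⊗ W)^∨` determined by the left duality is
`g ⊗ f ↦ (v ⊗ w ↦ f(v) g(w))`, without a sign. -/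
lemma toLin_rightDualIso_tensor (V W : WeightModule r) (g : Module.Dual ℂ W) (f : Module.Dual ℂ V)
    (v : V) (w : W) :
    (Hom.toLin (rightDualIso (@ExactPairing.tensor _ _ _ V W (dual V) (dual W) (leftPairing V)
      (leftPairing W)) (leftPairing (V ⊗ W))).hom (g ⊗ₜ[ℂ] f) : Module.Dual ℂ (V ⊗[ℂ] W))
        (v ⊗ₜ[ℂ] w) = f v * g w := by
  have h := @rightAdjointMate_comp_evaluation _ _ _ (V ⊗ W) (V ⊗ W)
    (@HasRightDual.mk _ _ _ (V ⊗ W) (dual (V ⊗ W)) (leftPairing (V ⊗ W)))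
    (@HasRightDual.mk _ _ _ (V ⊗ W) (dual W ⊗ dual V) (@ExactPairing.tensor _ _ _ V W (dual V)
      (dual W) (leftPairing V) (leftPairing W))) (𝟙 _)
  replace h := h.trans (((congrArg (· ≫ _) (MonoidalCategory.whiskerLeft_id _ _)).trans
    (Category.id_comp _)).trans (leftPairing_tensor_evaluation V W))
  have h' := LinearMap.congr_fun (congrArg Hom.toLin h) ((g ⊗ₜ[ℂ] f) ⊗ₜ[ℂ] (v ⊗ₜ[ℂ] w))
  refine Eq.trans h' ?_
  change g (f v • w) = _
  rw [map_smul, smul_eq_mul]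

lemma evRHom_tensor {s : ℤ} (hs : qpow r (2 * (s : ℂ)) = 1) (V W : WeightModule r)
    (x : V ⊗[ℂ] W) (g : Module.Dual ℂ (V ⊗[ℂ] W)) :
    Hom.toLin (evRHom hs (tensor V W)) (x ⊗ₜ[ℂ] g) = g (map (V.pivot s) (W.pivot s) x) := by
  refine (evRMap_tmul s (tensor V W) x g).trans (congrArg g ?_)
  have : (tensor V W).pivot s = map (V.pivot s) (W.pivot s) :=
    ext_homog₂ fun l a v hv m b w hw => by
      rw [(hv.tmul hw).pivot, TensorProduct.map_tmul, hv.pivot, hw.pivot,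
        ← TensorProduct.smul_tmul', TensorProduct.tmul_smul, smul_smul]
      congr 1
      rw [mul_add, qpow_add, pow_add]
      ring
  rw [this]

/-- The pivotal structure determined by `s`. -/
@[reducible] def pivotal {s : ℤ} (hs : qpow r (2 * (s : ℂ)) = 1) :
    PivotalStructure (dual (r := r)) where
  left := leftPairing
  right := rightPairing hs
  mate_eq f := hom_ext ((toLin_rightAdjointMate f).trans (toLin_leftAdjointMate hs f).symm)
  tensor_eq V W := by
    apply hom_ext
    refine TensorProduct.ext' fun g f => ?_
    have h := @leftAdjointMate_comp_evaluation _ _ _ (V ⊗ W) (V ⊗ W)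
      (@HasLeftDual.mk _ _ _ (V ⊗ W) (dual (V ⊗ W)) (rightPairing hs (V ⊗ W)))
      (@HasLeftDual.mk _ _ _ (V ⊗ W) (dual W ⊗ dual V) (@ExactPairing.tensor _ _ _ (dual W)
        (dual V) W V (rightPairing hs W) (rightPairing hs V))) (𝟙 _)
    replace h := h.trans (((congrArg (· ≫ _) (MonoidalCategory.id_whiskerRight _ _)).trans
      (Category.id_comp _)).trans (rightPairing_tensor_evaluation hs V W))
    refine TensorProduct.ext' fun v w => ?_
    rw [toLin_rightDualIso_tensor]
    have h' := LinearMap.congr_fun (congrArg Hom.toLin h)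
      ((V.pivotInv s v ⊗ₜ[ℂ] W.pivotInv s w) ⊗ₜ[ℂ] (g ⊗ₜ[ℂ] f))
    have h1 := (evRHom_tensor hs V W (V.pivotInv s v ⊗ₜ[ℂ] W.pivotInv s w)
      (Hom.toLin (leftDualIso (@ExactPairing.tensor _ _ _ (dual W)
        (dual V) W V (rightPairing hs W) (rightPairing hs V)) (rightPairing hs (V ⊗ W))).hom
          (g ⊗ₜ[ℂ] f))).symm.trans h'
    rw [TensorProduct.map_tmul, pivot_pivotInv, pivot_pivotInv] at h1
    refine Eq.trans ?_ h1.symm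
    change _ = evRMap s V (V.pivotInv s v ⊗ₜ[ℂ]
      (evRMap s W (W.pivotInv s w ⊗ₜ[ℂ] g) • f))
    rw [evRMap_tmul, evRMap_tmul, pivot_pivotInv, LinearMap.smul_apply, pivot_pivotInv,
      smul_eq_mul, mul_comm]
  unit_eq := by
    apply hom_ext
    refine LinearMap.ext_ring (LinearMap.ext_ring ?_)
    have h := @rightAdjointMate_comp_evaluation _ _ _ (𝟙_ (WeightModule r)) (𝟙_ (WeightModule r))
      (@HasRightDual.mk _ _ _ (𝟙_ (WeightModule r)) _ (leftPairing (unit r)))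
      (@HasRightDual.mk _ _ _ (𝟙_ (WeightModule r)) _ exactPairingUnit) (𝟙 _)
    have h' := @leftAdjointMate_comp_evaluation _ _ _ (𝟙_ (WeightModule r)) (𝟙_ (WeightModule r))
      (@HasLeftDual.mk _ _ _ (𝟙_ (WeightModule r)) _ (rightPairing hs (unit r)))
      (@HasLeftDual.mk _ _ _ (𝟙_ (WeightModule r)) _ exactPairingUnit) (𝟙 _)
    have e := LinearMap.congr_fun (congrArg Hom.toLin h) ((1 : ℂ) ⊗ₜ[ℂ] (1 : ℂ))
    have e' := LinearMap.congr_fun (congrArg Hom.toLin h') ((1 : ℂ) ⊗ₜ[ℂ] (1 : ℂ))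
    have hone : (unit r).Homog 0 0 (1 : ℂ) := ⟨by rw [unit_op]; simp [genFun], by simp⟩
    have hp : (unit r).pivot s (1 : ℂ) = (1 : ℂ) := by
      rw [hone.pivot]; simp [qpow_zero]
    have e1 := (evRMap_tmul s (unit r) (1 : ℂ) _).symm.trans e'
    rw [hp] at e1
    exact Eq.trans e e1.symm

lemma isStandardPivotal_pivotal {s : ℤ} (hs : qpow r (2 * (s : ℂ)) = 1) :
    IsStandardPivotal s (pivotal hs) where
  evL _ := rfl
  coevL _ := rfl
  evR _ := rfl
  coevR _ := rfl

end WeightModule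

end Osp

/-! ### The twist of a braided pivotal category -/

namespace BraidedPivotal

variable {C : Type u} [Category.{v} C] [MonoidalCategory C] [BraidedCategory C]

/-- A strand slides under a cap. -/
lemma braiding_cap_right {X Y W : C} (e : X ⊗ Y ⟶ 𝟙_ C) :
    X ◁ (β_ W Y).hom ≫ (α_ X Y W).inv ≫ e ▷ W ≫ (λ_ W).hom =
      (α_ X W Y).inv ≫ (β_ W X).inv ▷ Y ≫ (α_ W X Y).hom ≫ W ◁ e ≫ (ρ_ W).hom := by
  have h := BraidedCategory.braiding_naturality_right W e
  rw [braiding_tensorUnit_right, BraidedCategory.braiding_tensor_right_hom] at h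
  have h' := h =≫ (λ_ W).hom
  simp only [Category.assoc, Iso.inv_hom_id, Category.comp_id] at h'
  rw [h']
  simp

/-- A strand slides over a cap. -/
lemma braiding_cap_left {X Y W : C} (e : X ⊗ Y ⟶ 𝟙_ C) :
    (α_ X W Y).inv ≫ (β_ X W).hom ▷ Y ≫ (α_ W X Y).hom ≫ W ◁ e ≫ (ρ_ W).hom =
      X ◁ (β_ Y W).inv ≫ (α_ X Y W).inv ≫ e ▷ W ≫ (λ_ W).hom := by
  have h := BraidedCategory.braiding_naturality_left e W
  rw [braiding_tensorUnit_left, BraidedCategory.braiding_tensor_left_hom] at h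
  have h' := h =≫ (ρ_ W).hom
  simp only [Category.assoc, Iso.inv_hom_id, Category.comp_id] at h'
  rw [h']
  simp

/-- The nested pairing of `V ⊗ W` with `A ⊗ B`. -/
def nest {V W A B : C} (e : V ⊗ B ⟶ 𝟙_ C) (d : W ⊗ A ⟶ 𝟙_ C) : (V ⊗ W) ⊗ (A ⊗ B) ⟶ 𝟙_ C :=
  (α_ (V ⊗ W) A B).inv ≫ ((α_ V W A).hom ≫ V ◁ d ≫ (ρ_ V).hom) ▷ B ≫ e

/-- Pulling two nested caps through a crossing: the kinks on the two strands come with the inverse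
of the double braiding. -/
lemma braiding_nest {V W A B : C} (e : B ⊗ V ⟶ 𝟙_ C) (d : A ⊗ W ⟶ 𝟙_ C) :
    (β_ (V ⊗ W) (A ⊗ B)).hom ≫ nest d e =
      ((β_ W V).inv ≫ (β_ V W).inv) ▷ (A ⊗ B) ≫
        nest ((β_ V B).hom ≫ e) ((β_ W A).hom ≫ d) := by
  have h1 : (β_ (V ⊗ W) B).hom ≫ (α_ B V W).inv ≫ e ▷ W ≫ (λ_ W).hom =
      (β_ W V).inv ▷ B ≫ (α_ W V B).hom ≫ W ◁ ((β_ V B).hom ≫ e) ≫ (ρ_ W).hom := by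
    have := braiding_cap_right (W := W) ((β_ V B).hom ≫ e)
    rw [comp_whiskerRight] at this
    simp only [Category.assoc] at this ⊢
    rw [BraidedCategory.braiding_tensor_left_hom]
    simp [this]
  have h2 : (β_ (V ⊗ W) A).hom ≫ A ◁ (β_ W V).inv ≫ (α_ A W V).inv ≫ d ▷ V ≫ (λ_ V).hom =
      ((β_ W V).inv ≫ (β_ V W).inv) ▷ A ≫ (α_ V W A).hom ≫ V ◁ ((β_ W A).hom ≫ d) ≫
        (ρ_ V).hom := by
    have := braiding_cap_right (W := V) ((β_ W A).hom ≫ d)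
    rw [comp_whiskerRight] at this
    simp only [Category.assoc] at this ⊢
    rw [← BraidedCategory.braiding_naturality_left_assoc, BraidedCategory.braiding_tensor_left_hom]
    simp [this]
  have h3 : nest d e = (α_ A B (V ⊗ W)).hom ≫ A ◁ ((α_ B V W).inv ≫ e ▷ W ≫ (λ_ W).hom) ≫ d := by
    rw [nest]
    monoidal
  have h4 : (α_ A (V ⊗ W) B).hom ≫ A ◁ ((β_ W V).inv ▷ B ≫ (α_ W V B).hom ≫
      W ◁ ((β_ V B).hom ≫ e) ≫ (ρ_ W).hom) ≫ d =
      (A ◁ (β_ W V).inv ≫ (α_ A W V).inv ≫ d ▷ V ≫ (λ_ V).hom) ▷ B ≫ (β_ V B).hom ≫ e := by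
    generalize (β_ V B).hom ≫ e = k
    generalize (β_ W V).inv = b
    calc
      _ = 𝟙 _ ⊗≫ (A ◁ b) ▷ B ⊗≫ ((A ⊗ W) ◁ k ≫ d ▷ 𝟙_ C) ⊗≫ 𝟙 _ := by monoidal
      _ = _ := by rw [whisker_exchange]; monoidal
  rw [h3, BraidedCategory.braiding_tensor_right_hom]
  simp only [Category.assoc, Iso.inv_hom_id_assoc]
  rw [← MonoidalCategory.whiskerLeft_comp_assoc, h1, h4, ← comp_whiskerRight_assoc, h2]
  generalize (β_ W V).inv ≫ (β_ V W).inv = b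
  rw [nest]
  monoidal

variable {D : C → C} (P : PivotalStructure D)

/-- The twist, as the comparison of the right duality with the left duality transported along the
braiding. -/
lemma ptr_braiding (V : C) : P.ptr (β_ V V).hom =
    (rightDualIso (P.right V)
      (@BraidedCategory.exactPairing_swap C _ _ _ V (D V) (P.left V))).hom := by
  have h := braiding_cap_left (W := V) (P.evR V)
  have e : V ◁ (β_ (D V) V).inv ≫ (α_ V (D V) V).inv ≫ P.evR V ▷ V ≫ (λ_ V).hom =
      (α_ V V (D V)).inv ≫ (β_ V V).hom ▷ D V ≫ (α_ V V (D V)).hom ≫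
        V ◁ P.evR V ≫ (ρ_ V).hom := h.symm
  rw [PivotalStructure.ptr, ← e]
  simp only [rightDualIso, rightAdjointMate, id_whiskerRight, MonoidalCategory.whiskerLeft_id,
    Category.id_comp]
  change _ = (ρ_ V).inv ≫ V ◁ (P.coevL V ≫ (β_ (D V) V).inv) ≫ (α_ V (D V) V).inv ≫
    P.evR V ▷ V ≫ (λ_ V).hom
  simp

/-- The kink `ev ∘ c_{V, V^∨}`. -/
def kink (V : C) : V ⊗ D V ⟶ 𝟙_ C := (β_ V (D V)).hom ≫ P.evL V

/-- The twist straightens the kink. -/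
lemma ptr_whiskerRight_kink (V : C) : P.ptr (β_ V V).hom ▷ D V ≫ kink P V = P.evR V := by
  rw [ptr_braiding]
  have h := @rightAdjointMate_comp_evaluation C _ _ (D V) (D V)
    (@HasRightDual.mk _ _ _ (D V) V
      (@BraidedCategory.exactPairing_swap C _ _ _ V (D V) (P.left V)))
    (@HasRightDual.mk _ _ _ (D V) V (P.right V)) (𝟙 _)
  exact h.trans ((congrArg (· ≫ _) (MonoidalCategory.whiskerLeft_id _ _)).trans
    (Category.id_comp _))

/-- The kink is a nondegenerate pairing. -/
lemma whiskerRight_kink_injective {X V : C} {f g : X ⟶ V}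
    (h : f ▷ D V ≫ kink P V = g ▷ D V ≫ kink P V) : f = g := by
  let i : HasRightDual (D V) := @HasRightDual.mk _ _ _ (D V) V
      (@BraidedCategory.exactPairing_swap C _ _ _ V (D V) (P.left V))
  have hf := tensorRightHomEquiv_whiskerRight_comp_evaluation (X := D V) f
  have hg := tensorRightHomEquiv_whiskerRight_comp_evaluation (X := D V) g
  have := hf.symm.trans ((congrArg (tensorRightHomEquiv _ _ _ _) h).trans hg)
  exact (cancel_mono _).mp this

/-- In a braided category with a pivotal structure the twist is balanced up to the order of the
factors. The identification of `W^∨ ⊗ V^∨` with `(V ⊗ W)^∨` is the same for both dualities, so this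
can be tested against the nested pairings, where it is `braiding_nest`. -/
lemma ptr_braiding_tensor (V W : C) : P.ptr (β_ (V ⊗ W) (V ⊗ W)).hom =
    (P.ptr (β_ V V).hom ⊗ₘ P.ptr (β_ W W).hom) ≫ (β_ V W).hom ≫ (β_ W V).hom := by
  apply whiskerRight_kink_injective P
  rw [ptr_whiskerRight_kink]
  let φ := rightDualIso (@ExactPairing.tensor C _ _ V W (D V) (D W) (P.left V) (P.left W))
    (P.left (V ⊗ W))
  have hL : φ.hom ▷ (V ⊗ W) ≫ P.evL (V ⊗ W) = nest (P.evL W) (P.evL V) := by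
    have h := @rightAdjointMate_comp_evaluation C _ _ (V ⊗ W) (V ⊗ W)
      (@HasRightDual.mk _ _ _ (V ⊗ W) (D (V ⊗ W)) (P.left (V ⊗ W)))
      (@HasRightDual.mk _ _ _ (V ⊗ W) (D W ⊗ D V) (@ExactPairing.tensor C _ _ V W (D V) (D W)
        (P.left V) (P.left W))) (𝟙 _)
    refine h.trans (((congrArg (· ≫ _) (MonoidalCategory.whiskerLeft_id _ _)).trans
      (Category.id_comp _)).trans ?_)
    change 𝟙 _ ⊗≫ D W ◁ (P.evL V ▷ W) ⊗≫ P.evL W = _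
    rw [nest]; monoidal
  have hR : (V ⊗ W) ◁ φ.hom ≫ P.evR (V ⊗ W) = nest (P.evR V) (P.evR W) := by
    have h := @leftAdjointMate_comp_evaluation C _ _ (V ⊗ W) (V ⊗ W)
      (@HasLeftDual.mk _ _ _ (V ⊗ W) (D (V ⊗ W)) (P.right (V ⊗ W)))
      (@HasLeftDual.mk _ _ _ (V ⊗ W) (D W ⊗ D V) (@ExactPairing.tensor C _ _ (D W) (D V) W V
        (P.right W) (P.right V))) (𝟙 _)
    rw [show φ.hom = _ from P.tensor_eq V W]
    refine h.trans (((congrArg (· ≫ _) (MonoidalCategory.id_whiskerRight _ _)).trans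
      (Category.id_comp _)).trans ?_)
    change 𝟙 _ ⊗≫ V ◁ (P.evR W ▷ D V) ⊗≫ P.evR V = _
    rw [nest]; monoidal
  rw [← cancel_epi ((V ⊗ W) ◁ φ.hom), hR]
  have h1 : (V ⊗ W) ◁ φ.hom ≫ kink P (V ⊗ W) = ((β_ W V).inv ≫ (β_ V W).inv) ▷ (D W ⊗ D V) ≫
      nest (kink P V) (kink P W) := by
    rw [kink, BraidedCategory.braiding_naturality_right_assoc, hL, braiding_nest]
    rfl
  rw [whisker_exchange_assoc, h1, ← comp_whiskerRight_assoc]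
  simp only [Category.assoc, Iso.hom_inv_id_assoc, Iso.hom_inv_id, Category.comp_id]
  rw [← ptr_whiskerRight_kink, ← ptr_whiskerRight_kink P W]
  generalize P.ptr (β_ V V).hom = a
  generalize P.ptr (β_ W W).hom = b
  generalize kink P V = k
  generalize kink P W = l
  rw [nest, nest]
  symm
  calc
    _ = 𝟙 _ ⊗≫ (V ◁ (b ▷ D W)) ▷ D V ⊗≫ (a ▷ (W ⊗ D W) ≫ V ◁ l) ▷ D V ⊗≫ k := by
      simp only [tensorHom_def']
      monoidal
    _ = _ := by rw [← whisker_exchange]; monoidal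

end BraidedPivotal

namespace Osp

namespace WeightModule

variable {r : ℕ}

open TensorProduct (map)

/-! ### The twist of a weight module -/

/-- The partial trace of `f` at `v`, read off from a formula for the values of `f` on `v ⊗ w`. -/
lemma toLin_ptr {s : ℤ} (hs : qpow r (2 * (s : ℂ)) = 1) {V : WeightModule r} (f : V ⊗ V ⟶ V ⊗ V)
    (v : V) {ι : Type*} (t : Finset ι) (A : ι → Module.End ℂ V) (u : ι → V)
    (h : ∀ w : V, f.toLin (v ⊗ₜ[ℂ] w) = ∑ l ∈ t, A l w ⊗ₜ[ℂ] u l) :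
    Hom.toLin ((pivotal hs).ptr f) v = ∑ l ∈ t, A l (V.pivot s (u l)) := by
  have e : Hom.toLin ((pivotal hs).ptr f) v = TensorProduct.rid ℂ V (map LinearMap.id (evRMap s V)
      (TensorProduct.assoc ℂ V V (Module.Dual ℂ V) (map f.toLin LinearMap.id
        ((TensorProduct.assoc ℂ V V (Module.Dual ℂ V)).symm (v ⊗ₜ coevaluation ℂ V 1))))) := rfl
  rw [e, coevaluation_apply_one]
  simp only [TensorProduct.tmul_sum, map_sum, TensorProduct.assoc_symm_tmul, TensorProduct.map_tmul,
    h, TensorProduct.sum_tmul, LinearMap.id_apply]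
  rw [Finset.sum_comm]
  refine Finset.sum_congr rfl fun l _ => ?_
  have := congrArg (A l) ((Module.Basis.ofVectorSpace ℂ V).sum_repr (V.pivot s (u l)))
  rw [map_sum] at this
  rw [← this]
  refine Finset.sum_congr rfl fun i _ => ?_
  rw [map_smul]
  exact congrArg (fun c : ℂ => c • A l (Module.Basis.ofVectorSpace ℂ V i)) (evRMap_tmul s V (u l) _)

/-- The operator which multiplies vectors of weight `μ` by `q^{c μ}`. -/
def qH (V : WeightModule r) (c : ℂ) : Module.End ℂ V :=
  ∑ m ∈ eigs (V.op .H), qpow r (c * m) • eigProj (V.op .H) m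

lemma qH_apply {V : WeightModule r} {m : ℂ} {v : V} (h : V.op .H v = m • v) (c : ℂ) :
    V.qH c v = qpow r (c * m) • v := by
  by_cases h0 : v = 0
  · simp [h0]
  have hm := mem_eigs h h0
  simp only [qH, LinearMap.sum_apply, LinearMap.smul_apply]
  rw [Finset.sum_eq_single_of_mem m hm]
  · rw [eigProj_apply hm h, if_pos rfl]
  · intro k hk hkm
    rw [eigProj_apply hk h, if_neg hkm, smul_zero]

/-- The partial trace of the braiding on a homogeneous vector `v` of weight `λ`:
`θ v = ∑ l, (-1)^l c_l q^{(λ + 2 l) λ / 2 + (1 - s)(λ + 2 l)} F^l E^l v`. -/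
lemma toLin_ptr_braiding (hr : 3 ≤ r) (h0 : rbar r ≠ 0) {s : ℤ} (hs : qpow r (2 * (s : ℂ)) = 1)
    {V : WeightModule r} {l : ℂ} {a : ℕ} {v : V} (hv : V.Homog l a v) :
    Hom.toLin ((pivotal hs).ptr ((braided hr h0).braiding V V).hom) v =
      ∑ k ∈ Finset.range (rbar r), ((-1) ^ k * rCoeff r k *
        qpow r ((l + 2 * k) * l / 2 + (1 - s) * (l + 2 * k))) •
          (V.op .F ^ k) ((V.op .E ^ k) v) := by
  rw [toLin_ptr hs _ v (Finset.range (rbar r)) (fun k => (rCoeff r k * (-1) ^ (k * a) *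
    qpow r (-((l + 2 * k) * k)) * (-1) ^ ((a + k) * k)) •
      (V.op .F ^ k * V.qH ((l + 2 * k) / 2) * V.par ^ (a + k))) (fun k => (V.op .E ^ k) v)]
  · refine Finset.sum_congr rfl fun k _ => ?_
    have hk := hv.E_pow k
    rw [hk.pivot, map_smul, LinearMap.smul_apply, Module.End.mul_apply, Module.End.mul_apply,
      hk.par_pow, map_smul, map_smul, qH_apply hk.wt, map_smul, smul_smul, smul_smul, smul_smul]
    congr 1
    have e : qpow r ((l + 2 * k) * l / 2 + (1 - s) * (l + 2 * k)) =
        qpow r (-((l + 2 * k) * k)) * qpow r ((1 - s) * (l + 2 * k)) *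
          qpow r ((l + 2 * k) / 2 * (l + 2 * k)) := by
      rw [← qpow_add, ← qpow_add]; congr 1; ring
    rw [e]
    have sg : (-1 : ℂ) ^ (k * a) * (-1) ^ ((a + k) * k) * (-1) ^ ((a + k) * (a + k)) *
        (-1) ^ (a + k) = (-1) ^ k := by
      have : (-1 : ℂ) ^ (k * a) * (-1) ^ ((a + k) * k) * (-1) ^ ((a + k) * (a + k)) *
        (-1) ^ (a + k) * (-1) ^ k = 1 := by
        simp only [← pow_add]
        refine Even.neg_one_pow ?_
        have : k * a + (a + k) * k + (a + k) * (a + k) + (a + k) + k =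
          2 * (k * a + k + a * k + k * k) + a * (a + 1) := by ring
        rw [this]
        exact (even_two_mul _).add (Nat.even_mul_succ_self a)
      have h2 := neg_one_sq_pow k
      linear_combination (-1) ^ k * this - (-1 : ℂ) ^ (k * a) * (-1) ^ ((a + k) * k) *
        (-1) ^ ((a + k) * (a + k)) * (-1) ^ (a + k) * h2
    rw [← sg]
    ring
  · intro w
    have : braidMap V V ∘ₗ TensorProduct.mk ℂ V V v = ∑ k ∈ Finset.range (rbar r),
        (TensorProduct.mk ℂ V V).flip ((V.op .E ^ k) v) ∘ₗ ((rCoeff r k * (-1) ^ (k * a) *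
          qpow r (-((l + 2 * k) * k)) * (-1) ^ ((a + k) * k)) •
            (V.op .F ^ k * V.qH ((l + 2 * k) / 2) * V.par ^ (a + k))) := by
      refine ext_homog fun m b w hw => ?_
      rw [LinearMap.comp_apply, TensorProduct.mk_apply, braidMap_tmul hv hw, LinearMap.sum_apply]
      refine Finset.sum_congr rfl fun k _ => ?_
      rw [LinearMap.comp_apply, LinearMap.smul_apply, Module.End.mul_apply, Module.End.mul_apply,
        hw.par_pow, map_smul, map_smul, qH_apply hw.wt, map_smul, map_smul, map_smul, map_smul,
        smul_smul, smul_smul, LinearMap.flip_apply, TensorProduct.mk_apply]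
      congr 1
      have e : qpow r ((l + 2 * k) * (m - 2 * k) / 2) =
          qpow r (-((l + 2 * k) * k)) * qpow r ((l + 2 * k) / 2 * m) := by
        rw [← qpow_add]; congr 1; ring
      rw [e, show (a + k) * (b + k) = (a + k) * b + (a + k) * k by ring, pow_add]
      ring
    exact (LinearMap.congr_fun this w).trans (LinearMap.sum_apply _ _ _)

/-- On a vector of weight `λ` annihilated by `E` the twist acts by `q^{λ² / 2 + (1 - s) λ}`. -/
lemma toLin_ptr_braiding_of_E_eq_zero (hr : 3 ≤ r) (h0 : rbar r ≠ 0) {s : ℤ}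
    (hs : qpow r (2 * (s : ℂ)) = 1) {V : WeightModule r} {l : ℂ} {a : ℕ} {v : V}
    (hv : V.Homog l a v) (hE : V.op .E v = 0) :
    Hom.toLin ((pivotal hs).ptr ((braided hr h0).braiding V V).hom) v =
      qpow r (l * l / 2 + (1 - s) * l) • v := by
  rw [toLin_ptr_braiding hr h0 hs hv,
    Finset.sum_eq_single_of_mem 0 (Finset.mem_range.mpr (Nat.pos_of_ne_zero h0))]
  · simp [rCoeff_zero]
  · intro k _ hk
    obtain ⟨k, rfl⟩ := Nat.exists_eq_succ_of_ne_zero hk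
    rw [Nat.succ_eq_add_one, pow_succ (V.op .E), Module.End.mul_apply, hE, map_zero, map_zero,
      smul_zero]

lemma ptr_braiding_natural (hr : 3 ≤ r) (h0 : rbar r ≠ 0) {s : ℤ} (hs : qpow r (2 * (s : ℂ)) = 1)
    {V W : WeightModule r} (f : V ⟶ W) :
    f ≫ (pivotal hs).ptr ((braided hr h0).braiding W W).hom =
      (pivotal hs).ptr ((braided hr h0).braiding V V).hom ≫ f := by
  apply hom_ext
  refine ext_homog fun μ a v hv => ?_
  rw [comp_toLin, comp_toLin, LinearMap.comp_apply, LinearMap.comp_apply,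
    toLin_ptr_braiding hr h0 hs (hv.map f), toLin_ptr_braiding hr h0 hs hv, map_sum]
  refine Finset.sum_congr rfl fun k _ => ?_
  rw [map_smul, toLin_F_pow, toLin_E_pow]

/-- The twist, as a natural automorphism of the identity functor. -/
def twist (hr : 3 ≤ r) (h0 : rbar r ≠ 0) {s : ℤ} (hs : qpow r (2 * (s : ℂ)) = 1) :
    𝟭 (WeightModule r) ≅ 𝟭 (WeightModule r) :=
  letI := braided hr h0
  NatIso.ofComponents (fun V => rightDualIso ((pivotal hs).right V)
      (@BraidedCategory.exactPairing_swap _ _ _ _ V (dual V) ((pivotal hs).left V)))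
    (fun {V W} f => (congrArg (f ≫ ·) (BraidedPivotal.ptr_braiding (pivotal hs) W).symm).trans
      ((ptr_braiding_natural hr h0 hs f).trans
        (congrArg (· ≫ f) (BraidedPivotal.ptr_braiding (pivotal hs) V))))

lemma twist_app (hr : 3 ≤ r) (h0 : rbar r ≠ 0) {s : ℤ} (hs : qpow r (2 * (s : ℂ)) = 1)
    (V : WeightModule r) :
    (twist hr h0 hs).hom.app V = (pivotal hs).ptr ((braided hr h0).braiding V V).hom := by
  let := braided hr h0
  exact (BraidedPivotal.ptr_braiding (pivotal hs) V).symm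

/-- The twist is balanced. -/
lemma twist_tensor (hr : 3 ≤ r) (h0 : rbar r ≠ 0) {s : ℤ} (hs : qpow r (2 * (s : ℂ)) = 1)
    (V W : WeightModule r) : letI := braided hr h0
    (twist hr h0 hs).hom.app (V ⊗ W) = (β_ V W).hom ≫ (β_ W V).hom ≫
      ((twist hr h0 hs).hom.app V ⊗ₘ (twist hr h0 hs).hom.app W) := by
  let := braided hr h0
  simp only [twist_app]
  rw [BraidedPivotal.ptr_braiding_tensor, BraidedCategory.braiding_naturality_assoc,
    BraidedCategory.braiding_naturality]

end WeightModule

end Osp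

namespace Osp

/-! ### Verma modules -/

/-- The quantum number `(q^z - q^{-z}) / (q - q⁻¹)`, by which `E F + F E` acts on vectors of
weight `z`. -/
def qnum (r : ℕ) (z : ℂ) : ℂ := (qpow r 1 - qpow r (-1))⁻¹ * (qpow r z - qpow r (-z))

/-- The scalar by which `F E` acts on the `k`-th vector of the Verma module of highest
weight `ν`. -/
def vermaCoeff (r : ℕ) (ν : ℂ) (k : ℕ) : ℂ :=
  -((-1) ^ k * ∑ i ∈ Finset.range k, (-1) ^ i * qnum r (ν - 2 * i))

lemma vermaCoeff_zero (r : ℕ) (ν : ℂ) : vermaCoeff r ν 0 = 0 := by simp [vermaCoeff]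

lemma vermaCoeff_succ (r : ℕ) (ν : ℂ) (k : ℕ) :
    vermaCoeff r ν (k + 1) + vermaCoeff r ν k = qnum r (ν - 2 * k) := by
  have h : (-1 : ℂ) ^ k * (-1) ^ k = 1 := by rw [← mul_pow]; simp
  rw [vermaCoeff, vermaCoeff, Finset.sum_range_succ, pow_succ]
  linear_combination qnum r (ν - 2 * k) * h

lemma neg_one_pow_mul_qnum (r : ℕ) (ν : ℂ) (i : ℕ) : (-1) ^ i * qnum r (ν + 2 * i) =
    (qpow r 1 - qpow r (-1))⁻¹ * (qpow r ν * (-qpow r 2) ^ i - qpow r (-ν) * (-qpow r (-2)) ^ i) := by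
  have e1 : qpow r (ν + 2 * i) = qpow r ν * qpow r 2 ^ i := by rw [qpow_add, qpow_mul_nat]
  have e2 : qpow r (-(ν + 2 * i)) = qpow r (-ν) * qpow r (-2) ^ i := by
    rw [← qpow_mul_nat, ← qpow_add]; congr 1; ring
  rw [qnum, e1, e2, neg_pow (qpow r 2), neg_pow (qpow r (-2))]
  ring

lemma neg_qpow_mul (r : ℕ) : -qpow r (-2) * -qpow r 2 = 1 := by
  rw [neg_mul_neg, qpow_neg_mul]

lemma sum_range_pow_inv_rbar {r : ℕ} (h : rbar r ≠ 0) :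
    ∑ i ∈ Finset.range (rbar r), (-qpow r (-2)) ^ i = 0 := by
  have h1 := sum_range_pow_rbar h
  rw [← Finset.sum_range_reflect] at h1
  have h2 := congrArg ((-qpow r (-2)) ^ (rbar r - 1) * ·) h1
  simp only [mul_zero, Finset.mul_sum] at h2
  rw [← h2]
  refine Finset.sum_congr rfl fun i hi => ?_
  have hi' := Finset.mem_range.mp hi
  obtain ⟨m, hm⟩ := Nat.exists_eq_add_of_le (show i ≤ rbar r - 1 by omega)
  rw [hm, Nat.add_sub_cancel_left, pow_add, mul_assoc, ← mul_pow, neg_qpow_mul, one_pow, mul_one]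

lemma vermaCoeff_rbar {r : ℕ} (h : rbar r ≠ 0) (ν : ℂ) : vermaCoeff r ν (rbar r) = 0 := by
  have e : ∀ i : ℕ, (-1) ^ i * qnum r (ν - 2 * i) = -((-1) ^ i * qnum r (-ν + 2 * i)) := by
    intro i
    rw [qnum, qnum, show -(-ν + 2 * (i : ℂ)) = ν - 2 * i by ring,
      show -(ν - 2 * (i : ℂ)) = -ν + 2 * i by ring]
    ring
  rw [vermaCoeff, neg_eq_zero]
  refine mul_eq_zero_of_right _ ?_
  rw [Finset.sum_congr rfl fun i _ => e i, Finset.sum_neg_distrib, neg_eq_zero,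
    Finset.sum_congr rfl fun i _ => neg_one_pow_mul_qnum r (-ν) i, ← Finset.mul_sum,
    Finset.sum_sub_distrib, ← Finset.mul_sum, ← Finset.mul_sum, sum_range_pow_rbar h,
    sum_range_pow_inv_rbar h]
  simp

/-- The standard basis vectors of `ℂ^n`, extended by zero. -/
def stdVec (n k : ℕ) : Fin n → ℂ := fun i => if (i : ℕ) = k then 1 else 0

lemma stdVec_of_le {n k : ℕ} (h : n ≤ k) : stdVec n k = 0 := by
  ext i
  have : (i : ℕ) ≠ k := by have := i.2; omega
  simp [stdVec, this]

lemma stdVec_eq_basisFun {n : ℕ} (k : Fin n) : stdVec n k = Pi.basisFun ℂ (Fin n) k := by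
  ext i
  simp [stdVec, Pi.single_apply, Fin.ext_iff]

lemma ext_stdVec {n : ℕ} {X : Type*} [AddCommGroup X] [Module ℂ X] {f g : (Fin n → ℂ) →ₗ[ℂ] X}
    (h : ∀ k < n, f (stdVec n k) = g (stdVec n k)) : f = g :=
  (Pi.basisFun ℂ (Fin n)).ext fun k => by rw [← stdVec_eq_basisFun, h k k.2]

/-- The endomorphism of `ℂ^n` sending the `k`-th basis vector to `c k` times the
`d k`-th one. -/
def monomialEnd (n : ℕ) (c : ℕ → ℂ) (d : ℕ → ℕ) : Module.End ℂ (Fin n → ℂ) :=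
  (Pi.basisFun ℂ (Fin n)).constr ℂ fun k => c k • stdVec n (d k)

lemma monomialEnd_stdVec {n : ℕ} (c : ℕ → ℂ) (d : ℕ → ℕ) {k : ℕ} (hk : k < n) :
    monomialEnd n c d (stdVec n k) = c k • stdVec n (d k) := by
  have := stdVec_eq_basisFun (⟨k, hk⟩ : Fin n)
  simp only at this
  rw [this, monomialEnd, Module.Basis.constr_basis]

lemma monomialEnd_stdVec' {n : ℕ} (c : ℕ → ℂ) {d : ℕ → ℕ} {k : ℕ} (hd : k ≤ d k) :
    monomialEnd n c d (stdVec n k) = c k • stdVec n (d k) := by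
  rcases lt_or_ge k n with h | h
  · exact monomialEnd_stdVec c d h
  · rw [stdVec_of_le h, stdVec_of_le (h.trans hd), map_zero, smul_zero]

section

variable (r : ℕ) (ν : ℂ)

/-- The action of `H` on the Verma module. -/
def vermaH : Module.End ℂ (Fin (rbar r) → ℂ) := monomialEnd _ (fun k => ν - 2 * k) id

/-- The action of `K` on the Verma module. -/
def vermaK : Module.End ℂ (Fin (rbar r) → ℂ) := monomialEnd _ (fun k => qpow r (ν - 2 * k)) id

/-- The action of `K⁻¹` on the Verma module. -/
def vermaKinv : Module.End ℂ (Fin (rbar r) → ℂ) :=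
  monomialEnd _ (fun k => qpow r (-(ν - 2 * k))) id

/-- The action of `E` on the Verma module. -/
def vermaE : Module.End ℂ (Fin (rbar r) → ℂ) := monomialEnd _ (vermaCoeff r ν) (· - 1)

/-- The action of `F` on the Verma module. -/
def vermaF : Module.End ℂ (Fin (rbar r) → ℂ) := monomialEnd _ (fun _ => 1) (· + 1)

/-- The grading involution of the Verma module. -/
def vermaPar : Module.End ℂ (Fin (rbar r) → ℂ) := monomialEnd _ (fun k => (-1) ^ k) id

variable {r ν} (k : ℕ)

lemma vermaH_stdVec : vermaH r ν (stdVec _ k) = (ν - 2 * k) • stdVec _ k :=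
  monomialEnd_stdVec' _ le_rfl

lemma vermaK_stdVec : vermaK r ν (stdVec _ k) = qpow r (ν - 2 * k) • stdVec _ k :=
  monomialEnd_stdVec' _ le_rfl

lemma vermaKinv_stdVec : vermaKinv r ν (stdVec _ k) = qpow r (-(ν - 2 * k)) • stdVec _ k :=
  monomialEnd_stdVec' _ le_rfl

lemma vermaPar_stdVec : vermaPar r (stdVec _ k) = (-1 : ℂ) ^ k • stdVec _ k :=
  monomialEnd_stdVec' _ le_rfl

lemma vermaF_stdVec : vermaF r (stdVec _ k) = stdVec _ (k + 1) :=
  (monomialEnd_stdVec' _ (Nat.le_succ k)).trans (one_smul _ _)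

lemma vermaE_stdVec_zero : vermaE r ν (stdVec _ 0) = 0 := by
  rcases Nat.eq_zero_or_pos (rbar r) with h | h
  · rw [stdVec_of_le h.le, map_zero]
  · rw [vermaE, monomialEnd_stdVec _ _ h, vermaCoeff_zero, zero_smul]

variable {k} in
lemma vermaE_stdVec_succ (hk : k < rbar r) :
    vermaE r ν (stdVec _ (k + 1)) = vermaCoeff r ν (k + 1) • stdVec _ k := by
  rcases Nat.lt_or_ge (k + 1) (rbar r) with h | h
  · exact monomialEnd_stdVec _ _ h
  · have : rbar r = k + 1 := by omega
    rw [stdVec_of_le h, map_zero, ← this, vermaCoeff_rbar (by omega), zero_smul]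

lemma vermaF_pow_stdVec (j : ℕ) : (vermaF r ^ j) (stdVec _ k) = stdVec _ (k + j) := by
  induction j with
  | zero => rfl
  | succ j ih => rw [pow_succ', Module.End.mul_apply, ih, vermaF_stdVec, add_assoc]

lemma vermaE_pow_stdVec : (vermaE r ν ^ (k + 1)) (stdVec _ k) = 0 := by
  rcases Nat.lt_or_ge k (rbar r) with h | h
  · induction k with
    | zero => exact vermaE_stdVec_zero
    | succ k ih =>
      rw [pow_succ, Module.End.mul_apply, vermaE_stdVec_succ (by omega), map_smul, ih (by omega),
        smul_zero]
  · rw [stdVec_of_le h, map_zero]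

variable (r ν)

lemma verma_rel : Relations r (vermaH r ν) (vermaK r ν) (vermaKinv r ν) (vermaE r ν) (vermaF r) where
  HK := ext_stdVec fun k _ => by
    simp only [Module.End.mul_apply, vermaH_stdVec, vermaK_stdVec, map_smul, smul_smul, mul_comm]
  HKinv := ext_stdVec fun k _ => by
    simp only [Module.End.mul_apply, vermaH_stdVec, vermaKinv_stdVec, map_smul, smul_smul, mul_comm]
  HE := ext_stdVec fun k hk => by
    cases k with
    | zero => simp [vermaE_stdVec_zero, vermaH_stdVec]
    | succ k =>
      simp only [LinearMap.sub_apply, LinearMap.smul_apply, Module.End.mul_apply, vermaH_stdVec,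
        vermaE_stdVec_succ (show k < rbar r by omega), map_smul, smul_smul]
      push_cast
      module
  HF := ext_stdVec fun k hk => by
    simp only [LinearMap.sub_apply, LinearMap.smul_apply, Module.End.mul_apply, vermaH_stdVec,
      vermaF_stdVec, map_smul]
    push_cast
    module
  KKinv := ext_stdVec fun k _ => by
    simp only [Module.End.mul_apply, vermaK_stdVec, vermaKinv_stdVec, map_smul, smul_smul,
      qpow_neg_mul, one_smul, Module.End.one_apply]
  KinvK := ext_stdVec fun k _ => by
    rw [Module.End.mul_apply, vermaK_stdVec, map_smul, vermaKinv_stdVec, smul_smul, mul_comm,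
      qpow_neg_mul, one_smul, Module.End.one_apply]
  KE := ext_stdVec fun k hk => by
    cases k with
    | zero => simp [vermaE_stdVec_zero, vermaK_stdVec]
    | succ k =>
      simp only [LinearMap.smul_apply, Module.End.mul_apply, vermaK_stdVec,
        vermaE_stdVec_succ (show k < rbar r by omega), map_smul, smul_smul]
      congr 1
      rw [show ν - 2 * (k : ℂ) = 2 + (ν - 2 * (k + 1 : ℕ)) by push_cast; ring, qpow_add]
      ring
  KF := ext_stdVec fun k hk => by
    simp only [LinearMap.smul_apply, Module.End.mul_apply, vermaK_stdVec, vermaF_stdVec, map_smul,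
      smul_smul, ← qpow_add]
    congr 2
    push_cast
    ring
  EF := ext_stdVec fun k hk => by
    have h : vermaF r (vermaE r ν (stdVec _ k)) = vermaCoeff r ν k • stdVec _ k := by
      cases k with
      | zero => rw [vermaE_stdVec_zero, map_zero, vermaCoeff_zero, zero_smul]
      | succ k => rw [vermaE_stdVec_succ (by omega), map_smul, vermaF_stdVec]
    rw [LinearMap.add_apply, Module.End.mul_apply, Module.End.mul_apply, h, vermaF_stdVec,
      vermaE_stdVec_succ hk, ← add_smul, vermaCoeff_succ, LinearMap.smul_apply, LinearMap.sub_apply,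
      vermaK_stdVec, vermaKinv_stdVec, ← sub_smul, smul_smul, qnum]
  nilE _ := ext_stdVec fun k hk => by
    rw [LinearMap.zero_apply]
    exact Module.End.pow_map_zero_of_le (Nat.succ_le_of_lt hk) (vermaE_pow_stdVec k)
  nilF _ := ext_stdVec fun k hk => by
    rw [vermaF_pow_stdVec, stdVec_of_le (Nat.le_add_left _ _), LinearMap.zero_apply]

lemma verma_span : ⨆ μ : ℂ, (vermaH r ν).eigenspace μ ⊓ (vermaK r ν).eigenspace (qpow r μ) = ⊤ := by
  rw [eq_top_iff, ← (Pi.basisFun ℂ (Fin (rbar r))).span_eq, Submodule.span_le]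
  rintro _ ⟨k, rfl⟩
  rw [← stdVec_eq_basisFun]
  refine Submodule.mem_iSup_of_mem (ν - 2 * (k : ℕ)) ⟨?_, ?_⟩
  · exact Module.End.mem_eigenspace_iff.mpr (vermaH_stdVec _)
  · exact Module.End.mem_eigenspace_iff.mpr (vermaK_stdVec _)

namespace WeightModule

/-- The Verma module of highest weight `ν`, of dimension `r̄`, with even highest weight vector
`stdVec _ 0` and basis `F^k (stdVec _ 0) = stdVec _ k`. -/
@[reducible] def verma : WeightModule r where
  carrier := Fin (rbar r) → ℂ
  par := vermaPar r
  par_sq := ext_stdVec fun k _ => by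
    rw [Module.End.mul_apply, vermaPar_stdVec, map_smul, vermaPar_stdVec, smul_smul,
      neg_one_sq_pow, one_smul, Module.End.one_apply]
  act := lift (verma_rel r ν)
  par_H := by
    simp only [lift_gen, genFun]
    exact ext_stdVec fun k _ => by
      simp only [Module.End.mul_apply, vermaH_stdVec, vermaPar_stdVec, map_smul, smul_smul, mul_comm]
  par_K := by
    simp only [lift_gen, genFun]
    exact ext_stdVec fun k _ => by
      simp only [Module.End.mul_apply, vermaK_stdVec, vermaPar_stdVec, map_smul, smul_smul, mul_comm]
  par_E := by
    simp only [lift_gen, genFun]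
    refine ext_stdVec fun k hk => ?_
    cases k with
    | zero => simp [vermaE_stdVec_zero, vermaPar_stdVec]
    | succ k =>
      simp only [Module.End.mul_apply, LinearMap.neg_apply,
        vermaE_stdVec_succ (show k < rbar r by omega), vermaPar_stdVec, map_smul, smul_smul, pow_succ]
      module
  par_F := by
    simp only [lift_gen, genFun]
    refine ext_stdVec fun k hk => ?_
    simp only [Module.End.mul_apply, LinearMap.neg_apply, vermaF_stdVec, vermaPar_stdVec, map_smul,
      pow_succ]
    module
  diag := by
    simp only [lift_gen, genFun]
    exact (weight_of_span _ _ (verma_span r ν)).1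
  K_weight := by
    simp only [lift_gen, genFun]
    exact (weight_of_span _ _ (verma_span r ν)).2

end WeightModule

end

end Osp

namespace Osp

/-! ### The twist on Verma modules and their duals -/

/-- The coordinate functionals of `ℂ^n`, extended by zero. -/
def stdCoord (n i : ℕ) : Module.Dual ℂ (Fin n → ℂ) :=
  (Pi.basisFun ℂ (Fin n)).constr ℂ fun k => if i = k then 1 else 0

lemma stdCoord_stdVec {n k : ℕ} (hk : k < n) (i : ℕ) :
    stdCoord n i (stdVec n k) = if i = k then 1 else 0 := by
  have := stdVec_eq_basisFun (⟨k, hk⟩ : Fin n)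
  simp only at this
  rw [this, stdCoord, Module.Basis.constr_basis]

lemma ext_stdCoord {n : ℕ} {X : Type*} [AddCommGroup X] [Module ℂ X]
    {f g : Module.Dual ℂ (Fin n → ℂ) →ₗ[ℂ] X}
    (h : ∀ i < n, f (stdCoord n i) = g (stdCoord n i)) : f = g := by
  refine LinearMap.ext fun φ => ?_
  have : φ = ∑ i : Fin n, φ (stdVec n i) • stdCoord n i := by
    refine ext_stdVec fun k hk => ?_
    rw [LinearMap.sum_apply, Finset.sum_eq_single (⟨k, hk⟩ : Fin n)]
    · simp [stdCoord_stdVec hk]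
    · intro i _ hi
      have : (i : ℕ) ≠ k := fun h => hi (Fin.ext h)
      simp [stdCoord_stdVec hk, this]
    · simp
  rw [this, map_sum, map_sum]
  exact Finset.sum_congr rfl fun i _ => by rw [map_smul, map_smul, h i i.2]

namespace WeightModule

variable {r : ℕ}

lemma homog_stdVec (ν : ℂ) (k : ℕ) : (verma r ν).Homog (ν - 2 * k) k (stdVec _ k) where
  wt := by
    change lift (verma_rel r ν) (gen r .H) _ = _
    rw [lift_gen]
    exact vermaH_stdVec k
  par := vermaPar_stdVec k

lemma verma_F (ν : ℂ) : (verma r ν).op .F = vermaF r := lift_gen (verma_rel r ν) .F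

lemma verma_E (ν : ℂ) : (verma r ν).op .E = vermaE r ν := lift_gen (verma_rel r ν) .E

/-- On a Verma module the twist is determined by its value on the highest weight vector. -/
lemma toLin_ptr_braiding_verma (hr : 3 ≤ r) (h0 : rbar r ≠ 0) {s : ℤ}
    (hs : qpow r (2 * (s : ℂ)) = 1) (ν : ℂ) :
    Hom.toLin ((pivotal hs).ptr ((braided hr h0).braiding (verma r ν) (verma r ν)).hom) =
      qpow r (ν * ν / 2 + (1 - s) * ν) • LinearMap.id := by
  have hv : (verma r ν).Homog ν 0 (stdVec _ 0) := by simpa using homog_stdVec (r := r) ν 0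
  have h := toLin_ptr_braiding_of_E_eq_zero hr h0 hs hv (by rw [verma_E, vermaE_stdVec_zero])
  refine ext_stdVec fun k hk => ?_
  have e : stdVec (rbar r) k = ((verma r ν).op .F ^ k) (stdVec _ 0) := by
    rw [verma_F, vermaF_pow_stdVec, zero_add]
  rw [e, toLin_F_pow, h, map_smul]
  rfl

lemma homog_stdCoord (ν : ℂ) (i : ℕ) :
    (dual (verma r ν)).Homog (-(ν - 2 * i)) i (stdCoord _ i) where
  wt := by
    rw [dual_op]
    refine ext_stdVec fun k hk => ?_
    have h := (homog_stdVec (r := r) ν k).wt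
    simp only [genFun, LinearMap.dualMap_apply, LinearMap.neg_apply, h, map_neg, map_smul,
      LinearMap.smul_apply, stdCoord_stdVec hk, smul_eq_mul]
    split_ifs with hik
    · subst hik; ring
    · ring
  par := by
    refine ext_stdVec fun k hk => ?_
    change stdCoord _ i ((verma r ν).par (stdVec _ k)) = _
    rw [(homog_stdVec (r := r) ν k).par, map_smul, LinearMap.smul_apply, stdCoord_stdVec hk]
    split_ifs with hik
    · subst hik; rfl
    · simp

lemma dual_verma_E (ν : ℂ) : (dual (verma r ν)).op .E (stdCoord _ (rbar r - 1)) = 0 := by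
  rw [dual_op]
  refine ext_stdVec fun k hk => ?_
  have h1 := (homog_stdVec (r := r) ν k).Kinv
  simp only [genFun, LinearMap.dualMap_apply, Module.End.mul_apply, LinearMap.neg_apply, h1,
    map_smul, map_neg, LinearMap.zero_apply, verma_E]
  cases k with
  | zero => simp [vermaE_stdVec_zero]
  | succ k =>
    rw [vermaE_stdVec_succ (by omega), map_smul, (homog_stdVec (r := r) ν k).par, map_smul,
      map_smul, stdCoord_stdVec (by omega), if_neg (by omega)]
    simp

lemma dual_verma_F (ν : ℂ) {i : ℕ} (hi : i + 1 < rbar r) : (dual (verma r ν)).op .F (stdCoord _ (i + 1)) =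
    ((-1) ^ i * qpow r (ν - 2 * (i + 1 : ℕ))) • stdCoord _ i := by
  rw [dual_op]
  refine ext_stdVec fun k hk => ?_
  have h1 := (homog_stdVec (r := r) ν (k + 1))
  simp only [genFun, LinearMap.dualMap_apply, Module.End.mul_apply, LinearMap.neg_apply,
    map_smul, map_neg, LinearMap.smul_apply, verma_F, vermaF_stdVec, h1.K, h1.par]
  rcases Nat.lt_or_ge (k + 1) (rbar r) with h | h
  · simp only [stdCoord_stdVec hk, stdCoord_stdVec h, Nat.add_right_cancel_iff]
    split_ifs with hik
    · subst hik; simp [pow_succ]; ring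
    · simp
  · rw [stdVec_of_le h, map_zero, smul_zero, smul_zero, neg_zero,
      stdCoord_stdVec hk, if_neg (by omega), smul_zero]

/-- On the dual of a Verma module the twist is determined by its value on the highest weight
vector, the functional dual to the lowest weight vector. -/
lemma toLin_ptr_braiding_dual_verma (hr : 3 ≤ r) (h0 : rbar r ≠ 0) {s : ℤ}
    (hs : qpow r (2 * (s : ℂ)) = 1) (ν μ : ℂ) (hμ : μ = 2 * (rbar r - 1) - ν) :
    Hom.toLin ((pivotal hs).ptr
      ((braided hr h0).braiding (dual (verma r ν)) (dual (verma r ν))).hom) =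
        qpow r (μ * μ / 2 + (1 - s) * μ) • LinearMap.id := by
  have hv : (dual (verma r ν)).Homog μ (rbar r - 1) (stdCoord _ (rbar r - 1)) := by
    have := homog_stdCoord (r := r) ν (rbar r - 1)
    rwa [show -(ν - 2 * ((rbar r - 1 : ℕ) : ℂ)) = μ by
      rw [hμ, Nat.cast_sub (Nat.one_le_iff_ne_zero.mpr h0)]; push_cast; ring] at this
  have h := toLin_ptr_braiding_of_E_eq_zero hr h0 hs hv (dual_verma_E ν)
  have key : ∀ m i : ℕ, i + m + 1 = rbar r → Hom.toLin ((pivotal hs).ptr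
      ((braided hr h0).braiding (dual (verma r ν)) (dual (verma r ν))).hom) (stdCoord _ i) =
        qpow r (μ * μ / 2 + (1 - s) * μ) • stdCoord _ i := by
    intro m
    induction m with
    | zero =>
      intro i hi
      obtain rfl : i = rbar r - 1 := by omega
      exact h
    | succ m ih =>
      intro i hi
      have h1 := ih (i + 1) (by omega)
      have h2 := dual_verma_F (r := r) ν (show i + 1 < rbar r by omega)
      have h3 : ((-1) ^ i * qpow r (ν - 2 * (i + 1 : ℕ)))  ≠ 0 :=
        mul_ne_zero (pow_ne_zero _ (by norm_num)) (qpow_ne_zero _ _)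
      refine smul_right_injective _ h3 ?_
      change _ • _ = _ • _
      rw [← map_smul, smul_comm, ← h2]
      refine (Hom.map_act _ (gen r .F) _).trans ?_
      rw [h1, map_smul]
  refine ext_stdCoord fun i hi => ?_
  rw [key (rbar r - 1 - i) i (by omega)]
  rfl

/-- Comparing the twists of a Verma module and of its dual pins down the pivotal structure. -/
lemma eq_rbar_of_dual (hr : 3 ≤ r) (h0 : rbar r ≠ 0) {s : ℤ} (hs : qpow r (2 * (s : ℂ)) = 1)
    (h : ∀ V : WeightModule r, Hom.toLin ((pivotal hs).ptr
      ((braided hr h0).braiding (dual V) (dual V)).hom) =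
        LinearMap.dualMap (Hom.toLin ((pivotal hs).ptr ((braided hr h0).braiding V V).hom))) :
    s = rbar r := by
  by_contra hne
  have hd : ((rbar r : ℂ) - s) ≠ 0 := by
    intro h'
    apply hne
    have : (s : ℂ) = ((rbar r : ℤ) : ℂ) := by push_cast; linear_combination -h'
    exact_mod_cast this
  -- With this `ν` the two twists differ by `q^{r / 2} = -1`.
  obtain ⟨ν, hν⟩ : ∃ ν : ℂ, (2 * ν - 2 * ((rbar r : ℂ) - 1)) * (rbar r - s) = r / 2 :=
    ⟨rbar r - 1 + r / 4 / (rbar r - s), by field_simp; ring⟩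
  have h1 := h (verma r ν)
  rw [toLin_ptr_braiding_verma, toLin_ptr_braiding_dual_verma hr h0 hs ν _ rfl] at h1
  have h2 := LinearMap.congr_fun (LinearMap.congr_fun h1 (stdCoord _ 0)) (stdVec _ 0)
  simp only [LinearMap.smul_apply, LinearMap.id_apply, LinearMap.dualMap_apply, map_smul,
    stdCoord_stdVec (Nat.pos_of_ne_zero h0), if_true, smul_eq_mul, mul_one] at h2
  set μ := 2 * ((rbar r : ℂ) - 1) - ν with hμ
  have h3 : qpow r (r / 2) = 1 := by
    rw [← hν, show (2 * ν - 2 * ((rbar r : ℂ) - 1)) * (rbar r - s) =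
      (ν * ν / 2 + (1 - s) * ν) + -(μ * μ / 2 + (1 - s) * μ) by rw [hμ]; ring, qpow_add, ← h2,
      mul_comm, qpow_neg_mul]
  rw [qpow_eq_one_iff (by omega)] at h3
  obtain ⟨m, hm⟩ := h3
  have hr' : (r : ℂ) ≠ 0 := by exact_mod_cast (by omega : r ≠ 0)
  have h4 : (2 * m : ℂ) = 1 := by
    field_simp at hm
    linear_combination -hm
  have h5 : (2 * m : ℤ) = 1 := by exact_mod_cast h4
  omega

end WeightModule

end Osp

namespace Osp

open Polynomial (C X aeval)

/-! ### Ordered powers as polynomials -/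

/-- The polynomials `p₀`, `p_{k+1} = c_k - p_k`. -/
def ladder (p₀ : Polynomial ℂ) (c : ℕ → ℂ) : ℕ → Polynomial ℂ
  | 0 => p₀
  | k + 1 => C (c k) - ladder p₀ c k

/-- The product of the first `k` polynomials `ladder p₀ c i`. -/
def ladderProd (p₀ : Polynomial ℂ) (c : ℕ → ℂ) (k : ℕ) : Polynomial ℂ :=
  ∏ i ∈ Finset.range k, ladder p₀ c i

lemma degree_ladder_le {p₀ : Polynomial ℂ} (h : p₀.degree ≤ 1) (c : ℕ → ℂ) (k : ℕ) :
    (ladder p₀ c k).degree ≤ 1 := by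
  induction k with
  | zero => exact h
  | succ k ih =>
    exact (Polynomial.degree_sub_le _ _).trans
      (max_le (Polynomial.degree_C_le.trans zero_le_one) ih)

lemma degree_ladderProd_le {p₀ : Polynomial ℂ} (h : p₀.degree ≤ 1) (c : ℕ → ℂ) (k : ℕ) :
    (ladderProd p₀ c k).degree ≤ k := by
  refine (Polynomial.degree_prod_le _ _).trans ?_
  refine (Finset.sum_le_card_nsmul _ _ 1 fun i _ => degree_ladder_le h c i).trans ?_
  simp

lemma continuous_eval_ladderProd {p₀ : ℂ → Polynomial ℂ} {c : ℂ → ℕ → ℂ} (x : ℂ)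
    (h : Continuous fun z => (p₀ z).eval x) (hc : ∀ k, Continuous fun z => c z k) (k : ℕ) :
    Continuous fun z => (ladderProd (p₀ z) (c z) k).eval x := by
  have hl : ∀ k, Continuous fun z => (ladder (p₀ z) (c z) k).eval x := by
    intro k
    induction k with
    | zero => exact h
    | succ k ih =>
      simp only [ladder, Polynomial.eval_sub, Polynomial.eval_C]
      exact (hc k).sub ih
  simp only [ladderProd, Polynomial.eval_prod]
  exact continuous_finsetProd _ fun i _ => hl i

lemma aeval_mem {V : Type*} [AddCommGroup V] [Module ℂ V] {Z : Module.End ℂ V} {W : Submodule ℂ V}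
    (hZ : ∀ u ∈ W, Z u ∈ W) (p : Polynomial ℂ) {u : V} (hu : u ∈ W) : aeval Z p u ∈ W := by
  induction p using Polynomial.induction_on' generalizing u with
  | add p q hp hq => rw [map_add]; exact W.add_mem (hp hu) (hq hu)
  | monomial k a =>
    rw [Polynomial.aeval_monomial, Module.End.mul_apply, Module.algebraMap_end_apply]
    refine W.smul_mem _ ?_
    induction k with
    | zero => exact hu
    | succ k ih => rw [pow_succ', Module.End.mul_apply]; exact hZ _ ih

/-- If `A B + B A` is a scalar on the images of a subspace `W` under the powers of `B` and `A B` is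
a polynomial in `Z` on `W`, then so is `A^k B^k`. -/
lemma pow_pow_apply {V : Type*} [AddCommGroup V] [Module ℂ V] {A B Z : Module.End ℂ V}
    {W : Submodule ℂ V} {p₀ : Polynomial ℂ} {c : ℕ → ℂ} (hZ : ∀ u ∈ W, Z u ∈ W)
    (h0 : ∀ u ∈ W, A (B u) = aeval Z p₀ u)
    (hc : ∀ u ∈ W, ∀ k, A (B ((B ^ (k + 1)) u)) + B (A ((B ^ (k + 1)) u)) =
      c k • (B ^ (k + 1)) u) (k : ℕ) {u : V} (hu : u ∈ W) :
    (A ^ k) ((B ^ k) u) = aeval Z (ladderProd p₀ c k) u := by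
  have hs : ∀ k, ∀ u ∈ W, A (B ((B ^ k) u)) = (B ^ k) (aeval Z (ladder p₀ c k) u) := by
    intro k
    induction k with
    | zero => exact h0
    | succ k ih =>
      intro u hu
      have h1 := hc u hu k
      have h2 : B (A ((B ^ (k + 1)) u)) = (B ^ (k + 1)) (aeval Z (ladder p₀ c k) u) := by
        rw [pow_succ', Module.End.mul_apply, ih u hu, Module.End.mul_apply]
      rw [h2] at h1
      rw [eq_sub_of_add_eq h1, ladder, map_sub, LinearMap.sub_apply, map_sub,
        Polynomial.aeval_C, Module.algebraMap_end_apply, map_smul]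
  induction k generalizing u with
  | zero => simp [ladderProd]
  | succ k ih =>
    rw [pow_succ, Module.End.mul_apply, pow_succ' B, Module.End.mul_apply, hs k u hu,
      ih (aeval_mem hZ _ hu), ladderProd, ladderProd, Finset.prod_range_succ, map_mul,
      Module.End.mul_apply]

namespace WeightModule

variable {r : ℕ}

lemma E_F_add_F_E {V : WeightModule r} {μ : ℂ} {a : ℕ} {v : V} (hv : V.Homog μ a v) :
    V.op .E (V.op .F v) + V.op .F (V.op .E v) = qnum r μ • v := by
  have h := LinearMap.congr_fun V.rel.EF v
  simp only [LinearMap.add_apply, Module.End.mul_apply, LinearMap.smul_apply, LinearMap.sub_apply,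
    hv.K, hv.Kinv] at h
  rw [h, ← sub_smul, smul_smul, qnum]

/-- The homogeneous vectors of given weight and parity, as a subspace. -/
def homogSpace (V : WeightModule r) (μ : ℂ) (a : ℕ) : Submodule ℂ V :=
  (V.op .H).eigenspace μ ⊓ V.par.eigenspace ((-1) ^ a)

lemma mem_homogSpace {V : WeightModule r} {μ : ℂ} {a : ℕ} {v : V} :
    v ∈ V.homogSpace μ a ↔ V.Homog μ a v := by
  rw [homogSpace, Submodule.mem_inf, Module.End.mem_eigenspace_iff, Module.End.mem_eigenspace_iff]
  exact ⟨fun h => ⟨h.1, h.2⟩, fun h => ⟨h.1, h.2⟩⟩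

lemma F_E_mem {V : WeightModule r} {μ : ℂ} {a : ℕ} {v : V} (hv : v ∈ V.homogSpace μ a) :
    (V.op .F * V.op .E) v ∈ V.homogSpace μ a := by
  rw [mem_homogSpace] at hv ⊢
  exact hv.E.F.of_even (by ring) ⟨a + 1, by ring⟩

/-- On a weight space `F^k E^k` is a polynomial in `F E`. -/
lemma F_pow_E_pow {V : WeightModule r} {μ : ℂ} {a : ℕ} {v : V} (hv : V.Homog μ a v) (k : ℕ) :
    (V.op .F ^ k) ((V.op .E ^ k) v) =
      aeval (V.op .F * V.op .E) (ladderProd X (fun i => qnum r (μ + 2 * (i + 1 : ℕ))) k) v := by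
  refine pow_pow_apply (W := V.homogSpace μ a) (fun u hu => F_E_mem hu)
    (fun u _ => by rw [Polynomial.aeval_X]; rfl) (fun u hu i => ?_) k (mem_homogSpace.mpr hv)
  rw [add_comm]
  exact E_F_add_F_E ((mem_homogSpace.mp hu).E_pow (i + 1))

/-- On a weight space `E^k F^k` is a polynomial in `F E`. -/
lemma E_pow_F_pow {V : WeightModule r} {μ : ℂ} {a : ℕ} {v : V} (hv : V.Homog μ a v) (k : ℕ) :
    (V.op .E ^ k) ((V.op .F ^ k) v) = aeval (V.op .F * V.op .E)
      (ladderProd (C (qnum r μ) - X) (fun i => qnum r (μ - 2 * (i + 1 : ℕ))) k) v := by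
  refine pow_pow_apply (W := V.homogSpace μ a) (fun u hu => F_E_mem hu)
    (fun u hu => ?_) (fun u hu i => ?_) k (mem_homogSpace.mpr hv)
  · rw [map_sub, Polynomial.aeval_X, Polynomial.aeval_C, LinearMap.sub_apply,
      Module.algebraMap_end_apply, ← E_F_add_F_E (mem_homogSpace.mp hu), Module.End.mul_apply,
      add_sub_cancel_right]
  · exact E_F_add_F_E ((mem_homogSpace.mp hu).F_pow (i + 1))

/-! ### The twist of a dual module -/

/-- On `V^∨`, the operator `F^k E^k` is the transpose of `(-1)^k E^k F^k`. -/
lemma dual_F_pow_E_pow (V : WeightModule r) (k : ℕ) (f : Module.Dual ℂ V) (v : V) :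
    (((dual V).op .F ^ k) (((dual V).op .E ^ k) f) : Module.Dual ℂ V) v =
      (-1) ^ k * f ((V.op .E ^ k) ((V.op .F ^ k) v)) := by
  set E' : Module.End ℂ V := V.par * -(V.op .E * V.op .Kinv) with hE'
  set F' : Module.End ℂ V := V.par * -(V.op .K * V.op .F) with hF'
  have hpow : ∀ (g : Module.End ℂ V) (k : ℕ) (f : Module.Dual ℂ V) (v : V),
      ((LinearMap.dualMap g : Module.End ℂ (Module.Dual ℂ V)) ^ k) f v = f ((g ^ k) v) := by
    intro g k
    induction k with
    | zero => intros; rfl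
    | succ k ih =>
      intro f v
      rw [pow_succ, Module.End.mul_apply, ih, LinearMap.dualMap_apply, pow_succ',
        Module.End.mul_apply]
  have e1 : E' * F' = -(V.op .E * V.op .F) := by
    have h : V.par * (V.op .E * V.op .Kinv) * (V.par * (V.op .K * V.op .F)) =
        V.par * V.op .E * (V.op .Kinv * V.par) * (V.op .K * V.op .F) := by simp only [mul_assoc]
    have h' : V.op .E * V.par * (V.par * V.op .Kinv) * (V.op .K * V.op .F) =
        V.op .E * (V.par * V.par) * (V.op .Kinv * V.op .K) * V.op .F := by simp only [mul_assoc]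
    rw [hE', hF', mul_neg, mul_neg, neg_mul_neg, h, V.par_E, ← V.par_Kinv, neg_mul, neg_mul, h',
      V.par_sq, V.rel.KinvK, mul_one, mul_one]
  have e2 : E' * V.op .E = (-qpow r (-2)) • (V.op .E * E') := by
    rw [hE', mul_neg, neg_mul, mul_neg, mul_assoc, mul_assoc, V.rel.KiE, ← mul_assoc (V.op .E) V.par,
      ← neg_eq_iff_eq_neg.mpr V.par_E, mul_smul_comm, mul_smul_comm, neg_mul, neg_neg, neg_smul,
      mul_assoc]
  have e3 : V.op .F * F' = (-qpow r 2) • (F' * V.op .F) := by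
    have h : V.op .F * V.op .K = qpow r 2 • (V.op .K * V.op .F) := by
      rw [V.rel.KF, smul_smul, mul_comm, qpow_neg_mul, one_smul]
    rw [hF', mul_neg, mul_neg, neg_mul, ← mul_assoc (V.op .F) V.par,
      ← neg_eq_iff_eq_neg.mpr V.par_F, neg_mul, neg_neg, mul_assoc V.par, ← mul_assoc (V.op .F), h,
      smul_mul_assoc, mul_smul_comm, neg_smul, smul_neg, neg_neg]
    simp only [mul_assoc]
  have e4 : ∀ k, E' ^ k * V.op .E = (-qpow r (-2)) ^ k • (V.op .E * E' ^ k) := by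
    intro k
    induction k with
    | zero => simp
    | succ k ih =>
      rw [pow_succ, mul_assoc, e2, mul_smul_comm, ← mul_assoc, ih, smul_mul_assoc, smul_smul,
        mul_assoc, ← pow_succ, ← pow_succ']
  have e5 : ∀ k, V.op .F * F' ^ k = (-qpow r 2) ^ k • (F' ^ k * V.op .F) := by
    intro k
    induction k with
    | zero => simp
    | succ k ih =>
      rw [pow_succ', ← mul_assoc, e3, smul_mul_assoc, mul_assoc, ih, mul_smul_comm, smul_smul,
        ← mul_assoc, ← pow_succ', ← pow_succ']
  have key : ∀ k, E' ^ k * F' ^ k = (-1 : ℂ) ^ k • (V.op .E ^ k * V.op .F ^ k) := by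
    intro k
    induction k with
    | zero => simp
    | succ k ih =>
      have h : E' ^ k * V.op .E * (V.op .F * F' ^ k) = V.op .E * (E' ^ k * F' ^ k) * V.op .F := by
        rw [e4, e5, smul_mul_smul_comm, ← mul_pow, neg_qpow_mul, one_pow, one_smul]
        simp only [mul_assoc]
      have h' : E' ^ (k + 1) * F' ^ (k + 1) = E' ^ k * (E' * F') * F' ^ k := by
        rw [pow_succ, pow_succ' F']; simp only [mul_assoc]
      have h'' : E' ^ k * -(V.op .E * V.op .F) * F' ^ k =
          -(E' ^ k * V.op .E * (V.op .F * F' ^ k)) := by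
        simp only [mul_assoc, mul_neg, neg_mul]
      rw [h', e1, h'', h, ih, pow_succ' (V.op .E), pow_succ (V.op .F), pow_succ]
      simp only [mul_assoc, mul_smul_comm, smul_mul_assoc, mul_neg, mul_one, neg_smul]
  rw [dual_op, dual_op]
  simp only [genFun]
  rw [hpow, hpow, ← Module.End.mul_apply, key, LinearMap.smul_apply, map_smul, smul_eq_mul,
    Module.End.mul_apply]

/-- The twist of `V^∨` as the transpose of an operator on `V`, obtained from the formula for the twist
of `V` by exchanging `E` with `F`, dropping the signs `(-1)^k` and passing to the weight of `f`. -/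
lemma toLin_ptr_braiding_dual (hr : 3 ≤ r) (h0 : rbar r ≠ 0) {s : ℤ}
    (hs : qpow r (2 * (s : ℂ)) = 1) {V : WeightModule r} {m : ℂ} {b : ℕ} {f : Module.Dual ℂ V}
    (hf : (dual V).Homog m b f) (v : V) :
    (Hom.toLin ((pivotal hs).ptr ((braided hr h0).braiding (dual V) (dual V)).hom) f :
      Module.Dual ℂ V) v = f (∑ k ∈ Finset.range (rbar r), (rCoeff r k *
        qpow r ((m + 2 * k) * m / 2 + (1 - s) * (m + 2 * k))) •
          (V.op .E ^ k) ((V.op .F ^ k) v)) := by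
  rw [toLin_ptr_braiding hr h0 hs hf, map_sum]
  refine (LinearMap.sum_apply _ _ _).trans (Finset.sum_congr rfl fun k _ => ?_)
  refine (LinearMap.smul_apply _ _ _).trans ?_
  have h := neg_one_sq_pow k
  rw [dual_F_pow_E_pow, map_smul, smul_eq_mul, smul_eq_mul]
  linear_combination (rCoeff r k * qpow r ((m + 2 * k) * m / 2 + (1 - s) * (m + 2 * k)) *
    f ((V.op .E ^ k) ((V.op .F ^ k) v))) * h

end WeightModule

end Osp

namespace Osp

open Polynomial (C X aeval)

lemma continuous_qpow (r : ℕ) : Continuous (qpow r) := by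
  unfold qpow
  fun_prop

lemma continuous_qnum (r : ℕ) : Continuous (qnum r) := by
  have := continuous_qpow r
  unfold qnum
  fun_prop

/-! ### The eigenvalues of `F E` on a weight space -/

/-- The eigenvalue of `F E` on the vector of weight `z` of the Verma module of highest
weight `z + 2 j`. -/
lemma vermaCoeff_add (r : ℕ) (z : ℂ) (j : ℕ) : vermaCoeff r (z + 2 * j) j =
    ∑ i ∈ Finset.range j, (-1) ^ i * qnum r (z + 2 + 2 * i) := by
  rw [vermaCoeff, ← Finset.sum_range_reflect, Finset.mul_sum, ← Finset.sum_neg_distrib]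
  refine Finset.sum_congr rfl fun i hi => ?_
  obtain ⟨m, rfl⟩ := Nat.exists_eq_add_of_le (Nat.succ_le_of_lt (Finset.mem_range.mp hi))
  rw [show i.succ + m - 1 - i = m by omega, show z + 2 * ((i.succ + m : ℕ) : ℂ) - 2 * (m : ℂ) =
    z + 2 + 2 * i by push_cast; ring, Nat.succ_eq_add_one]
  have h : (-1 : ℂ) ^ m * (-1) ^ m = 1 := by rw [← mul_pow]; simp
  linear_combination (-1 : ℂ) ^ i * qnum r (z + 2 + 2 * i) * h

lemma countable_qpow_eq {r : ℕ} (hr : r ≠ 0) (c : ℂ) : {z : ℂ | qpow r (2 * z) = c}.Countable := by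
  by_cases h : ∃ z₀, qpow r (2 * z₀) = c
  · obtain ⟨z₀, rfl⟩ := h
    refine (Set.countable_range fun n : ℤ => z₀ + n * r / 2).mono fun z hz => ?_
    have h1 : qpow r (2 * z - 2 * z₀) = 1 := by
      rw [qpow_sub, show qpow r (2 * z) = _ from hz, mul_inv_cancel₀ (qpow_ne_zero _ _)]
    obtain ⟨n, hn⟩ := (qpow_eq_one_iff hr _).mp h1
    exact ⟨n, by simp only; linear_combination -hn / 2⟩
  · convert Set.countable_empty
    ext z
    exact ⟨fun hz => (h ⟨z, hz⟩).elim, fun hz => hz.elim⟩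

/-- Outside a countable set of weights the eigenvalues of `F E` are distinct. -/
lemma countable_vermaCoeff_eq {r : ℕ} (hr : 3 ≤ r) {i j : ℕ} (hij : i < j) (hj : j < rbar r) :
    {z : ℂ | vermaCoeff r (z + 2 * i) i = vermaCoeff r (z + 2 * j) j}.Countable := by
  set A := ∑ m ∈ Finset.Ico i j, (-qpow r 2) ^ m with hA
  set B := ∑ m ∈ Finset.Ico i j, (-qpow r (-2)) ^ m with hB
  have hA0 : qpow r 4 * A ≠ 0 := by
    rw [hA, Finset.sum_Ico_eq_sum_range]
    simp only [pow_add, ← Finset.mul_sum]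
    exact mul_ne_zero (qpow_ne_zero _ _) (mul_ne_zero
      (pow_ne_zero _ (neg_ne_zero.mpr (qpow_ne_zero _ _)))
      (sum_range_pow_ne_zero (by omega) (by omega)))
  refine (countable_qpow_eq (by omega : r ≠ 0) (B / (qpow r 4 * A))).mono fun z hz => ?_
  have hz' : vermaCoeff r (z + 2 * i) i = vermaCoeff r (z + 2 * j) j := hz
  rw [vermaCoeff_add, vermaCoeff_add, ← Finset.sum_range_add_sum_Ico _ hij.le] at hz'
  have h1 := (left_eq_add.mp hz')
  simp only [neg_one_pow_mul_qnum, ← Finset.mul_sum, Finset.sum_sub_distrib] at h1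
  have h2 := (mul_eq_zero.mp h1).resolve_left (inv_ne_zero (qpow_sub_inv_ne_zero hr))
  rw [← hA, ← hB] at h2
  change qpow r (2 * z) = _
  rw [eq_div_iff hA0]
  have e : qpow r (2 * z) * (qpow r 4 * A) = qpow r (z + 2) * (qpow r (z + 2) * A) := by
    rw [← mul_assoc, ← mul_assoc, ← qpow_add, ← qpow_add]; congr 2; ring
  rw [e, sub_eq_zero.mp h2, ← mul_assoc, mul_comm (qpow r (z + 2)), qpow_neg_mul, one_mul]

/-- The difference, as a polynomial in `F E`, between the twist and the transpose of the twist of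
the dual module on vectors of weight `z`, for the pivotal structure with `s = r̄`. -/
def dualDefect (r : ℕ) (z : ℂ) : Polynomial ℂ := ∑ k ∈ Finset.range (rbar r),
  (C ((-1) ^ k * rCoeff r k * qpow r ((z + 2 * k) * z / 2 + (1 - rbar r) * (z + 2 * k))) *
      ladderProd X (fun i => qnum r (z + 2 * (i + 1 : ℕ))) k -
    C (rCoeff r k * qpow r ((-z + 2 * k) * -z / 2 + (1 - rbar r) * (-z + 2 * k))) *
      ladderProd (C (qnum r z) - X) (fun i => qnum r (z - 2 * (i + 1 : ℕ))) k)

lemma degree_dualDefect_lt (r : ℕ) (z : ℂ) : (dualDefect r z).degree < rbar r := by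
  have h : ∀ (p₀ : Polynomial ℂ) (c : ℕ → ℂ) (a : ℂ), p₀.degree ≤ 1 → ∀ k < rbar r,
      C a * ladderProd p₀ c k ∈ Polynomial.degreeLT ℂ (rbar r) := by
    intro p₀ c a hp k hk
    rw [← Polynomial.smul_eq_C_mul]
    exact Submodule.smul_mem _ _ (Polynomial.mem_degreeLT.mpr
      ((degree_ladderProd_le hp c k).trans_lt (by exact_mod_cast hk)))
  refine Polynomial.mem_degreeLT.mp (Submodule.sum_mem _ fun k hk => Submodule.sub_mem _
    (h _ _ _ Polynomial.degree_X_le k (Finset.mem_range.mp hk))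
    (h _ _ _ ?_ k (Finset.mem_range.mp hk)))
  exact (Polynomial.degree_sub_le _ _).trans
    (max_le (Polynomial.degree_C_le.trans zero_le_one) Polynomial.degree_X_le)

lemma continuous_eval_dualDefect (r : ℕ) (x : ℂ) :
    Continuous fun z => (dualDefect r z).eval x := by
  have h1 := continuous_qpow r
  have h2 := continuous_qnum r
  simp only [dualDefect, Polynomial.eval_finsetSum, Polynomial.eval_sub, Polynomial.eval_mul,
    Polynomial.eval_C]
  refine continuous_finsetSum _ fun k _ => Continuous.sub ?_ ?_
  · refine Continuous.mul (by fun_prop) (continuous_eval_ladderProd (p₀ := fun _ => X)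
      (c := fun z i => qnum r (z + 2 * (i + 1 : ℕ))) x (by fun_prop) (fun i => by fun_prop) k)
  · refine Continuous.mul (by fun_prop) (continuous_eval_ladderProd
      (p₀ := fun z => C (qnum r z) - X)
      (c := fun z i => qnum r (z - 2 * (i + 1 : ℕ))) x ?_ (fun i => by fun_prop) k)
    simp only [Polynomial.eval_sub, Polynomial.eval_C, Polynomial.eval_X]
    fun_prop

namespace WeightModule

variable {r : ℕ}

lemma aeval_dualDefect {V : WeightModule r} {z : ℂ} {a : ℕ} {v : V} (hv : V.Homog z a v) :
    aeval (V.op .F * V.op .E) (dualDefect r z) v =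
      ∑ k ∈ Finset.range (rbar r), ((-1) ^ k * rCoeff r k *
        qpow r ((z + 2 * k) * z / 2 + (1 - rbar r) * (z + 2 * k))) •
          (V.op .F ^ k) ((V.op .E ^ k) v) -
      ∑ k ∈ Finset.range (rbar r), (rCoeff r k *
        qpow r ((-z + 2 * k) * -z / 2 + (1 - rbar r) * (-z + 2 * k))) •
          (V.op .E ^ k) ((V.op .F ^ k) v) := by
  rw [dualDefect, map_sum, LinearMap.sum_apply, ← Finset.sum_sub_distrib]
  refine Finset.sum_congr rfl fun k _ => ?_
  rw [F_pow_E_pow hv, E_pow_F_pow hv, map_sub, map_mul (aeval _), map_mul (aeval _), Polynomial.aeval_C,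
    Polynomial.aeval_C, LinearMap.sub_apply, Module.End.mul_apply, Module.End.mul_apply,
    Module.algebraMap_end_apply, Module.algebraMap_end_apply]

/-- On Verma modules the twist agrees with the transpose of the twist of the dual, as both are
scalars. -/
lemma eval_dualDefect (hr : 3 ≤ r) (h0 : rbar r ≠ 0)
    (hs : qpow r (2 * ((rbar r : ℤ) : ℂ)) = 1) (z : ℂ) {j : ℕ} (hj : j < rbar r) :
    (dualDefect r z).eval (vermaCoeff r (z + 2 * j) j) = 0 := by
  set ν := z + 2 * (j : ℂ) with hν
  have hv : (verma r ν).Homog z j (stdVec _ j) := by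
    have := homog_stdVec (r := r) ν j
    rwa [hν, add_sub_cancel_right] at this
  have hf : (dual (verma r ν)).Homog (-z) j (stdCoord _ j) := by
    have := homog_stdCoord (r := r) ν j
    rwa [hν, add_sub_cancel_right] at this
  have hFE : ((verma r ν).op .F * (verma r ν).op .E) (stdVec _ j) =
      vermaCoeff r ν j • stdVec _ j := by
    rw [Module.End.mul_apply, verma_E, verma_F]
    cases j with
    | zero => rw [vermaE_stdVec_zero, map_zero, vermaCoeff_zero, zero_smul]
    | succ j => rw [vermaE_stdVec_succ (by omega), map_smul, vermaF_stdVec]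
  have h1 := congrArg (stdCoord _ j) (aeval_dualDefect hv)
  have hev : aeval ((verma r ν).op .F * (verma r ν).op .E) (dualDefect r z) (stdVec _ j) =
      (dualDefect r z).eval (vermaCoeff r ν j) • stdVec _ j := by
    refine Module.End.aeval_apply_of_hasEigenvector ⟨Module.End.mem_eigenspace_iff.mpr hFE, ?_⟩
    intro h
    have := congrArg (stdCoord _ j) h
    rw [stdCoord_stdVec hj] at this
    simp at this
  have h2 := toLin_ptr_braiding hr h0 hs hv
  have h3 := toLin_ptr_braiding_dual hr h0 hs hf (stdVec _ j)
  simp only [Int.cast_natCast] at h2 h3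
  rw [toLin_ptr_braiding_verma] at h2
  rw [toLin_ptr_braiding_dual_verma hr h0 hs ν _ rfl] at h3
  rw [hev, map_sub, ← h2, ← h3, map_smul, LinearMap.smul_apply, map_smul, LinearMap.smul_apply,
    LinearMap.id_apply, LinearMap.id_apply, LinearMap.smul_apply, stdCoord_stdVec hj, if_pos rfl,
    smul_eq_mul, mul_one, smul_eq_mul, smul_eq_mul, mul_one, mul_one, sub_eq_zero.mpr] at h1
  · exact h1
  · congr 1; push_cast; ring

/-- For a generic weight the polynomial `dualDefect` has too many zeros; it vanishes at every weight
by continuity. -/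
lemma dualDefect_eq_zero (hr : 3 ≤ r) (h0 : rbar r ≠ 0)
    (hs : qpow r (2 * ((rbar r : ℤ) : ℂ)) = 1) (z : ℂ) : dualDefect r z = 0 := by
  set S : Set ℂ := ⋃ j ∈ Finset.range (rbar r), ⋃ i ∈ Finset.range j,
    {z : ℂ | vermaCoeff r (z + 2 * i) i = vermaCoeff r (z + 2 * j) j} with hS
  have hSc : S.Countable := by
    refine Set.Countable.biUnion (Finset.countable_toSet _) fun j hj => ?_
    refine Set.Countable.biUnion (Finset.countable_toSet _) fun i hi => ?_
    exact countable_vermaCoeff_eq hr (Finset.mem_range.mp hi) (Finset.mem_range.mp hj)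
  have hgen : ∀ z ∈ Sᶜ, dualDefect r z = 0 := by
    intro z hz
    have hne : ∀ i j : ℕ, i < j → j < rbar r →
        vermaCoeff r (z + 2 * i) i ≠ vermaCoeff r (z + 2 * j) j := by
      intro i j hij hj h
      refine hz ?_
      simp only [hS, Set.mem_iUnion]
      exact ⟨j, Finset.mem_range.mpr hj, i, Finset.mem_range.mpr hij, h⟩
    refine Polynomial.eq_zero_of_degree_lt_of_eval_index_eq_zero
      (v := fun j : ℕ => vermaCoeff r (z + 2 * j) j) (Finset.range (rbar r)) ?_ ?_ ?_
    · intro i hi j hj h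
      have hi' := Finset.mem_range.mp hi
      have hj' := Finset.mem_range.mp hj
      rcases lt_trichotomy i j with hij | hij | hij
      · exact (hne i j hij hj' h).elim
      · exact hij
      · exact (hne j i hij hi' h.symm).elim
    · rw [Finset.card_range]
      exact degree_dualDefect_lt r z
    · exact fun j hj => eval_dualDefect hr h0 hs z (Finset.mem_range.mp hj)
  refine Polynomial.funext fun x => ?_
  have hc := Continuous.ext_on (hSc.dense_compl ℝ) (continuous_eval_dualDefect r x)
    (continuous_const (y := (0 : ℂ))) fun w hw => by simp [hgen w hw]
  simpa using congrFun hc z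

/-- For `s = r̄` the twist is compatible with duality. -/
lemma toLin_ptr_braiding_dual_of_rbar (hr : 3 ≤ r) (h0 : rbar r ≠ 0)
    (hs : qpow r (2 * ((rbar r : ℤ) : ℂ)) = 1) (V : WeightModule r) :
    Hom.toLin ((pivotal hs).ptr ((braided hr h0).braiding (dual V) (dual V)).hom) =
      LinearMap.dualMap (Hom.toLin ((pivotal hs).ptr ((braided hr h0).braiding V V).hom)) := by
  refine ext_homog (V := dual V) fun m b f hf => ext_homog fun z a v hv => ?_
  rw [toLin_ptr_braiding_dual hr h0 hs hf, LinearMap.dualMap_apply, toLin_ptr_braiding hr h0 hs hv]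
  have hfv : ∀ w : V, V.op .H w = z • w → m ≠ -z → f w = 0 := by
    intro w hw hm
    have h := LinearMap.congr_fun hf.wt w
    rw [dual_op] at h
    simp only [genFun, LinearMap.dualMap_apply, LinearMap.neg_apply, map_neg, hw, map_smul,
      LinearMap.smul_apply, smul_eq_mul] at h
    have h' : (m + z) * f w = 0 := by linear_combination -h
    exact (mul_eq_zero.mp h').resolve_left fun h'' => hm (by linear_combination h'')
  by_cases hm : m = -z
  · subst hm
    have h := aeval_dualDefect hv
    rw [dualDefect_eq_zero hr h0 hs, map_zero, LinearMap.zero_apply] at h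
    simp only [Int.cast_natCast]
    rw [sub_eq_zero.mp h.symm]
  · rw [map_sum, map_sum]
    refine Finset.sum_congr rfl fun k _ => ?_
    rw [map_smul, map_smul, hfv _ _ hm, hfv _ _ hm, smul_zero, smul_zero]
    · have := ((hv.E_pow k).F_pow k).wt
      rwa [add_sub_cancel_right] at this
    · have := ((hv.F_pow k).E_pow k).wt
      rwa [sub_add_cancel] at this

end WeightModule

end Osp

namespace Osp

namespace WeightModule

variable {r : ℕ}

/-! ### The category of weight modules is abelian -/

/-- A subspace stable under the quantum group and the grading involution, as a weight module. -/
@[reducible] def sub (V : WeightModule r) (W : Submodule ℂ V) (hp : ∀ w ∈ W, V.par w ∈ W)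
    (h : ∀ x, ∀ w ∈ W, V.act x w ∈ W) : WeightModule r where
  carrier := W
  par := V.par.restrict hp
  par_sq := LinearMap.ext fun w => Subtype.ext (V.par_par w)
  act :=
    { toFun := fun x => (V.act x).restrict (h x)
      map_one' := LinearMap.ext fun w => Subtype.ext (by simp)
      map_mul' := fun x y => LinearMap.ext fun w => Subtype.ext (by simp)
      map_zero' := LinearMap.ext fun w => Subtype.ext (by simp)
      map_add' := fun x y => LinearMap.ext fun w => Subtype.ext (by simp)
      commutes' := fun c => LinearMap.ext fun w => Subtype.ext (by simp) }
  par_H := LinearMap.ext fun w => Subtype.ext (V.H_par w).symm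
  par_K := LinearMap.ext fun w => Subtype.ext (V.K_par w).symm
  par_E := LinearMap.ext fun w => Subtype.ext (LinearMap.congr_fun V.par_E w)
  par_F := LinearMap.ext fun w => Subtype.ext (LinearMap.congr_fun V.par_F w)
  diag := Module.End.genEigenspace_restrict_eq_top (h _) V.diag
  K_weight μ w hw := Subtype.ext (V.K_weight μ w (congrArg Subtype.val hw))

/-- The images of joint weight vectors under an intertwining map are joint weight vectors. -/
lemma range_le_iSup_weight (V : WeightModule r) {X : Type*} [AddCommGroup X] [Module ℂ X]
    (f : V →ₗ[ℂ] X) (H K : Module.End ℂ X) (hH : ∀ v, f (V.op .H v) = H (f v))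
    (hK : ∀ v, f (V.op .K v) = K (f v)) :
    LinearMap.range f ≤ ⨆ μ : ℂ, H.eigenspace μ ⊓ K.eigenspace (qpow r μ) := by
  rw [LinearMap.range_eq_map, ← V.weight_span, Submodule.map_iSup]
  refine iSup_mono fun μ => ?_
  rintro _ ⟨v, ⟨h1, h2⟩, rfl⟩
  refine ⟨Module.End.mem_eigenspace_iff.mpr ?_, Module.End.mem_eigenspace_iff.mpr ?_⟩
  · rw [← hH, Module.End.mem_eigenspace_iff.mp h1, map_smul]
  · rw [← hK, Module.End.mem_eigenspace_iff.mp h2, map_smul]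

lemma quot_span (V : WeightModule r) (W : Submodule ℂ V) (h : ∀ x, ∀ w ∈ W, V.act x w ∈ W) :
    ⨆ μ : ℂ, Module.End.eigenspace (W.mapQ W (V.op .H) (h _)) μ ⊓
      Module.End.eigenspace (W.mapQ W (V.op .K) (h _)) (qpow r μ) = ⊤ :=
  top_le_iff.mp ((Submodule.range_mkQ W).ge.trans
    (range_le_iSup_weight V W.mkQ _ _ (fun _ => rfl) (fun _ => rfl)))

/-- The quotient of a weight module by a stable subspace. -/
@[reducible] def quot (V : WeightModule r) (W : Submodule ℂ V) (hp : ∀ w ∈ W, V.par w ∈ W)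
    (h : ∀ x, ∀ w ∈ W, V.act x w ∈ W) : WeightModule r where
  carrier := V ⧸ W
  par := W.mapQ W V.par hp
  par_sq := Submodule.linearMap_qext _ (LinearMap.ext fun v => congrArg W.mkQ (V.par_par v))
  act :=
    { toFun := fun x => W.mapQ W (V.act x) (h x)
      map_one' := Submodule.linearMap_qext _ (LinearMap.ext fun v => by simp)
      map_mul' := fun x y => Submodule.linearMap_qext _ (LinearMap.ext fun v => by simp)
      map_zero' := Submodule.linearMap_qext _ (LinearMap.ext fun v => by simp)
      map_add' := fun x y => Submodule.linearMap_qext _ (LinearMap.ext fun v => by simp)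
      commutes' := fun c => Submodule.linearMap_qext _ (LinearMap.ext fun v => by simp) }
  par_H := Submodule.linearMap_qext _ (LinearMap.ext fun v => congrArg W.mkQ (V.H_par v).symm)
  par_K := Submodule.linearMap_qext _ (LinearMap.ext fun v => congrArg W.mkQ (V.K_par v).symm)
  par_E := Submodule.linearMap_qext _ (LinearMap.ext fun v =>
    congrArg W.mkQ (LinearMap.congr_fun V.par_E v))
  par_F := Submodule.linearMap_qext _ (LinearMap.ext fun v =>
    congrArg W.mkQ (LinearMap.congr_fun V.par_F v))
  diag := (weight_of_span _ _ (quot_span V W h)).1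
  K_weight := (weight_of_span _ _ (quot_span V W h)).2

lemma pi_span {n : ℕ} (V : Fin n → WeightModule r) :
    ⨆ μ : ℂ, Module.End.eigenspace
      (LinearMap.pi fun i => (V i).op .H ∘ₗ LinearMap.proj i : Module.End ℂ (∀ i, V i)) μ = ⊤ := by
  rw [eq_top_iff]
  intro v _
  rw [← Finset.univ_sum_single v]
  refine Submodule.sum_mem _ fun i _ => ?_
  refine (range_le_iSup_weight (V i) (LinearMap.single ℂ (fun i => V i) i) _
    (LinearMap.pi fun i => (V i).op .K ∘ₗ LinearMap.proj i) (fun x => ?_) (fun x => ?_)).trans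
      (iSup_mono fun μ => inf_le_left) ⟨v i, rfl⟩
  · refine funext fun j => ?_
    exact (Pi.apply_single (fun j => (V j).op .H) (fun j => map_zero _) i x j).symm
  · refine funext fun j => ?_
    exact (Pi.apply_single (fun j => (V j).op .K) (fun j => map_zero _) i x j).symm

/-- Finite products of weight modules. -/
@[reducible] def pi {n : ℕ} (V : Fin n → WeightModule r) : WeightModule r where
  carrier := ∀ i, V i
  par := LinearMap.pi fun i => (V i).par ∘ₗ LinearMap.proj i
  par_sq := LinearMap.ext fun v => funext fun i => (V i).par_par (v i)
  act :=
    { toFun := fun x => LinearMap.pi fun i => (V i).act x ∘ₗ LinearMap.proj i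
      map_one' := LinearMap.ext fun v => funext fun i => by simp
      map_mul' := fun x y => LinearMap.ext fun v => funext fun i => by simp
      map_zero' := LinearMap.ext fun v => funext fun i => by simp
      map_add' := fun x y => LinearMap.ext fun v => funext fun i => by simp
      commutes' := fun c => LinearMap.ext fun v => funext fun i => by simp }
  par_H := LinearMap.ext fun v => funext fun i => ((V i).H_par (v i)).symm
  par_K := LinearMap.ext fun v => funext fun i => ((V i).K_par (v i)).symm
  par_E := LinearMap.ext fun v => funext fun i => LinearMap.congr_fun (V i).par_E (v i)
  par_F := LinearMap.ext fun v => funext fun i => LinearMap.congr_fun (V i).par_F (v i)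
  diag := pi_span V
  K_weight μ v hv := funext fun i => (V i).K_weight μ (v i) (congrFun hv i)

/-- The inclusion of a stable subspace. -/
def subι (V : WeightModule r) (W : Submodule ℂ V) (hp : ∀ w ∈ W, V.par w ∈ W)
    (h : ∀ x, ∀ w ∈ W, V.act x w ∈ W) : sub V W hp h ⟶ V where
  toLin := W.subtype
  map_par _ := rfl
  map_act _ _ := rfl

/-- The projection onto a quotient. -/
def quotπ (V : WeightModule r) (W : Submodule ℂ V) (hp : ∀ w ∈ W, V.par w ∈ W)
    (h : ∀ x, ∀ w ∈ W, V.act x w ∈ W) : V ⟶ quot V W hp h where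
  toLin := W.mkQ
  map_par _ := rfl
  map_act _ _ := rfl

section

variable {V W : WeightModule r} (f : V ⟶ W)

lemma par_mem_ker (v : V) (hv : v ∈ LinearMap.ker f.toLin) : V.par v ∈ LinearMap.ker f.toLin := by
  rw [LinearMap.mem_ker] at hv ⊢
  rw [f.map_par, hv, map_zero]

lemma act_mem_ker (x : QGroup r) (v : V) (hv : v ∈ LinearMap.ker f.toLin) :
    V.act x v ∈ LinearMap.ker f.toLin := by
  rw [LinearMap.mem_ker] at hv ⊢
  rw [f.map_act, hv, map_zero]

lemma par_mem_range (w : W) (hw : w ∈ LinearMap.range f.toLin) :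
    W.par w ∈ LinearMap.range f.toLin := by
  obtain ⟨v, rfl⟩ := hw
  exact ⟨_, f.map_par v⟩

lemma act_mem_range (x : QGroup r) (w : W) (hw : w ∈ LinearMap.range f.toLin) :
    W.act x w ∈ LinearMap.range f.toLin := by
  obtain ⟨v, rfl⟩ := hw
  exact ⟨_, f.map_act x v⟩

/-- The inclusion of the kernel. -/
def kerι := subι V (LinearMap.ker f.toLin) (par_mem_ker f) (act_mem_ker f)

/-- The projection onto the cokernel. -/
def cokerπ := quotπ W (LinearMap.range f.toLin) (par_mem_range f) (act_mem_range f)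

lemma kerι_comp : kerι f ≫ f = 0 := hom_ext (LinearMap.ext fun v => v.2)

lemma comp_cokerπ : f ≫ cokerπ f = 0 :=
  hom_ext (LinearMap.ext fun v => (Submodule.Quotient.mk_eq_zero _).mpr ⟨v, rfl⟩)

lemma mem_ker_of_comp {X : WeightModule r} {k : X ⟶ V} (hk : k ≫ f = 0) (x : X) :
    k.toLin x ∈ LinearMap.ker f.toLin := LinearMap.congr_fun (congrArg Hom.toLin hk) x

lemma range_le_ker_of_comp {X : WeightModule r} {k : W ⟶ X} (hk : f ≫ k = 0) :
    LinearMap.range f.toLin ≤ LinearMap.ker k.toLin := by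
  rintro _ ⟨v, rfl⟩
  exact LinearMap.congr_fun (congrArg Hom.toLin hk) v

/-- The linear kernel is a kernel. -/
def isLimitKer : Limits.IsLimit (Limits.KernelFork.ofι (kerι f) (kerι_comp f)) :=
  Limits.KernelFork.IsLimit.ofι _ _
    (fun k hk => ⟨k.toLin.codRestrict _ (mem_ker_of_comp f hk),
      fun v => Subtype.ext (k.map_par v), fun x v => Subtype.ext (k.map_act x v)⟩)
    (fun _ _ => rfl)
    (fun _ _ _ hm => hom_ext (LinearMap.ext fun v =>
      Subtype.ext (LinearMap.congr_fun (congrArg Hom.toLin hm) v)))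

/-- The linear cokernel is a cokernel. -/
def isColimitCoker : Limits.IsColimit (Limits.CokernelCofork.ofπ (cokerπ f) (comp_cokerπ f)) :=
  Limits.CokernelCofork.IsColimit.ofπ _ _
    (fun k hk => ⟨(LinearMap.range f.toLin).liftQ k.toLin (range_le_ker_of_comp f hk),
      fun v => by
        obtain ⟨v, rfl⟩ := Submodule.mkQ_surjective _ v
        exact k.map_par v,
      fun x v => by
        obtain ⟨v, rfl⟩ := Submodule.mkQ_surjective _ v
        exact k.map_act x v⟩)
    (fun _ _ => rfl)
    (fun _ _ _ hm => hom_ext (Submodule.linearMap_qext _ (congrArg Hom.toLin hm)))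

lemma injective_of_mono [Mono f] : Function.Injective f.toLin := by
  rw [← LinearMap.ker_eq_bot, eq_bot_iff]
  intro v hv
  have h : kerι f = 0 := by rw [← cancel_mono f, kerι_comp, Limits.zero_comp]
  exact LinearMap.congr_fun (congrArg Hom.toLin h) ⟨v, hv⟩

lemma surjective_of_epi [Epi f] : Function.Surjective f.toLin := by
  intro w
  have h : cokerπ f = 0 := by rw [← cancel_epi f, comp_cokerπ, Limits.comp_zero]
  exact (Submodule.Quotient.mk_eq_zero _).mp (LinearMap.congr_fun (congrArg Hom.toLin h) w)

lemma isIso_of_bijective (h : Function.Bijective f.toLin) : IsIso f :=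
  inferInstanceAs (IsIso (isoOfBijective f h).hom)

end

instance : IsNormalMonoCategory (WeightModule r) where
  normalMonoOfMono {V W} f _ := by
    let l := (isLimitKer (cokerπ f)).lift (Limits.KernelFork.ofι f (comp_cokerπ f))
    have hl : l ≫ kerι (cokerπ f) = f := (isLimitKer (cokerπ f)).fac _ .zero
    have hb : Function.Bijective (Hom.toLin l) := by
      refine ⟨fun a b h => injective_of_mono f ?_, fun w => ?_⟩
      · rw [← hl]
        exact congrArg Subtype.val h
      · obtain ⟨v, hv⟩ := (Submodule.Quotient.mk_eq_zero _).mp w.2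
        exact ⟨v, Subtype.ext hv⟩
    exact ⟨{ Z := _, g := cokerπ f, w := comp_cokerπ f
             isLimit := Limits.IsKernel.isoKernel (cokerπ f) f (isLimitKer (cokerπ f))
              (isoOfBijective l hb) hl }⟩

instance : IsNormalEpiCategory (WeightModule r) where
  normalEpiOfEpi {V W} f _ := by
    let l := (isColimitCoker (kerι f)).desc (Limits.CokernelCofork.ofπ f (kerι_comp f))
    have hl : cokerπ (kerι f) ≫ l = f := (isColimitCoker (kerι f)).fac _ .one
    have hb : Function.Bijective (Hom.toLin l) := by
      refine ⟨?_, fun w => ?_⟩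
      · rw [← LinearMap.ker_eq_bot, eq_bot_iff]
        intro q hq
        obtain ⟨v, rfl⟩ := Submodule.mkQ_surjective _ q
        exact (Submodule.Quotient.mk_eq_zero _).mpr ⟨⟨v, hq⟩, rfl⟩
      · obtain ⟨v, hv⟩ := surjective_of_epi f w
        exact ⟨Submodule.Quotient.mk v, hv⟩
    exact ⟨{ W := _, g := kerι f, w := kerι_comp f
             isColimit := Limits.IsCokernel.cokernelIso (kerι f) f (isColimitCoker (kerι f))
              (isoOfBijective l hb) hl }⟩

instance : Limits.HasKernels (WeightModule r) := ⟨fun f => ⟨⟨⟨_, isLimitKer f⟩⟩⟩⟩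

instance : Limits.HasCokernels (WeightModule r) := ⟨fun f => ⟨⟨⟨_, isColimitCoker f⟩⟩⟩⟩

instance : Limits.HasFiniteProducts (WeightModule r) where
  out n :=
    { has_limit := fun D => by
        let V : Fin n → WeightModule r := fun i => D.obj ⟨i⟩
        let c : Limits.Fan V := Limits.Fan.mk (pi V) fun i => ⟨LinearMap.proj i, fun _ => rfl,
          fun _ _ => rfl⟩
        have hc : Limits.IsLimit c := Limits.Fan.IsLimit.mk c
          (fun s => ⟨LinearMap.pi fun i => (s.proj i).toLin,
            fun v => funext fun i => (s.proj i).map_par v,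
            fun x v => funext fun i => (s.proj i).map_act x v⟩)
          (fun _ _ => rfl)
          (fun s m hm => hom_ext (LinearMap.ext fun v => funext fun i =>
            LinearMap.congr_fun (congrArg Hom.toLin (hm i)) v))
        have : Limits.HasLimit (Discrete.functor V) := ⟨⟨⟨c, hc⟩⟩⟩
        exact Limits.hasLimit_of_iso (F := Discrete.functor V) (Discrete.natIso fun _ => Iso.refl _) }

/-- The category of weight modules is abelian. -/
@[reducible] def abelian : Abelian (WeightModule r) where

lemma simple_unit : Simple (𝟙_ (WeightModule r)) where
  mono_isIso_iff_nonzero {V} f _ := by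
    constructor
    · intro _ h
      subst h
      obtain ⟨v, hv⟩ := surjective_of_epi (0 : V ⟶ 𝟙_ (WeightModule r)) (1 : ℂ)
      exact zero_ne_one (α := ℂ) hv
    · intro h
      refine isIso_of_bijective f ⟨injective_of_mono f, ?_⟩
      have h' : f.toLin ≠ 0 := fun h' => h (hom_ext h')
      exact LinearMap.surjective (f := (f.toLin : V →ₗ[ℂ] ℂ)) h'

lemma bijective_smul_id_unit :
    Function.Bijective (fun k : ℂ => k • 𝟙 (𝟙_ (WeightModule r))) := by
  constructor
  · intro a b h
    have := LinearMap.congr_fun (congrArg Hom.toLin h) (1 : ℂ)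
    simpa using this
  · intro f
    refine ⟨(f.toLin (1 : ℂ) : ℂ), hom_ext (LinearMap.ext_ring ?_)⟩
    exact mul_one (M := ℂ) (f.toLin (1 : ℂ))

end WeightModule

end Osp

end

theorem mainTheorem9 (r : ℕ) (hr : 3 ≤ r) (hr4 : ¬ r ≡ 4 [MOD 8]) (s : ℤ)
    (hs : Osp.qpow r (2 * (s : ℂ)) = 1) :
    ∃ (B : BraidedCategory (Osp.WeightModule r))
      (P : PivotalStructure (Osp.WeightModule.dual (r := r)))
      (θ : 𝟭 (Osp.WeightModule r) ≅ 𝟭 (Osp.WeightModule r)),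
      Osp.WeightModule.IsStandardBraiding B ∧
      Osp.WeightModule.IsStandardPivotal s P ∧
      (∀ V : Osp.WeightModule r, θ.hom.app V = P.ptr (B.braiding V V).hom) ∧
      (IsLinearRibbonCategory (Osp.WeightModule r) P θ ↔ s = (Osp.rbar r : ℤ)) := by
  have h4 : r ≠ 4 := by
    rintro rfl
    exact hr4 rfl
  have h0 : Osp.rbar r ≠ 0 := Osp.rbar_ne_zero hr h4
  refine ⟨Osp.WeightModule.braided hr h0, Osp.WeightModule.pivotal hs,
    Osp.WeightModule.twist hr h0 hs, Osp.WeightModule.isStandardBraiding_braided hr h0,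
    Osp.WeightModule.isStandardPivotal_pivotal hs, Osp.WeightModule.twist_app hr h0 hs,
    fun h => ?_, ?_⟩
  · refine Osp.WeightModule.eq_rbar_of_dual hr h0 hs fun V => ?_
    let := Osp.WeightModule.braided hr h0
    have hV := h.ribbon.dual V
    rw [Osp.WeightModule.twist_app, Osp.WeightModule.twist_app] at hV
    exact (congrArg Osp.WeightModule.Hom.toLin hV).trans
      (Osp.WeightModule.toLin_rightAdjointMate _)
  · rintro rfl
    let := Osp.WeightModule.braided hr h0
    refine ⟨⟨Osp.WeightModule.abelian, rfl⟩, Osp.WeightModule.simple_unit,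
      Osp.WeightModule.bijective_smul_id_unit, Osp.WeightModule.twist_tensor hr h0 hs, fun V => ?_⟩
    rw [Osp.WeightModule.twist_app, Osp.WeightModule.twist_app]
    exact Osp.WeightModule.hom_ext
      ((Osp.WeightModule.toLin_ptr_braiding_dual_of_rbar hr h0 hs V).trans
        (Osp.WeightModule.toLin_rightAdjointMate _).symm)
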